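/- Let $(M^{4n}, g_M, J_1, J_2, J_3)$ be a hyperkähler manifold of real dimension $4n$, with $J_1J_2=J_3$ (and cyclically) and Kähler forms $\sigma_i(\cdot,\cdot)=g_M(J_i\cdot,\cdot)$, $i=1,2,3$. Let $\pi: P^{4n+3}\to M$ be a smooth principal $T^3$-bundle, $T^3=(\mathbb{R}/2\pi\mathbb{Z})^3$, with an (invariant, $\mathbb{R}^3$-valued) connection form $(\alpha,\xi,\eta)$ whose curvature is given by $$d\alpha=\pi^*\sigma_1,\qquad d\xi=-\pi^*\sigma_2,\qquad d\eta=-\pi^*\sigma_3 .$$ Let $N^{4n+4}=\mathbb{R}_t\times P$ and, omitting pull-backs to $N$, put $$g_N=dt^2+4e^{4t}(\alpha^2+\xi^2+\eta^2)+e^{2t}g_M,$$ $$\omega_1=e^{2t}\sigma_1+(2e^{2t}\xi)\wedge(2e^{2t}\eta)+dt\wedge(2e^{2t}\alpha),$$ $$\omega_2=e^{2t}\sigma_2+(2e^{2t}\xi)\wedge dt+(2e^{2t}\alpha)\wedge(2e^{2t}\eta),$$ $$\omega_3=e^{2t}\sigma_3+(2e^{2t}\xi)\wedge(2e^{2t}\alpha)+(2e^{2t}\eta)\wedge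 dt,$$ $$\tilde g=e^{-\frac{4}{2n+1}t}g_N,\qquad \tilde\omega_i=e^{-\frac{4}{2n+1}t}\omega_i\quad(i=1,2,3).$$ Then for every $(a,b,c)\in\mathbb{R}^3$ with $a^2+b^2+c^2=1$, $(N,\tilde g,\,a\tilde\omega_1+b\tilde\omega_2+c\tilde\omega_3)$ is a balanced Hermitian manifold. That is, with $\tilde\omega=a\tilde\omega_1+b\tilde\omega_2+c\tilde\omega_3$: $\tilde g$ is a smooth Riemannian metric, the endomorphism field $J$ determined by $\tilde g(J\cdot,\cdot)=\tilde\omega(\cdot,\cdot)$ is a smooth integrable almost complex structure (the exterior derivative of every smooth complex $1$-form of type $(1,0)$ has no $(0,2)$-part), $\tilde g(J\cdot,J\cdot)=\tilde g$, and $d(\tilde\omega^{\,2n+1})=0$, where $2n+2$ is the complex dimension of $N$. -/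

import Mathlib

open Set Manifold Bundle
open scoped ContDiff Topology

noncomputable section

section Algebra

theorem update_castAdd_left {V : Type*} {k l : ℕ} (v : Fin (k + l) → V) (i : Fin k) (z : V) :
    (fun i' : Fin k => Function.update v (Fin.castAdd l i) z (Fin.castAdd l i'))
      = Function.update (fun i' => v (Fin.castAdd l i')) i z := by
  funext i'; simp [Function.update_apply]

theorem update_natAdd_right {V : Type*} {k l : ℕ} (v : Fin (k + l) → V) (j : Fin l) (z : V) :
    (fun j' : Fin l => Function.update v (Fin.natAdd k j) z (Fin.natAdd k j'))
      = Function.update (fun j' => v (Fin.natAdd k j')) j z := by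
  funext j'; simp [Function.update_apply]

theorem update_castAdd_right {V : Type*} {k l : ℕ} (v : Fin (k + l) → V) (i : Fin k) (z : V) :
    (fun j' : Fin l => Function.update v (Fin.castAdd l i) z (Fin.natAdd k j'))
      = fun j' => v (Fin.natAdd k j') := by
  funext j'
  rw [Function.update_of_ne]
  intro h; have := congrArg Fin.val h; simp at this; omega

theorem update_natAdd_left {V : Type*} {k l : ℕ} (v : Fin (k + l) → V) (j : Fin l) (z : V) :
    (fun i' : Fin k => Function.update v (Fin.natAdd k j) z (Fin.castAdd l i'))
      = fun i' => v (Fin.castAdd l i') := by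
  funext i'
  rw [Function.update_of_ne]
  intro h; have := congrArg Fin.val h; simp at this; omega

variable {V : Type*} [AddCommGroup V] [Module ℝ V] [TopologicalSpace V]

/-- The multilinear map `v ↦ a (v₁, …, v_k) * b (v_{k+1}, …, v_{k+l})`. -/
def formProd {k l : ℕ} (a : V [⋀^Fin k]→L[ℝ] ℝ) (b : V [⋀^Fin l]→L[ℝ] ℝ) :
    ContinuousMultilinearMap ℝ (fun _ : Fin (k + l) => V) ℝ where
  toFun v := a (fun i => v (Fin.castAdd l i)) * b (fun j => v (Fin.natAdd k j))
  map_update_add' := by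
    intro inst v i x y
    obtain rfl : inst = instDecidableEqFin (k + l) := Subsingleton.elim _ _
    refine Fin.addCases (fun i => ?_) (fun j => ?_) i
    · simp only [update_castAdd_left, update_castAdd_right, a.map_update_add, add_mul]
    · simp only [update_natAdd_left, update_natAdd_right, b.map_update_add, mul_add]
  map_update_smul' := by
    intro inst v i c x
    obtain rfl : inst = instDecidableEqFin (k + l) := Subsingleton.elim _ _
    refine Fin.addCases (fun i => ?_) (fun j => ?_) i
    · simp only [update_castAdd_left, update_castAdd_right, a.map_update_smul, smul_eq_mul,
        mul_assoc]
    · simp only [update_natAdd_left, update_natAdd_right, b.map_update_smul, smul_eq_mul,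
        mul_left_comm]
  cont := by
    refine Continuous.mul (a.cont.comp ?_) (b.cont.comp ?_) <;> fun_prop

/-- The wedge product of alternating forms, normalized so that for `1`-forms
`(a ∧ b)(v, w) = a v * b w - a w * b v`. -/
def wedge {k l : ℕ} (a : V [⋀^Fin k]→L[ℝ] ℝ) (b : V [⋀^Fin l]→L[ℝ] ℝ) :
    V [⋀^Fin (k + l)]→L[ℝ] ℝ :=
  ((k.factorial : ℝ) * (l.factorial : ℝ))⁻¹ • ContinuousMultilinearMap.alternatization (formProd a b)

/-- The `k`-fold wedge power `a ∧ ⋯ ∧ a` of a `2`-form. -/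
def wedgePow (a : V [⋀^Fin 2]→L[ℝ] ℝ) : (k : ℕ) → V [⋀^Fin (2 * k)]→L[ℝ] ℝ
  | 0 => ContinuousAlternatingMap.constOfIsEmpty ℝ V (Fin 0) 1
  | k + 1 => wedge (wedgePow a k) a

/-- The linear functional underlying an alternating `1`-form. -/
def asLinear (a : V [⋀^Fin 1]→L[ℝ] ℝ) : V →L[ℝ] ℝ :=
  (ContinuousAlternatingMap.ofSubsingleton ℝ V ℝ (0 : Fin 1)).symm a

/-- The symmetric bilinear form `a² : (v, w) ↦ a v * a w` of a `1`-form. -/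
def sqForm (a : V [⋀^Fin 1]→L[ℝ] ℝ) : V →L[ℝ] V →L[ℝ] ℝ :=
  (asLinear a).smulRight (asLinear a)

end Algebra

section Manifold

variable {E : Type*} [NormedAddCommGroup E] [NormedSpace ℝ E]
  {H : Type*} [TopologicalSpace H] (I : ModelWithCorners ℝ E H)
  (M : Type*) [TopologicalSpace M] [ChartedSpace H M]
  {E' : Type*} [NormedAddCommGroup E'] [NormedSpace ℝ E']
  {H' : Type*} [TopologicalSpace H'] (I' : ModelWithCorners ℝ E' H')
  {M' : Type*} [TopologicalSpace M'] [ChartedSpace H' M']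

/-- Differential `k`-forms on `M` with values in `F`. -/
abbrev DForm (k : ℕ) (F : Type*) [NormedAddCommGroup F] [NormedSpace ℝ F] : Type _ :=
  (x : M) → (TangentSpace I x) [⋀^Fin k]→L[ℝ] F

/-- Tensors of type `(0,2)` on `M`. -/
abbrev BilinField : Type _ :=
  (x : M) → TangentSpace I x →L[ℝ] TangentSpace I x →L[ℝ] ℝ

/-- Fields of endomorphisms of the tangent spaces of `M`. -/
abbrev EndField : Type _ :=
  (x : M) → TangentSpace I x →L[ℝ] TangentSpace I x

variable {I M}

/-- The expression of a form in the chart around `x₀`. -/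
def DForm.inChart {k : ℕ} {F : Type*} [NormedAddCommGroup F] [NormedSpace ℝ F]
    (Ω : DForm I M k F) (x₀ : M) : E → E [⋀^Fin k]→L[ℝ] F := fun y =>
  (Ω ((extChartAt I x₀).symm y)).compContinuousLinearMap
    (mfderivWithin 𝓘(ℝ, E) I (extChartAt I x₀).symm (range I) y)

/-- A form is smooth if its expressions in charts are smooth. -/
def DForm.IsSmooth {k : ℕ} {F : Type*} [NormedAddCommGroup F] [NormedSpace ℝ F]
    (Ω : DForm I M k F) : Prop :=
  ∀ x₀ : M, ContDiffOn ℝ ∞ (Ω.inChart x₀) (extChartAt I x₀).target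

/-- The exterior derivative: at `x` it is computed in the chart around `x`. -/
def DForm.d {k : ℕ} {F : Type*} [NormedAddCommGroup F] [NormedSpace ℝ F]
    (Ω : DForm I M k F) : DForm I M (k + 1) F := fun x =>
  (extDerivWithin (Ω.inChart x) (range I) (extChartAt I x x)).compContinuousLinearMap
    (mfderiv I 𝓘(ℝ, E) (extChartAt I x) x)

/-- The pull-back `f^* Ω`. -/
def DForm.pullback {k : ℕ} {F : Type*} [NormedAddCommGroup F] [NormedSpace ℝ F]
    (f : M → M') (Ω : DForm I' M' k F) : DForm I M k F := fun x =>
  (Ω (f x)).compContinuousLinearMap (mfderiv I I' f x)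

/-- The differential of a real function, as a `1`-form. -/
def DForm.ofFun (f : M → ℝ) : DForm I M 1 ℝ := fun x =>
  ContinuousAlternatingMap.ofSubsingleton ℝ (TangentSpace I x) ℝ (0 : Fin 1)
    (mfderiv I 𝓘(ℝ, ℝ) f x)

/-- The pull-back of a `(0,2)`-tensor. -/
def BilinField.pullback (f : M → M') (g : BilinField I' M') : BilinField I M := fun x =>
  (ContinuousLinearMap.precomp ℝ (mfderiv I I' f x)).comp ((g (f x)).comp (mfderiv I I' f x))

/-! ### Hermitian and hyperkähler structures -/

/-- `g` is a smooth Riemannian metric. -/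
def IsRiemannianMetric [IsManifold I ∞ M] (g : BilinField I M) : Prop :=
  ∃ G : ContMDiffRiemannianMetric I ∞ E (fun x : M => TangentSpace I x), ∀ x, G.inner x = g x

/-- `J` is a smooth almost complex structure. -/
structure IsAlmostComplex [IsManifold I ∞ M] (J : EndField I M) : Prop where
  smooth : ContMDiff I (I.prod 𝓘(ℝ, E →L[ℝ] E)) ∞
    (fun x : M => TotalSpace.mk' (E →L[ℝ] E)
      (E := fun x : M => TangentSpace I x →L[ℝ] TangentSpace I x) x (J x))
  sq : ∀ x (v : TangentSpace I x), J x (J x v) = -v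

/-- A complex `1`-form of type `(1,0)`. -/
def DForm.IsOneZero (J : EndField I M) (ψ : DForm I M 1 ℂ) : Prop :=
  ∀ x (v : TangentSpace I x), ψ x ![J x v] = Complex.I * ψ x ![v]

/-- `J` is integrable: `d (Γ(Λ^{1,0})) ⊆ Γ(Λ^{2,0} ⊕ Λ^{1,1})`. The condition on `dψ` says that
its complex bilinear extension vanishes on all pairs of `(0,1)`-vectors `v + i J v`, `w + i J w`,
that is, that its `(0,2)`-part is zero. -/
def IsIntegrable (J : EndField I M) : Prop :=
  ∀ ψ : DForm I M 1 ℂ, ψ.IsSmooth → ψ.IsOneZero J → ∀ x (v w : TangentSpace I x),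
    ψ.d x ![v, w] - ψ.d x ![J x v, J x w]
      + Complex.I * (ψ.d x ![J x v, w] + ψ.d x ![v, J x w]) = 0

/-- `(M, g, J, Ω)` is a Hermitian manifold, with `Ω(v, w) = g(J v, w)`. -/
structure IsHermitian [IsManifold I ∞ M]
    (g : BilinField I M) (J : EndField I M) (Ω : DForm I M 2 ℝ) : Prop where
  metric : IsRiemannianMetric g
  almostComplex : IsAlmostComplex J
  integrable : IsIntegrable J
  compatible : ∀ x (v w : TangentSpace I x), g x (J x v) (J x w) = g x v w
  smooth_form : Ω.IsSmooth
  form : ∀ x (v w : TangentSpace I x), Ω x ![v, w] = g x (J x v) w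

/-- `(M, g, Ω)` is a balanced Hermitian manifold of complex dimension `m`: there is a complex
structure `J` (unique, as `g(J v, w) = Ω(v, w)`) making it Hermitian, and `d(Ω^{m-1}) = 0`. -/
def IsBalancedHermitian [IsManifold I ∞ M] (m : ℕ)
    (g : BilinField I M) (Ω : DForm I M 2 ℝ) : Prop :=
  Module.finrank ℝ E = 2 * m ∧ (∃ J : EndField I M, IsHermitian g J Ω) ∧
    DForm.d (fun x => wedgePow (Ω x) (m - 1) : DForm I M (2 * (m - 1)) ℝ) = 0

/-- `(M, g, J₁, J₂, J₃)` is hyperkähler with Kähler forms `σ₁, σ₂, σ₃`. -/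
structure IsHyperKahler [IsManifold I ∞ M] (g : BilinField I M)
    (J₁ J₂ J₃ : EndField I M) (σ₁ σ₂ σ₃ : DForm I M 2 ℝ) : Prop where
  hermitian₁ : IsHermitian g J₁ σ₁
  hermitian₂ : IsHermitian g J₂ σ₂
  hermitian₃ : IsHermitian g J₃ σ₃
  mul₁₂ : ∀ x (v : TangentSpace I x), J₁ x (J₂ x v) = J₃ x v
  mul₂₃ : ∀ x (v : TangentSpace I x), J₂ x (J₃ x v) = J₁ x v
  mul₃₁ : ∀ x (v : TangentSpace I x), J₃ x (J₁ x v) = J₂ x v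
  closed₁ : σ₁.d = 0
  closed₂ : σ₂.d = 0
  closed₃ : σ₃.d = 0

/-! ### Principal torus bundles -/

/-- The torus `T³ = (ℝ/2prℤ)³`. -/
abbrev Torus3 : Type := Circle × Circle × Circle

/-- The model with corners of `T³`. -/
abbrev modelTorus3 := (𝓡 1).prod ((𝓡 1).prod (𝓡 1))

/-- The three one-parameter subgroups of `T³`. -/
def torusCurve (j : Fin 3) (s : ℝ) : Torus3 :=
  ![(Circle.exp s, 1, 1), (1, Circle.exp s, 1), (1, 1, Circle.exp s)] j

/-- `pr : P → M` is a smooth principal `T³`-bundle. -/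
structure IsPrincipalTorusBundle (I : ModelWithCorners ℝ E H) (I' : ModelWithCorners ℝ E' H') {P : Type*} [TopologicalSpace P] [ChartedSpace H' P]
    [MulAction Torus3 P] (pr : P → M) : Prop where
  smooth_proj : ContMDiff I' I ∞ pr
  smooth_action : ContMDiff (modelTorus3.prod I') I' ∞ (fun q : Torus3 × P => q.1 • q.2)
  proj_smul : ∀ (z : Torus3) (p : P), pr (z • p) = pr p
  locally_trivial : ∀ x : M, ∃ (U : Set M) (e : OpenPartialHomeomorph P (M × Torus3)),
    IsOpen U ∧ x ∈ U ∧ e.source = pr ⁻¹' U ∧ e.target = U ×ˢ univ ∧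
    ContMDiffOn I' (I.prod modelTorus3) ∞ e e.source ∧
    ContMDiffOn (I.prod modelTorus3) I' ∞ e.symm e.target ∧
    ∀ p ∈ e.source, (e p).1 = pr p ∧ ∀ z : Torus3, (e (z • p)).2 = z * (e p).2

/-- `θ = (θ₀, θ₁, θ₂)` is a connection form on a principal `T³`-bundle with total space `P`:
it is smooth and invariant, and `θ i` takes the value `δ_{ij}` on the `j`-th fundamental vector
field. -/
structure IsTorusConnection (I' : ModelWithCorners ℝ E' H') {P : Type*} [TopologicalSpace P] [ChartedSpace H' P]
    [MulAction Torus3 P] (θ : Fin 3 → DForm I' P 1 ℝ) : Prop where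
  smooth : ∀ i, (θ i).IsSmooth
  invariant : ∀ i (z : Torus3), DForm.pullback I' (fun p : P => z • p) (θ i) = θ i
  vertical : ∀ i j (p : P),
    θ i (torusCurve j 0 • p)
      ![mfderiv 𝓘(ℝ, ℝ) I' (fun s : ℝ => torusCurve j s • p) 0 (1 : ℝ)] = if i = j then 1 else 0

end Manifold

/-! ## The structures on `N = ℝ × P` -/

section Construction

variable {E : Type*} [NormedAddCommGroup E] [NormedSpace ℝ E]
  {H : Type*} [TopologicalSpace H] {I : ModelWithCorners ℝ E H}
  {M : Type*} [TopologicalSpace M] [ChartedSpace H M]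
  {E' : Type*} [NormedAddCommGroup E'] [NormedSpace ℝ E']
  {H' : Type*} [TopologicalSpace H'] {I' : ModelWithCorners ℝ E' H'}
  {P : Type*} [TopologicalSpace P] [ChartedSpace H' P]

/-- The `1`-form `dt` on `ℝ × P`. -/
def dtForm : DForm (𝓘(ℝ, ℝ).prod I') (ℝ × P) 1 ℝ := DForm.ofFun Prod.fst

/-- The pull-back of a form on `P` to `ℝ × P`. -/
def liftTotal {k : ℕ} (α : DForm I' P k ℝ) : DForm (𝓘(ℝ, ℝ).prod I') (ℝ × P) k ℝ :=
  DForm.pullback I' Prod.snd α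

/-- The pull-back of a form on `M` to `ℝ × P`. -/
def liftBase {k : ℕ} (pr : P → M) (σ : DForm I M k ℝ) : DForm (𝓘(ℝ, ℝ).prod I') (ℝ × P) k ℝ :=
  DForm.pullback I (fun q : ℝ × P => pr q.2) σ

/-- `g_N = dt² + 4 e^{4t} (α² + ξ² + η²) + e^{2t} g_M`. -/
def metricN (pr : P → M) (gM : BilinField I M) (α ξ η : DForm I' P 1 ℝ) :
    BilinField (𝓘(ℝ, ℝ).prod I') (ℝ × P) := fun q =>
  sqForm (dtForm q)
    + (4 * Real.exp (4 * q.1)) •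
        (sqForm (liftTotal α q) + sqForm (liftTotal ξ q) + sqForm (liftTotal η q))
    + Real.exp (2 * q.1) • BilinField.pullback I (fun q : ℝ × P => pr q.2) gM q

/-- `ω₁ = e^{2t} σ₁ + (2 e^{2t} ξ) ∧ (2 e^{2t} η) + dt ∧ (2 e^{2t} α)`. -/
def omega₁ (pr : P → M) (σ₁ : DForm I M 2 ℝ) (α ξ η : DForm I' P 1 ℝ) :
    DForm (𝓘(ℝ, ℝ).prod I') (ℝ × P) 2 ℝ := fun q =>
  Real.exp (2 * q.1) • liftBase pr σ₁ q
    + wedge ((2 * Real.exp (2 * q.1)) • liftTotal ξ q) ((2 * Real.exp (2 * q.1)) • liftTotal η q)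
    + wedge (dtForm q) ((2 * Real.exp (2 * q.1)) • liftTotal α q)

/-- `ω₂ = e^{2t} σ₂ + (2 e^{2t} ξ) ∧ dt + (2 e^{2t} α) ∧ (2 e^{2t} η)`. -/
def omega₂ (pr : P → M) (σ₂ : DForm I M 2 ℝ) (α ξ η : DForm I' P 1 ℝ) :
    DForm (𝓘(ℝ, ℝ).prod I') (ℝ × P) 2 ℝ := fun q =>
  Real.exp (2 * q.1) • liftBase pr σ₂ q
    + wedge ((2 * Real.exp (2 * q.1)) • liftTotal ξ q) (dtForm q)
    + wedge ((2 * Real.exp (2 * q.1)) • liftTotal α q) ((2 * Real.exp (2 * q.1)) • liftTotal η q)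

/-- `ω₃ = e^{2t} σ₃ + (2 e^{2t} ξ) ∧ (2 e^{2t} α) + (2 e^{2t} η) ∧ dt`. -/
def omega₃ (pr : P → M) (σ₃ : DForm I M 2 ℝ) (α ξ η : DForm I' P 1 ℝ) :
    DForm (𝓘(ℝ, ℝ).prod I') (ℝ × P) 2 ℝ := fun q =>
  Real.exp (2 * q.1) • liftBase pr σ₃ q
    + wedge ((2 * Real.exp (2 * q.1)) • liftTotal ξ q) ((2 * Real.exp (2 * q.1)) • liftTotal α q)
    + wedge ((2 * Real.exp (2 * q.1)) • liftTotal η q) (dtForm q)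

/-- The conformal factor `e^{-4t/(2n+1)}` on `ℝ × P`. -/
def conformalFactor (n : ℕ) (q : ℝ × P) : ℝ := Real.exp (-(4 / (2 * (n : ℝ) + 1)) * q.1)

end Construction

end

noncomputable section

section ExteriorAlgebra

open ExteriorAlgebra

variable {V : Type*} [AddCommGroup V] [Module ℝ V] [TopologicalSpace V]
  {ι : Type*} [Fintype ι]

/-- The element of the exterior algebra of the dual space which corresponds to an alternating
form, computed in a basis. -/
def extMap (b : Module.Basis ι ℝ V) (k : ℕ) :
    (V [⋀^Fin k]→L[ℝ] ℝ) →ₗ[ℝ] ExteriorAlgebra ℝ (Module.Dual ℝ V) where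
  toFun a := (k.factorial : ℝ)⁻¹ •
    ∑ h : Fin k → ι, a (fun i => b (h i)) • ιMulti ℝ k (fun i => b.coord (h i))
  map_add' a a' := by simp [add_smul, Finset.sum_add_distrib]
  map_smul' c a := by
    simp only [ContinuousAlternatingMap.smul_apply, RingHom.id_apply, smul_eq_mul, mul_smul]
    rw [← Finset.smul_sum, smul_comm]

theorem extMap_apply (b : Module.Basis ι ℝ V) {k : ℕ} (a : V [⋀^Fin k]→L[ℝ] ℝ) :
    extMap b k a = (k.factorial : ℝ)⁻¹ •
      ∑ h : Fin k → ι, a (fun i => b (h i)) • ιMulti ℝ k (fun i => b.coord (h i)) := rfl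

omit [TopologicalSpace V] in
theorem multilinear_expand (b : Module.Basis ι ℝ V) {k : ℕ} {F : Type*} [AddCommGroup F] [Module ℝ F]
    (a : MultilinearMap ℝ (fun _ : Fin k => V) F) (v : Fin k → V) :
    a v = ∑ h : Fin k → ι, (∏ i, b.repr (v i) (h i)) • a (fun i => b (h i)) := by
  classical
  conv_lhs => rw [show v = fun i => ∑ j, b.repr (v i) j • b j from
    funext fun i => (b.sum_repr (v i)).symm]
  rw [MultilinearMap.map_sum]
  exact Finset.sum_congr rfl fun h _ => MultilinearMap.map_smul_univ _ _ _

theorem extMap_injective (b : Module.Basis ι ℝ V) (k : ℕ) : Function.Injective (extMap b k) := by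
  classical
  intro a a' haa
  ext v
  let D : (Module.Dual ℝ V) [⋀^Fin k]→ₗ[ℝ] ℝ :=
    (Matrix.detRowAlternating (R := ℝ) (n := Fin k)).compLinearMap
      (LinearMap.pi fun j => Module.Dual.eval ℝ V (v j))
  let ev : ExteriorAlgebra ℝ (Module.Dual ℝ V) →ₗ[ℝ] ℝ := liftAlternating (Pi.single k D)
  have hev : ∀ θ, ev (ιMulti ℝ k θ) = D θ := fun θ => by
    simp only [ev, liftAlternating_apply_ιMulti, Pi.single_eq_same]
  have key : ∀ a : V [⋀^Fin k]→L[ℝ] ℝ, ev (extMap b k a) = a v := by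
    intro a
    rw [extMap_apply, map_smul, map_sum]
    simp only [map_smul, hev]
    have hD : ∀ h : Fin k → ι, D (fun i => b.coord (h i))
        = ∑ σ : Equiv.Perm (Fin k), (Equiv.Perm.sign σ : ℝ) * ∏ i, b.repr (v i) (h (σ i)) := by
      intro h
      exact Matrix.det_apply' (Matrix.of fun i j => b.coord (h i) (v j))
    simp only [hD, Finset.smul_sum]
    rw [Finset.sum_comm]
    have hσ : ∀ σ : Equiv.Perm (Fin k), ∑ h : Fin k → ι, a (fun i => b (h i)) •
        ((Equiv.Perm.sign σ : ℝ) * ∏ i, b.repr (v i) (h (σ i))) = a v := by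
      intro σ
      have h1 := multilinear_expand b a.toMultilinearMap v
      rw [show a v = a.toMultilinearMap v from rfl, h1]
      refine Fintype.sum_equiv (Equiv.arrowCongr σ.symm (Equiv.refl ι)) _ _ fun h => ?_
      have h2 := a.toAlternatingMap.map_perm (fun i => b (h i)) σ
      simp only [ContinuousAlternatingMap.coe_toAlternatingMap] at h2
      have h3 : (a.toMultilinearMap fun i => b ((σ.symm.arrowCongr (Equiv.refl ι)) h i))
          = (Equiv.Perm.sign σ : ℝ) * a (fun i => b (h i)) := by
        have : (a.toMultilinearMap fun i => b ((σ.symm.arrowCongr (Equiv.refl ι)) h i))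
          = a ((fun i => b (h i)) ∘ σ) := rfl
        rw [this, h2, Units.smul_def, zsmul_eq_mul]
      rw [h3]
      simp only [Equiv.arrowCongr_apply, Equiv.symm_symm, Equiv.coe_refl, Function.comp_apply,
        id_eq, smul_eq_mul]
      ring
    simp only [← Finset.smul_sum, hσ]
    rw [Finset.sum_const, Finset.card_univ, Fintype.card_perm, Fintype.card_fin, nsmul_eq_mul,
      smul_eq_mul, ← mul_assoc, inv_mul_cancel₀ (by positivity), one_mul]
  rw [← key a, ← key a', haa]

theorem formProd_apply {k l : ℕ} (a : V [⋀^Fin k]→L[ℝ] ℝ) (c : V [⋀^Fin l]→L[ℝ] ℝ)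
    (v : Fin (k + l) → V) :
    formProd a c v = a (fun i => v (Fin.castAdd l i)) * c (fun j => v (Fin.natAdd k j)) := rfl

theorem extMap_wedge (b : Module.Basis ι ℝ V) {k l : ℕ}
    (a : V [⋀^Fin k]→L[ℝ] ℝ) (c : V [⋀^Fin l]→L[ℝ] ℝ) :
    extMap b (k + l) (wedge a c) = extMap b k a * extMap b l c := by
  classical
  have h1 : ∀ σ : Equiv.Perm (Fin (k + l)),
      ∑ h : Fin (k + l) → ι, (Equiv.Perm.sign σ • formProd a c ((fun i => b (h i)) ∘ σ)) •
        ιMulti ℝ (k + l) (fun i => b.coord (h i)) =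
      ∑ h : Fin (k + l) → ι, formProd a c (fun i => b (h i)) •
        ιMulti ℝ (k + l) (fun i => b.coord (h i)) := by
    intro σ
    refine Fintype.sum_equiv (Equiv.arrowCongr σ.symm (Equiv.refl ι)) _ _ fun h => ?_
    have h2 : ιMulti ℝ (k + l) (fun i => b.coord ((σ.symm.arrowCongr (Equiv.refl ι)) h i))
        = Equiv.Perm.sign σ • ιMulti ℝ (k + l) (fun i => b.coord (h i)) :=
      (ιMulti ℝ (k + l)).map_perm (fun i => b.coord (h i)) σ
    rw [h2, smul_comm, Units.smul_def, Units.smul_def, smul_assoc]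
    rfl
  have h3 : ∑ h : Fin (k + l) → ι, formProd a c (fun i => b (h i)) •
        ιMulti ℝ (k + l) (fun i => b.coord (h i)) =
      (∑ h : Fin k → ι, a (fun i => b (h i)) • ιMulti ℝ k (fun i => b.coord (h i))) *
      (∑ h : Fin l → ι, c (fun i => b (h i)) • ιMulti ℝ l (fun i => b.coord (h i))) := by
    rw [Finset.sum_mul_sum, ← Finset.sum_product', ← Finset.univ_product_univ.symm]
    refine Fintype.sum_equiv (Fin.appendEquiv k l).symm _ _ fun h => ?_
    obtain ⟨p, rfl⟩ := (Fin.appendEquiv k l).surjective h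
    rw [Equiv.symm_apply_apply, smul_mul_smul_comm, ιMulti_mul_ιMulti]
    congr 1
    · simp [formProd_apply, Fin.appendEquiv]
    · congr 1
      funext i
      refine Fin.addCases (fun i => ?_) (fun i => ?_) i <;> simp [Fin.appendEquiv]
  rw [wedge, map_smul, extMap_apply, extMap_apply, extMap_apply, smul_mul_smul_comm, ← h3]
  simp only [ContinuousMultilinearMap.alternatization_apply_apply, Finset.sum_smul]
  rw [Finset.sum_comm]
  simp only [h1]
  rw [Finset.sum_const, Finset.card_univ, Fintype.card_perm, Fintype.card_fin, mul_inv]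
  rw [← Nat.cast_smul_eq_nsmul ℝ ((k + l).factorial), smul_smul (((k + l).factorial : ℝ)⁻¹), inv_mul_cancel₀ (by positivity),
    one_smul]

/-- `1`-forms as elements of the exterior algebra. -/
theorem extMap_one (b : Module.Basis ι ℝ V) (a : V [⋀^Fin 1]→L[ℝ] ℝ) :
    extMap b 1 a = ExteriorAlgebra.ι ℝ (∑ i, a ![b i] • b.coord i) := by
  rw [extMap_apply, Nat.factorial_one, Nat.cast_one, inv_one, one_smul, map_sum]
  refine Fintype.sum_equiv (Equiv.funUnique (Fin 1) ι) _ _ fun h => ?_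
  rw [map_smul, ιMulti_apply]
  simp
  congr 1
  congr 1
  funext i
  fin_cases i
  rfl

theorem extMap_one_mul_self (b : Module.Basis ι ℝ V) (a : V [⋀^Fin 1]→L[ℝ] ℝ) :
    extMap b 1 a * extMap b 1 a = 0 := by
  rw [extMap_one, ι_sq_zero]

omit [TopologicalSpace V] in
theorem commute_mul_ι (x y : Module.Dual ℝ V) (z : ExteriorAlgebra ℝ (Module.Dual ℝ V)) :
    Commute (ExteriorAlgebra.ι ℝ x * ExteriorAlgebra.ι ℝ y) z := by
  have anti : ∀ x y : Module.Dual ℝ V, ExteriorAlgebra.ι ℝ x * ExteriorAlgebra.ι ℝ y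
      = -(ExteriorAlgebra.ι ℝ y * ExteriorAlgebra.ι ℝ x) := fun x y =>
    eq_neg_iff_add_eq_zero.2 (ι_add_mul_swap x y)
  induction z using ExteriorAlgebra.induction with
  | algebraMap r => exact (Algebra.commutes r _).symm
  | ι w =>
    change _ * _ = _ * _
    rw [mul_assoc, anti y w, mul_neg, ← mul_assoc, anti x w, neg_mul, neg_neg, mul_assoc]
  | mul z z' h h' => exact h.mul_right h'
  | add z z' h h' => exact h.add_right h'

theorem extMap_two_commute (b : Module.Basis ι ℝ V) (a : V [⋀^Fin 2]→L[ℝ] ℝ)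
    (z : ExteriorAlgebra ℝ (Module.Dual ℝ V)) : Commute (extMap b 2 a) z := by
  rw [extMap_apply]
  refine Commute.smul_left (Commute.sum_left _ _ _ fun h _ => Commute.smul_left ?_ _) _
  rw [ιMulti_apply]
  simpa using commute_mul_ι _ _ z

theorem extMap_wedgePow (b : Module.Basis ι ℝ V) (a : V [⋀^Fin 2]→L[ℝ] ℝ) (k : ℕ) :
    extMap b (2 * k) (wedgePow a k) = extMap b 2 a ^ k := by
  induction k with
  | zero =>
    change extMap b 0 _ = _
    rw [extMap_apply]
    simp [wedgePow]
  | succ k ih =>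
    rw [pow_succ, ← ih]
    exact extMap_wedge b _ _

theorem wedge_compContinuousLinearMap {W : Type*} [AddCommGroup W] [Module ℝ W]
    [TopologicalSpace W] {k l : ℕ} (a : V [⋀^Fin k]→L[ℝ] ℝ) (c : V [⋀^Fin l]→L[ℝ] ℝ)
    (L : W →L[ℝ] V) :
    (wedge a c).compContinuousLinearMap L
      = wedge (a.compContinuousLinearMap L) (c.compContinuousLinearMap L) := by
  ext v
  simp [wedge, ContinuousMultilinearMap.alternatization_apply_apply, formProd_apply,
    Function.comp_def]

theorem wedgePow_compContinuousLinearMap {W : Type*} [AddCommGroup W] [Module ℝ W]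
    [TopologicalSpace W] (a : V [⋀^Fin 2]→L[ℝ] ℝ) (L : W →L[ℝ] V) (k : ℕ) :
    (wedgePow a k).compContinuousLinearMap L = wedgePow (a.compContinuousLinearMap L) k := by
  induction k with
  | zero => ext v; simp [wedgePow]
  | succ k ih =>
    change (wedge (wedgePow a k) a).compContinuousLinearMap L = _
    rw [wedge_compContinuousLinearMap, ih]
    rfl

theorem wedge_one_one_apply (a c : V [⋀^Fin 1]→L[ℝ] ℝ) (v w : V) :
    wedge a c ![v, w] = a ![v] * c ![w] - a ![w] * c ![v] := by
  have h : (Finset.univ : Finset (Equiv.Perm (Fin 2))) = {1, Equiv.swap 0 1} := by decide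
  have e1 : ∀ v w : V, (fun i : Fin 1 => (![v, w] : Fin 2 → V) (Fin.castAdd 1 i)) = ![v] := by
    intro v w; funext i; fin_cases i; rfl
  have e2 : ∀ v w : V, (fun i : Fin 1 => (![v, w] : Fin 2 → V) (Fin.natAdd 1 i)) = ![w] := by
    intro v w; funext i; fin_cases i; rfl
  have e3 : (![v, w] : Fin 2 → V) ∘ (Equiv.swap 0 1 : Equiv.Perm (Fin 2)) = ![w, v] := by
    funext i; fin_cases i <;> rfl
  change ((Nat.factorial 1 : ℝ) * (Nat.factorial 1 : ℝ))⁻¹ •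
    (ContinuousMultilinearMap.alternatization (formProd a c)) ![v, w] = _
  rw [ContinuousMultilinearMap.alternatization_apply_apply]
  change _ • ∑ σ : Equiv.Perm (Fin 2), _ = _
  rw [h, Finset.sum_pair (by decide)]
  have e4 : (![v, w] : Fin 2 → V) ∘ (1 : Equiv.Perm (Fin 2)) = ![v, w] := rfl
  rw [e4, e3, formProd_apply, formProd_apply, e1, e2, e1, e2]
  simp
  ring

/-- Forms of degree larger than the dimension vanish. -/
theorem eq_zero_of_finrank_lt [FiniteDimensional ℝ V] {k : ℕ} (a : V [⋀^Fin k]→L[ℝ] ℝ)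
    (hk : Module.finrank ℝ V < k) : a = 0 := by
  ext v
  refine a.toAlternatingMap.map_linearDependent v fun hv => ?_
  have := hv.fintype_card_le_finrank
  simp at this
  omega

/-- A form of top degree is multiplied by the determinant under pull-back. -/
theorem compContinuousLinearMap_eq_det_smul [FiniteDimensional ℝ V] {k : ℕ}
    (a : V [⋀^Fin k]→L[ℝ] ℝ) (hk : Module.finrank ℝ V = k) (L : V →L[ℝ] V) :
    a.compContinuousLinearMap L = LinearMap.det (L : V →ₗ[ℝ] V) • a := by
  ext v
  let e := Module.finBasisOfFinrankEq ℝ V hk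
  have h := a.toAlternatingMap.eq_smul_basis_det e
  have h' : ∀ w, a w = a e * e.det w := fun w => by
    have := congrArg (fun f : V [⋀^Fin k]→ₗ[ℝ] ℝ => f w) h
    simpa using this
  change a (L ∘ v) = LinearMap.det (L : V →ₗ[ℝ] V) * a v
  rw [h', h' v]
  have := e.det_comp (L : V →ₗ[ℝ] V) v
  rw [show (L ∘ v : Fin k → V) = (L : V →ₗ[ℝ] V) ∘ v from rfl, this]
  ring

/-- An endomorphism with square `-1` has determinant `1`. -/
theorem det_eq_one_of_sq_eq_neg_one {W : Type*} [AddCommGroup W] [Module ℝ W]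
    [FiniteDimensional ℝ W] (J : W →ₗ[ℝ] W) (hJ : J ∘ₗ J = -LinearMap.id) :
    LinearMap.det J = 1 := by
  have h1 : LinearMap.det J * LinearMap.det J = LinearMap.det (-LinearMap.id : W →ₗ[ℝ] W) := by
    rw [← LinearMap.det_comp, hJ]
  have h2 : (LinearMap.id + J) ∘ₗ (LinearMap.id + J) = (2 : ℝ) • J := by
    ext v
    have := congrArg (fun f : W →ₗ[ℝ] W => f v) hJ
    simp at this
    simp only [LinearMap.comp_apply, LinearMap.add_apply, LinearMap.id_apply, map_add, this,
      two_smul]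
    abel
  have h3 : LinearMap.det (LinearMap.id + J) * LinearMap.det (LinearMap.id + J)
      = 2 ^ Module.finrank ℝ W * LinearMap.det J := by
    rw [← LinearMap.det_comp, h2, LinearMap.det_smul]
  have h4 : LinearMap.det (-LinearMap.id : W →ₗ[ℝ] W) ^ 2 = 1 := by
    rw [sq, ← LinearMap.det_comp]; simp
  have h5 : 0 ≤ LinearMap.det J := by
    have : 0 ≤ 2 ^ Module.finrank ℝ W * LinearMap.det J := h3 ▸ mul_self_nonneg _
    exact nonneg_of_mul_nonneg_right this (by positivity)
  rw [← h1] at h4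
  have h6 : LinearMap.det J ^ 4 = 1 := by rw [← h4]; ring
  exact (pow_eq_one_iff_of_nonneg h5 (by norm_num)).1 h6

end ExteriorAlgebra

section Normed

open ExteriorAlgebra

variable {V : Type*} [NormedAddCommGroup V] [NormedSpace ℝ V]
  {ι : Type*} [Fintype ι]

theorem extMap_alternatizeUncurryFin (b : Module.Basis ι ℝ V) {k : ℕ}
    (f : V →L[ℝ] V [⋀^Fin k]→L[ℝ] ℝ) :
    extMap b (k + 1) (ContinuousAlternatingMap.alternatizeUncurryFin f)
      = ∑ i, ExteriorAlgebra.ι ℝ (b.coord i) * extMap b k (f (b i)) := by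
  have h1 : ∀ p : Fin (k + 1), ∑ h : Fin (k + 1) → ι,
      ((-1) ^ (p : ℕ) • f (b (h p)) (p.removeNth fun i => b (h i))) •
        ιMulti ℝ (k + 1) (fun i => b.coord (h i)) =
      ∑ i, ExteriorAlgebra.ι ℝ (b.coord i) *
        ∑ h : Fin k → ι, f (b i) (fun i => b (h i)) • ιMulti ℝ k (fun i => b.coord (h i)) := by
    intro p
    simp only [Finset.mul_sum]
    rw [← Fintype.sum_prod_type']
    refine Fintype.sum_equiv (Fin.insertNthEquiv (fun _ => ι) p).symm _ _ fun h => ?_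
    obtain ⟨⟨j, g⟩, rfl⟩ := (Fin.insertNthEquiv (fun _ => ι) p).surjective h
    rw [Equiv.symm_apply_apply]
    have e1 : (fun i => b.coord ((Fin.insertNthEquiv (fun _ => ι) p) (j, g) i))
        = p.insertNth (b.coord j) (fun i => b.coord (g i)) := by
      funext i
      refine Fin.succAboveCases p ?_ (fun i => ?_) i <;> simp
    have e2 : (p.removeNth fun i => b ((Fin.insertNthEquiv (fun _ => ι) p) (j, g) i))
        = fun i => b (g i) := by
      funext i
      simp [Fin.removeNth]
    rw [e1, e2, AlternatingMap.map_insertNth]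
    have e3 : ιMulti ℝ (k + 1) (Matrix.vecCons (b.coord j) fun i => b.coord (g i))
        = ExteriorAlgebra.ι ℝ (b.coord j) * ιMulti ℝ k (fun i => b.coord (g i)) := by
      rw [ιMulti_succ_apply]
      rfl
    rw [e3]
    simp only [Fin.insertNthEquiv_apply, Fin.insertNth_apply_same]
    rw [mul_smul_comm, smul_assoc, smul_comm (f _ _)]
    rcases Nat.even_or_odd (p : ℕ) with hp | hp <;> simp [hp.neg_one_pow]
  rw [extMap_apply]
  simp only [ContinuousAlternatingMap.alternatizeUncurryFin_apply, Finset.sum_smul]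
  rw [Finset.sum_comm]
  simp only [h1]
  rw [Finset.sum_const, Finset.card_univ, Fintype.card_fin, ← Nat.cast_smul_eq_nsmul ℝ, smul_smul,
    Finset.smul_sum]
  refine Finset.sum_congr rfl fun i _ => ?_
  rw [extMap_apply, mul_smul_comm]
  congr 1
  rw [Nat.factorial_succ]
  push_cast
  field_simp

end Normed

section Bilinear

variable {X : Type*} [NormedAddCommGroup X] [NormedSpace ℝ X]
  {A : Type*} [NormedAddCommGroup A] [NormedSpace ℝ A] [FiniteDimensional ℝ A]
  {B : Type*} [NormedAddCommGroup B] [NormedSpace ℝ B] [FiniteDimensional ℝ B]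
  {C : Type*} [NormedAddCommGroup C] [NormedSpace ℝ C] (β : A →ₗ[ℝ] B →ₗ[ℝ] C)

theorem isBoundedBilinearMap_of_finiteDimensional :
    IsBoundedBilinearMap ℝ (fun p : A × B => β p.1 p.2) :=
  (LinearMap.toContinuousLinearMap
    ((LinearMap.toContinuousLinearMap : (B →ₗ[ℝ] C) ≃ₗ[ℝ] (B →L[ℝ] C)).toLinearMap
      ∘ₗ β)).isBoundedBilinearMap

theorem contDiffWithinAt_bilinear {n : WithTop ℕ∞} {a : X → A} {c : X → B} {s : Set X} {x : X}
    (ha : ContDiffWithinAt ℝ n a s x) (hc : ContDiffWithinAt ℝ n c s x) :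
    ContDiffWithinAt ℝ n (fun y => β (a y) (c y)) s x :=
  (isBoundedBilinearMap_of_finiteDimensional β).contDiff.contDiffAt.comp_contDiffWithinAt x
    (ha.prodMk hc)

theorem differentiableAt_bilinear {a : X → A} {c : X → B} {x : X}
    (ha : DifferentiableAt ℝ a x) (hc : DifferentiableAt ℝ c x) :
    DifferentiableAt ℝ (fun y => β (a y) (c y)) x :=
  DifferentiableAt.comp (g := fun p : A × B => β p.1 p.2) x
    ((isBoundedBilinearMap_of_finiteDimensional β).differentiableAt (a x, c x))
    (ha.prodMk hc)

theorem fderiv_bilinear_apply {a : X → A} {c : X → B} {x : X}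
    (ha : DifferentiableAt ℝ a x) (hc : DifferentiableAt ℝ c x) (v : X) :
    fderiv ℝ (fun y => β (a y) (c y)) x v = β (a x) (fderiv ℝ c x v) + β (fderiv ℝ a x v) (c x) := by
  have h := ((isBoundedBilinearMap_of_finiteDimensional β).hasFDerivAt (a x, c x)).comp x
    (ha.hasFDerivAt.prodMk hc.hasFDerivAt)
  rw [HasFDerivAt.fderiv (f := fun y => β (a y) (c y)) h]
  rfl

end Bilinear

section Calculus

open ExteriorAlgebra

variable {V : Type*} [NormedAddCommGroup V] [NormedSpace ℝ V] [FiniteDimensional ℝ V]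
  {F : Type*} [NormedAddCommGroup F] [NormedSpace ℝ F] [FiniteDimensional ℝ F]
  {X : Type*} [NormedAddCommGroup X] [NormedSpace ℝ X]

/-- The values of a form on the tuples of basis vectors. -/
def evalBasis (k : ℕ) {ι : Type*} (b : Module.Basis ι ℝ V) :
    (V [⋀^Fin k]→L[ℝ] F) →ₗ[ℝ] ((Fin k → ι) → F) where
  toFun a h := a fun i => b (h i)
  map_add' _ _ := rfl
  map_smul' _ _ := rfl

omit [FiniteDimensional ℝ V] [FiniteDimensional ℝ F] in
theorem evalBasis_injective (k : ℕ) {ι : Type*} [Fintype ι] (b : Module.Basis ι ℝ V) :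
    Function.Injective (evalBasis (F := F) k b) := by
  intro a a' h
  ext v
  have h1 := multilinear_expand b a.toMultilinearMap v
  have h2 := multilinear_expand b a'.toMultilinearMap v
  have h3 : ∀ g : Fin k → ι, a (fun i => b (g i)) = a' (fun i => b (g i)) := congrFun h
  change a.toMultilinearMap v = a'.toMultilinearMap v
  rw [h1, h2]
  exact Finset.sum_congr rfl fun g _ => congrArg _ (h3 g)

instance finiteDimensional_continuousAlternatingMap (k : ℕ) :
    FiniteDimensional ℝ (V [⋀^Fin k]→L[ℝ] F) :=
  Module.Finite.of_injective _ (evalBasis_injective k (Module.finBasis ℝ V))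

theorem contDiffWithinAt_alternating {k : ℕ} {n : WithTop ℕ∞} {a : X → V [⋀^Fin k]→L[ℝ] F}
    {s : Set X} {x : X} (h : ∀ v, ContDiffWithinAt ℝ n (fun y => a y v) s x) :
    ContDiffWithinAt ℝ n a s x := by
  obtain ⟨g, hg⟩ := (evalBasis (F := F) k (Module.finBasis ℝ V)).exists_leftInverse_of_injective
    (LinearMap.ker_eq_bot.2 (evalBasis_injective k (Module.finBasis ℝ V)))
  have h1 : ContDiffWithinAt ℝ n
      (fun y => evalBasis (F := F) k (Module.finBasis ℝ V) (a y)) s x :=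
    contDiffWithinAt_pi.2 fun i => h _
  have h2 := (LinearMap.toContinuousLinearMap g).contDiff.contDiffAt.comp_contDiffWithinAt x h1
  refine h2.congr_of_eventuallyEq (Filter.Eventually.of_forall fun y => ?_) ?_
  · exact (congrArg (fun f => f (a y)) hg).symm
  · exact (congrArg (fun f => f (a x)) hg).symm

omit [FiniteDimensional ℝ F] in
theorem ContDiffWithinAt.alternating_apply {k : ℕ} {n : WithTop ℕ∞} {a : X → V [⋀^Fin k]→L[ℝ] F}
    {w : X → Fin k → V} {s : Set X} {x : X} (h : ContDiffWithinAt ℝ n a s x)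
    (hw : ∀ i, ContDiffWithinAt ℝ n (fun y => w y i) s x) :
    ContDiffWithinAt ℝ n (fun y => a y (w y)) s x := by
  let b := Module.finBasis ℝ V
  have h1 : ∀ y, a y (w y) = ∑ h : Fin k → Fin (Module.finrank ℝ V),
      (∏ i, LinearMap.toContinuousLinearMap (b.coord (h i)) (w y i)) • a y (fun i => b (h i)) :=
    fun y => multilinear_expand b (a y).toMultilinearMap (w y)
  simp only [h1]
  refine ContDiffWithinAt.sum fun g _ => ContDiffWithinAt.smul (contDiffWithinAt_prod fun i _ => ?_) ?_
  · exact (ContinuousLinearMap.contDiff _).contDiffAt.comp_contDiffWithinAt x (hw i)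
  · exact (ContinuousAlternatingMap.apply ℝ V F fun i => b (g i)).contDiff.contDiffAt.comp_contDiffWithinAt x h

theorem ContDiffWithinAt.compContinuousLinearMap {X' : Type*} [NormedAddCommGroup X']
    [NormedSpace ℝ X'] [FiniteDimensional ℝ X'] {k : ℕ} {n : WithTop ℕ∞}
    {a : X → V [⋀^Fin k]→L[ℝ] F} {L : X → X' →L[ℝ] V} {s : Set X} {x : X}
    (h : ContDiffWithinAt ℝ n a s x) (hL : ContDiffWithinAt ℝ n L s x) :
    ContDiffWithinAt ℝ n (fun y => (a y).compContinuousLinearMap (L y)) s x := by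
  refine contDiffWithinAt_alternating fun v => ?_
  refine h.alternating_apply (w := fun y i => L y (v i)) fun i => ?_
  exact hL.clm_apply contDiffWithinAt_const

/-- The wedge product as a bilinear map. -/
def wedgeₗ (k l : ℕ) :
    (V [⋀^Fin k]→L[ℝ] ℝ) →ₗ[ℝ] (V [⋀^Fin l]→L[ℝ] ℝ) →ₗ[ℝ] V [⋀^Fin (k + l)]→L[ℝ] ℝ :=
  LinearMap.mk₂ ℝ wedge
    (fun a a' c => by
      ext v
      simp [wedge, ContinuousMultilinearMap.alternatization_apply_apply, formProd_apply, add_mul,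
        Finset.sum_add_distrib, mul_add])
    (fun r a c => by
      ext v
      simp [wedge, ContinuousMultilinearMap.alternatization_apply_apply, formProd_apply, mul_assoc,
        Finset.mul_sum, mul_left_comm, Units.smul_def])
    (fun a c c' => by
      ext v
      simp [wedge, ContinuousMultilinearMap.alternatization_apply_apply, formProd_apply,
        Finset.sum_add_distrib, mul_add])
    (fun r a c => by
      ext v
      simp [wedge, ContinuousMultilinearMap.alternatization_apply_apply, formProd_apply, mul_assoc,
        Finset.mul_sum, mul_left_comm, Units.smul_def])

theorem ContDiffWithinAt.wedge {k l : ℕ} {n : WithTop ℕ∞} {a : X → V [⋀^Fin k]→L[ℝ] ℝ}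
    {c : X → V [⋀^Fin l]→L[ℝ] ℝ} {s : Set X} {x : X} (ha : ContDiffWithinAt ℝ n a s x)
    (hc : ContDiffWithinAt ℝ n c s x) :
    ContDiffWithinAt ℝ n (fun y => _root_.wedge (a y) (c y)) s x :=
  contDiffWithinAt_bilinear (wedgeₗ (V := V) k l) ha hc

theorem differentiableAt_wedge {k l : ℕ} {a : X → V [⋀^Fin k]→L[ℝ] ℝ}
    {c : X → V [⋀^Fin l]→L[ℝ] ℝ} {x : X} (ha : DifferentiableAt ℝ a x)
    (hc : DifferentiableAt ℝ c x) : DifferentiableAt ℝ (fun y => wedge (a y) (c y)) x :=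
  differentiableAt_bilinear (wedgeₗ (V := V) k l) ha hc

theorem fderiv_wedge_apply {k l : ℕ} {a : X → V [⋀^Fin k]→L[ℝ] ℝ}
    {c : X → V [⋀^Fin l]→L[ℝ] ℝ} {x : X} (ha : DifferentiableAt ℝ a x)
    (hc : DifferentiableAt ℝ c x) (v : X) :
    fderiv ℝ (fun y => wedge (a y) (c y)) x v
      = wedge (a x) (fderiv ℝ c x v) + wedge (fderiv ℝ a x v) (c x) :=
  fderiv_bilinear_apply (wedgeₗ (V := V) k l) ha hc v

theorem differentiableAt_wedgePow {a : X → V [⋀^Fin 2]→L[ℝ] ℝ} {x : X}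
    (ha : DifferentiableAt ℝ a x) (k : ℕ) : DifferentiableAt ℝ (fun y => wedgePow (a y) k) x := by
  induction k with
  | zero => exact differentiableAt_const _
  | succ k ih => exact differentiableAt_wedge ih ha

variable {ι : Type*} [Fintype ι] (b : Module.Basis ι ℝ V)

omit [FiniteDimensional ℝ V] in
theorem extMap_extDeriv {k : ℕ} (a : V → V [⋀^Fin k]→L[ℝ] ℝ) (x : V) :
    extMap b (k + 1) (extDeriv a x)
      = ∑ i, ExteriorAlgebra.ι ℝ (b.coord i) * extMap b k (fderiv ℝ a x (b i)) :=
  extMap_alternatizeUncurryFin b _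

omit [FiniteDimensional ℝ V] in
theorem extMap_extDeriv_smul {k : ℕ} {h : V → ℝ} {a : V → V [⋀^Fin k]→L[ℝ] ℝ} {x : V}
    {θ : V [⋀^Fin 1]→L[ℝ] ℝ} (hh : DifferentiableAt ℝ h x) (hθ : ∀ v, fderiv ℝ h x v = θ ![v])
    (ha : DifferentiableAt ℝ a x) :
    extMap b (k + 1) (extDeriv (fun y => h y • a y) x)
      = extMap b 1 θ * extMap b k (a x) + h x • extMap b (k + 1) (extDeriv a x) := by
  rw [extMap_extDeriv, extMap_extDeriv, extMap_one, map_sum, Finset.sum_mul, Finset.smul_sum,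
    ← Finset.sum_add_distrib]
  refine Finset.sum_congr rfl fun i _ => ?_
  rw [fderiv_fun_smul hh ha]
  simp only [add_apply, smul_apply,
    ContinuousLinearMap.smulRight_apply, map_add, map_smul, hθ, mul_add, smul_mul_assoc,
    mul_smul_comm]
  abel

theorem extMap_extDeriv_wedge_one {l : ℕ} {a : V → V [⋀^Fin 1]→L[ℝ] ℝ}
    {c : V → V [⋀^Fin l]→L[ℝ] ℝ} {x : V} (ha : DifferentiableAt ℝ a x)
    (hc : DifferentiableAt ℝ c x) :
    extMap b (1 + l + 1) (extDeriv (fun y => wedge (a y) (c y)) x)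
      = extMap b 2 (extDeriv a x) * extMap b l (c x)
        - extMap b 1 (a x) * extMap b (l + 1) (extDeriv c x) := by
  rw [extMap_extDeriv, extMap_extDeriv, extMap_extDeriv, Finset.sum_mul, Finset.mul_sum,
    ← Finset.sum_sub_distrib]
  refine Finset.sum_congr rfl fun i _ => ?_
  rw [fderiv_wedge_apply ha hc, map_add, extMap_wedge, extMap_wedge, mul_add, extMap_one b (a x),
    ← mul_assoc, ← mul_assoc, ← mul_assoc,
    show ExteriorAlgebra.ι ℝ (b.coord i) * ExteriorAlgebra.ι ℝ (∑ i, a x ![b i] • b.coord i)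
      = -(ExteriorAlgebra.ι ℝ (∑ i, a x ![b i] • b.coord i) * ExteriorAlgebra.ι ℝ (b.coord i)) from
      eq_neg_iff_add_eq_zero.2 (ι_add_mul_swap _ _)]
  simp only [neg_mul]
  abel

theorem extMap_extDeriv_wedgePow {a : V → V [⋀^Fin 2]→L[ℝ] ℝ} {x : V}
    (ha : DifferentiableAt ℝ a x) (k : ℕ) :
    extMap b (2 * (k + 1) + 1) (extDeriv (fun y => wedgePow (a y) (k + 1)) x)
      = ((k : ℝ) + 1) • (extMap b 3 (extDeriv a x) * extMap b 2 (a x) ^ k) := by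
  have h : ∀ k v, extMap b (2 * (k + 1)) (fderiv ℝ (fun y => wedgePow (a y) (k + 1)) x v)
      = ((k : ℝ) + 1) • (extMap b 2 (fderiv ℝ a x v) * extMap b 2 (a x) ^ k) := by
    intro k v
    have step : ∀ k, extMap b (2 * (k + 1)) (fderiv ℝ (fun y => wedgePow (a y) (k + 1)) x v)
        = extMap b 2 (a x) ^ k * extMap b 2 (fderiv ℝ a x v)
          + extMap b (2 * k) (fderiv ℝ (fun y => wedgePow (a y) k) x v) * extMap b 2 (a x) := by
      intro k
      have h1 := fderiv_wedge_apply (differentiableAt_wedgePow ha k) ha v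
      have h2 := congrArg (extMap b (2 * k + 2)) h1
      rw [map_add, extMap_wedge, extMap_wedge, extMap_wedgePow] at h2
      exact h2
    induction k with
    | zero =>
      rw [step]
      have : fderiv ℝ (fun y => wedgePow (a y) 0) x = 0 := fderiv_const_apply _
      rw [this]
      simp
    | succ k ih =>
      rw [step, ih, smul_mul_assoc, mul_assoc, ← pow_succ,
        ((extMap_two_commute b (fderiv ℝ a x v) (extMap b 2 (a x) ^ (k + 1)))).eq]
      push_cast
      module
  rw [extMap_extDeriv, extMap_extDeriv, Finset.sum_mul, Finset.smul_sum]
  refine Finset.sum_congr rfl fun i _ => ?_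
  rw [h, mul_smul_comm, mul_assoc]

end Calculus

theorem minSmoothness_two_le_infty : minSmoothness ℝ 2 ≤ (∞ : WithTop ℕ∞) := by
  rw [minSmoothness_of_isRCLikeNormedField]
  exact WithTop.coe_le_coe.2 (le_top (a := (2 : ℕ∞)))

section Charts

variable {E : Type*} [NormedAddCommGroup E] [NormedSpace ℝ E]
  {H : Type*} [TopologicalSpace H] {I : ModelWithCorners ℝ E H}
  {M : Type*} [TopologicalSpace M] [ChartedSpace H M]
  {E' : Type*} [NormedAddCommGroup E'] [NormedSpace ℝ E']
  {H' : Type*} [TopologicalSpace H'] {I' : ModelWithCorners ℝ E' H'}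
  {M' : Type*} [TopologicalSpace M'] [ChartedSpace H' M']
  {F : Type*} [NormedAddCommGroup F] [NormedSpace ℝ F]

variable (I) in
/-- The derivative at `x` of the chart around `x₀`. -/
def chartD (x₀ x : M) : TangentSpace I x →L[ℝ] E := mfderiv I 𝓘(ℝ, E) (extChartAt I x₀) x

variable (I) in
/-- The inverse of the derivative at `x` of the chart around `x₀`. -/
def chartDinv (x₀ x : M) : E →L[ℝ] TangentSpace I x := (chartD I x₀ x).inverse

variable [IsManifold I ∞ M] [IsManifold I' ∞ M']

theorem chartD_isInvertible {x₀ x : M} (hx : x ∈ (extChartAt I x₀).source) :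
    (chartD I x₀ x).IsInvertible := by
  have : IsManifold I 1 M := IsManifold.of_le (n := ∞) (by norm_num)
  exact isInvertible_mfderiv_extChartAt hx

theorem chartD_chartDinv {x₀ x : M} (hx : x ∈ (extChartAt I x₀).source) (v : E) :
    chartD I x₀ x (chartDinv I x₀ x v) = v := by
  have := (chartD_isInvertible hx).self_apply_inverse v
  exact this

theorem chartDinv_chartD {x₀ x : M} (hx : x ∈ (extChartAt I x₀).source) (v : TangentSpace I x) :
    chartDinv I x₀ x (chartD I x₀ x v) = v := by
  have := (chartD_isInvertible hx).inverse_apply_self v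
  exact this

theorem mfderivWithin_symm_eq {x₀ : M} {y : E} (hy : y ∈ (extChartAt I x₀).target) :
    mfderivWithin 𝓘(ℝ, E) I (extChartAt I x₀).symm (range I) y
      = chartDinv I x₀ ((extChartAt I x₀).symm y) := by
  have : IsManifold I 1 M := IsManifold.of_le (n := ∞) (by norm_num)
  have h := mfderivWithin_extChartAt_symm_comp_mfderiv_extChartAt (I := I) hy
  have h' := mfderiv_extChartAt_comp_mfderivWithin_extChartAt_symm (I := I) hy
  exact (ContinuousLinearMap.inverse_eq h' h).symm

theorem inChart_eq {k : ℕ} (Ω : DForm I M k F) {x₀ : M} {y : E}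
    (hy : y ∈ (extChartAt I x₀).target) :
    Ω.inChart x₀ y = (Ω ((extChartAt I x₀).symm y)).compContinuousLinearMap
      (chartDinv I x₀ ((extChartAt I x₀).symm y)) := by
  rw [DForm.inChart, mfderivWithin_symm_eq hy]

theorem inChart_apply {k : ℕ} (Ω : DForm I M k F) {x₀ x : M}
    (hx : x ∈ (extChartAt I x₀).source) (v : Fin k → E) :
    Ω.inChart x₀ (extChartAt I x₀ x) v = Ω x (fun i => chartDinv I x₀ x (v i)) := by
  rw [inChart_eq Ω ((extChartAt I x₀).map_source hx), (extChartAt I x₀).left_inv hx]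
  rfl

omit [IsManifold I ∞ M] in
theorem d_eq [I.Boundaryless] {k : ℕ} (Ω : DForm I M k F) (x : M) :
    Ω.d x = (extDeriv (Ω.inChart x) (extChartAt I x x)).compContinuousLinearMap (chartD I x x) := by
  rw [DForm.d, I.range_eq_univ, extDerivWithin_univ]
  rfl

variable (I I') in
/-- The expression of a map in charts. -/
def inCharts (f : M → M') (x₀ : M) (x₁ : M') : E → E' :=
  fun y => extChartAt I' x₁ (f ((extChartAt I x₀).symm y))

theorem contDiffAt_inCharts [I.Boundaryless] {f : M → M'} (hf : ContMDiff I I' ∞ f) {x₀ : M} {x₁ : M'} {y : E}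
    (hy : y ∈ (extChartAt I x₀).target)
    (hfy : f ((extChartAt I x₀).symm y) ∈ (extChartAt I' x₁).source) :
    ContDiffAt ℝ ∞ (inCharts I I' f x₀ x₁) y := by
  rw [← contMDiffAt_iff_contDiffAt]
  have h1 : ContMDiffAt 𝓘(ℝ, E) I ∞ (extChartAt I x₀).symm y :=
    (contMDiffOn_extChartAt_symm x₀).contMDiffAt
      ((isOpen_extChartAt_target x₀).mem_nhds hy)
  have h2 : ContMDiffAt I' 𝓘(ℝ, E') ∞ (extChartAt I' x₁) (f ((extChartAt I x₀).symm y)) :=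
    contMDiffAt_extChartAt' (by rwa [extChartAt_source] at hfy)
  exact h2.comp y ((hf _).comp y h1)

theorem fderiv_inCharts [I.Boundaryless] {f : M → M'} (hf : ContMDiff I I' ∞ f) {x₀ : M} {x₁ : M'} {y : E}
    (hy : y ∈ (extChartAt I x₀).target)
    (hfy : f ((extChartAt I x₀).symm y) ∈ (extChartAt I' x₁).source) (v : E) :
    fderiv ℝ (inCharts I I' f x₀ x₁) y v = chartD I' x₁ (f ((extChartAt I x₀).symm y))
      (mfderiv I I' f ((extChartAt I x₀).symm y) (chartDinv I x₀ ((extChartAt I x₀).symm y) v)) := by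
  have : IsManifold I 1 M := IsManifold.of_le (n := ∞) (by norm_num)
  have : IsManifold I' 1 M' := IsManifold.of_le (n := ∞) (by norm_num)
  have h1 : MDifferentiableAt 𝓘(ℝ, E) I (extChartAt I x₀).symm y := by
    have := mdifferentiableWithinAt_extChartAt_symm (I := I) hy
    rwa [I.range_eq_univ, mdifferentiableWithinAt_univ] at this
  have h2 : MDifferentiableAt I' 𝓘(ℝ, E') (extChartAt I' x₁) (f ((extChartAt I x₀).symm y)) :=
    mdifferentiableAt_extChartAt (by rwa [extChartAt_source] at hfy)
  have h3 : MDifferentiableAt I I' f ((extChartAt I x₀).symm y) :=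
    (hf _).mdifferentiableAt (by norm_num)
  have e1 : mfderiv 𝓘(ℝ, E) I (extChartAt I x₀).symm y
      = chartDinv I x₀ ((extChartAt I x₀).symm y) := by
    rw [← mfderivWithin_symm_eq hy, I.range_eq_univ, mfderivWithin_univ]
  have e2 := mfderiv_comp y h2 (h3.comp y h1)
  have e3 := mfderiv_comp y h3 h1
  rw [e3, e1] at e2
  have e4 : mfderiv 𝓘(ℝ, E) 𝓘(ℝ, E') (inCharts I I' f x₀ x₁) y = fderiv ℝ (inCharts I I' f x₀ x₁) y :=
    mfderiv_eq_fderiv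
  rw [← e4]
  exact congrArg (fun L : E →L[ℝ] E' => L v) e2

theorem inChart_pullback [I.Boundaryless] {k : ℕ} {f : M → M'} (hf : ContMDiff I I' ∞ f)
    (Ω : DForm I' M' k F) {x₀ : M} {x₁ : M'} {y : E} (hy : y ∈ (extChartAt I x₀).target)
    (hfy : f ((extChartAt I x₀).symm y) ∈ (extChartAt I' x₁).source) :
    (DForm.pullback I' f Ω : DForm I M k F).inChart x₀ y
      = (Ω.inChart x₁ (inCharts I I' f x₀ x₁ y)).compContinuousLinearMap
        (fderiv ℝ (inCharts I I' f x₀ x₁) y) := by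
  rw [inChart_eq _ hy]
  ext v
  change Ω (f ((extChartAt I x₀).symm y)) _ = Ω.inChart x₁ (inCharts I I' f x₀ x₁ y) _
  rw [inCharts, inChart_apply Ω hfy]
  congr 1
  funext i
  have := fderiv_inCharts hf hy hfy (v i)
  change mfderiv I I' f ((extChartAt I x₀).symm y) (chartDinv I x₀ ((extChartAt I x₀).symm y) (v i))
    = chartDinv I' x₁ (f ((extChartAt I x₀).symm y)) (fderiv ℝ (inCharts I I' f x₀ x₁) y (v i))
  rw [this, chartDinv_chartD hfy]

theorem eventually_inChart_pullback [I.Boundaryless] {k : ℕ} {f : M → M'}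
    (hf : ContMDiff I I' ∞ f)
    (Ω : DForm I' M' k F) {x₀ : M} {x₁ : M'} {y : E} (hy : y ∈ (extChartAt I x₀).target)
    (hfy : f ((extChartAt I x₀).symm y) ∈ (extChartAt I' x₁).source) :
    (DForm.pullback I' f Ω : DForm I M k F).inChart x₀
      =ᶠ[𝓝 y] fun y => (Ω.inChart x₁ (inCharts I I' f x₀ x₁ y)).compContinuousLinearMap
        (fderiv ℝ (inCharts I I' f x₀ x₁) y) := by
  have h1 : ContinuousAt (fun y => f ((extChartAt I x₀).symm y)) y :=
    hf.continuous.continuousAt.comp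
      ((continuousOn_extChartAt_symm x₀).continuousAt ((isOpen_extChartAt_target x₀).mem_nhds hy))
  filter_upwards [(isOpen_extChartAt_target x₀).mem_nhds hy,
    h1.preimage_mem_nhds ((isOpen_extChartAt_source x₁).mem_nhds hfy)] with z hz hz'
  exact inChart_pullback hf Ω hz hz'

omit [IsManifold I ∞ M] in
theorem DForm.IsSmooth.contDiffAt [I.Boundaryless] {k : ℕ} {Ω : DForm I M k F} (h : Ω.IsSmooth) {x₀ : M} {y : E}
    (hy : y ∈ (extChartAt I x₀).target) : ContDiffAt ℝ ∞ (Ω.inChart x₀) y :=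
  (h x₀).contDiffAt ((isOpen_extChartAt_target x₀).mem_nhds hy)

theorem DForm.IsSmooth.pullback [FiniteDimensional ℝ E] [FiniteDimensional ℝ E']
    [FiniteDimensional ℝ F] [I.Boundaryless] [I'.Boundaryless] {k : ℕ} {f : M → M'}
    (hf : ContMDiff I I' ∞ f) {Ω : DForm I' M' k F} (hΩ : Ω.IsSmooth) :
    (DForm.pullback I' f Ω : DForm I M k F).IsSmooth := by
  intro x₀ y hy
  have hfy := mem_extChartAt_source (I := I') (f ((extChartAt I x₀).symm y))
  refine ContDiffAt.contDiffWithinAt (ContDiffAt.congr_of_eventuallyEq ?_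
    (eventually_inChart_pullback hf Ω hy hfy))
  have hF := contDiffAt_inCharts hf hy hfy
  have h1 : ContDiffAt ℝ ∞ (Ω.inChart (f ((extChartAt I x₀).symm y)))
      (inCharts I I' f x₀ (f ((extChartAt I x₀).symm y)) y) :=
    hΩ.contDiffAt ((extChartAt I' (f ((extChartAt I x₀).symm y))).map_source hfy)
  have h2 : ContDiffAt ℝ ∞ (fun z => Ω.inChart (f ((extChartAt I x₀).symm y))
      (inCharts I I' f x₀ (f ((extChartAt I x₀).symm y)) z)) y := ContDiffAt.comp y h1 hF
  exact ContDiffWithinAt.compContinuousLinearMap h2 (hF.fderiv_right (by norm_num))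

/-- The exterior derivative commutes with pull-backs, in any chart. -/
theorem extDeriv_inChart_pullback [I.Boundaryless] [I'.Boundaryless] {k : ℕ} {f : M → M'}
    (hf : ContMDiff I I' ∞ f) {Ω : DForm I' M' k F} (hΩ : Ω.IsSmooth)
    {x₀ : M} {y : E} (hy : y ∈ (extChartAt I x₀).target) :
    extDeriv ((DForm.pullback I' f Ω : DForm I M k F).inChart x₀) y
      = (DForm.pullback I' f Ω.d : DForm I M (k + 1) F).inChart x₀ y := by
  have hfy := mem_extChartAt_source (I := I') (f ((extChartAt I x₀).symm y))
  have hF := contDiffAt_inCharts hf hy hfy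
  have h1 : ContDiffAt ℝ ∞ (Ω.inChart (f ((extChartAt I x₀).symm y)))
      (inCharts I I' f x₀ (f ((extChartAt I x₀).symm y)) y) :=
    hΩ.contDiffAt ((extChartAt I' (f ((extChartAt I x₀).symm y))).map_source hfy)
  rw [(eventually_inChart_pullback hf Ω hy hfy).extDeriv_eq,
    extDeriv_pullback (h1.differentiableAt (by norm_num)) hF minSmoothness_two_le_infty, inChart_eq _ hy]
  ext v
  change extDeriv (Ω.inChart _) (inCharts I I' f x₀ _ y) _ = Ω.d (f ((extChartAt I x₀).symm y)) _
  rw [d_eq]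
  change _ = extDeriv (Ω.inChart _) (inCharts I I' f x₀ _ y) _
  congr 1
  funext i
  exact fderiv_inCharts hf hy hfy (v i)

end Charts

theorem contDiffAt_clm {X V W : Type*} [NormedAddCommGroup X] [NormedSpace ℝ X]
    [NormedAddCommGroup V] [NormedSpace ℝ V] [FiniteDimensional ℝ V]
    [NormedAddCommGroup W] [NormedSpace ℝ W] {f : X → V →L[ℝ] W} {n : WithTop ℕ∞} {x : X}
    (h : ∀ v, ContDiffAt ℝ n (fun y => f y v) x) : ContDiffAt ℝ n f x := by
  let d := Module.finrank ℝ V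
  have hd : d = Module.finrank ℝ (Fin d → ℝ) := (Module.finrank_fin_fun ℝ).symm
  let e₁ := ContinuousLinearEquiv.ofFinrankEq hd
  let e₂ := (e₁.arrowCongr (1 : W ≃L[ℝ] W)).trans (ContinuousLinearEquiv.piRing (Fin d))
  rw [← Function.id_comp f, ← e₂.symm_comp_self]
  exact e₂.symm.contDiff.contDiffAt.comp x (contDiffAt_pi.mpr fun i => h _)

section Sections

variable {E : Type*} [NormedAddCommGroup E] [NormedSpace ℝ E]
  {H : Type*} [TopologicalSpace H] {I : ModelWithCorners ℝ E H}
  {M : Type*} [TopologicalSpace M] [ChartedSpace H M]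
  {E' : Type*} [NormedAddCommGroup E'] [NormedSpace ℝ E']
  {H' : Type*} [TopologicalSpace H'] {I' : ModelWithCorners ℝ E' H'}
  {M' : Type*} [TopologicalSpace M'] [ChartedSpace H' M']

/-- The expression of a `(0,2)`-tensor in the chart around `x₀`. -/
def BilinField.inChart (g : BilinField I M) (x₀ : M) : E → E →L[ℝ] E →L[ℝ] ℝ := fun y =>
  (ContinuousLinearMap.precomp ℝ (chartDinv I x₀ ((extChartAt I x₀).symm y))).comp
    ((g ((extChartAt I x₀).symm y)).comp (chartDinv I x₀ ((extChartAt I x₀).symm y)))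

/-- A `(0,2)`-tensor is smooth if its expressions in charts are smooth. -/
def BilinField.IsSmooth (g : BilinField I M) : Prop :=
  ∀ x₀ : M, ContDiffOn ℝ ∞ (g.inChart x₀) (extChartAt I x₀).target

/-- The expression of a field of endomorphisms in the chart around `x₀`. -/
def EndField.inChart (J : EndField I M) (x₀ : M) : E → E →L[ℝ] E := fun y =>
  (chartD I x₀ ((extChartAt I x₀).symm y)).comp
    ((J ((extChartAt I x₀).symm y)).comp (chartDinv I x₀ ((extChartAt I x₀).symm y)))

theorem BilinField.inChart_apply (g : BilinField I M) {x₀ x : M}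
    (hx : x ∈ (extChartAt I x₀).source) (v w : E) :
    g.inChart x₀ (extChartAt I x₀ x) v w = g x (chartDinv I x₀ x v) (chartDinv I x₀ x w) := by
  rw [BilinField.inChart, (extChartAt I x₀).left_inv hx]
  rfl

theorem EndField.inChart_apply (J : EndField I M) {x₀ x : M}
    (hx : x ∈ (extChartAt I x₀).source) (v : E) :
    J.inChart x₀ (extChartAt I x₀ x) v = chartD I x₀ x (J x (chartDinv I x₀ x v)) := by
  rw [EndField.inChart, (extChartAt I x₀).left_inv hx]
  rfl

variable [IsManifold I ∞ M] [IsManifold I' ∞ M']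

theorem continuousLinearMapAt_eq_chartD {x₀ x : M} (hx : x ∈ (chartAt H x₀).source) (v : TangentSpace I x) :
    (trivializationAt E (TangentSpace I) x₀).continuousLinearMapAt ℝ x v = chartD I x₀ x v := by
  have : IsManifold I 1 M := IsManifold.of_le (n := ∞) (by norm_num)
  exact congrArg (fun L : TangentSpace I x →L[ℝ] E => L v)
    (TangentBundle.continuousLinearMapAt_trivializationAt hx)

theorem symmL_eq_chartDinv {x₀ x : M} (hx : x ∈ (chartAt H x₀).source) (v : E) :
    (trivializationAt E (TangentSpace I) x₀).symmL ℝ x v = chartDinv I x₀ x v := by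
  have h1 : x ∈ (extChartAt I x₀).source := by rwa [extChartAt_source]
  have h2 : x ∈ (trivializationAt E (TangentSpace I) x₀).baseSet := by
    rwa [TangentBundle.trivializationAt_baseSet]
  rw [← chartDinv_chartD h1 ((trivializationAt E (TangentSpace I) x₀).symmL ℝ x v),
    ← continuousLinearMapAt_eq_chartD hx,
    (trivializationAt E (TangentSpace I) x₀).continuousLinearMapAt_symmL h2]

theorem contMDiffOn_comp_extChartAt_iff {G : Type*} [NormedAddCommGroup G] [NormedSpace ℝ G]
    [I.Boundaryless] {x₀ : M} {c : M → G} :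
    ContMDiffOn I 𝓘(ℝ, G) ∞ c (extChartAt I x₀).source ↔
      ContDiffOn ℝ ∞ (fun y => c ((extChartAt I x₀).symm y)) (extChartAt I x₀).target := by
  rw [← contMDiffOn_iff_contDiffOn]
  constructor
  · intro h
    exact h.comp (contMDiffOn_extChartAt_symm x₀) fun y hy => (extChartAt I x₀).map_target hy
  · intro h
    have h1 : ContMDiffOn I 𝓘(ℝ, E) ∞ (extChartAt I x₀) (extChartAt I x₀).source := by
      rw [extChartAt_source]; exact contMDiffOn_extChartAt
    refine (h.comp h1 fun x hx => (extChartAt I x₀).map_source hx).congr fun x hx => ?_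
    change c x = c ((extChartAt I x₀).symm (extChartAt I x₀ x))
    rw [(extChartAt I x₀).left_inv hx]

set_option synthInstance.maxHeartbeats 400000 in
theorem BilinField.contMDiffOn_iff [I.Boundaryless] (g : BilinField I M) (x₀ : M) :
    ContMDiffOn I (I.prod 𝓘(ℝ, E →L[ℝ] E →L[ℝ] ℝ)) ∞
      (fun x : M => TotalSpace.mk' (E →L[ℝ] E →L[ℝ] ℝ)
        (E := fun x : M => TangentSpace I x →L[ℝ] TangentSpace I x →L[ℝ] ℝ) x (g x))
      (extChartAt I x₀).source ↔
    ContDiffOn ℝ ∞ (g.inChart x₀) (extChartAt I x₀).target := by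
  let e := trivializationAt (E →L[ℝ] E →L[ℝ] ℝ)
    (fun x : M => TangentSpace I x →L[ℝ] TangentSpace I x →L[ℝ] Bundle.Trivial M ℝ x) x₀
  have hb : (extChartAt I x₀).source ⊆ e.baseSet := by
    intro x hx
    rw [extChartAt_source] at hx
    simp [e, hx]
  refine (e.contMDiffOn_section_iff (isOpen_extChartAt_source x₀) hb).trans ?_
  rw [contMDiffOn_comp_extChartAt_iff]
  refine contDiffOn_congr fun y hy => ?_
  have hx : (extChartAt I x₀).symm y ∈ (extChartAt I x₀).source := (extChartAt I x₀).map_target hy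
  have hx' : (extChartAt I x₀).symm y ∈ (chartAt H x₀).source := by rwa [← extChartAt_source I]
  have hx'' : (extChartAt I x₀).symm y ∈ (trivializationAt E (TangentSpace I) x₀).baseSet := by
    rwa [TangentBundle.trivializationAt_baseSet]
  ext v w
  have h := inCoordinates_apply_eq₂ (𝕜 := ℝ) (E₃ := Bundle.Trivial M ℝ) (F₃ := ℝ)
    (ϕ := g ((extChartAt I x₀).symm y)) (v := v) (w := w)
    hx'' hx'' (by simp)
  refine h.trans ?_
  have h1 := symmL_eq_chartDinv (I := I) hx' v
  have h2 := symmL_eq_chartDinv (I := I) hx' w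
  rw [Trivialization.symmL_apply _ hx''] at h1 h2
  rw [h1, h2]
  simp
  rfl

theorem EndField.contMDiffOn_iff [I.Boundaryless] (J : EndField I M) (x₀ : M) :
    ContMDiffOn I (I.prod 𝓘(ℝ, E →L[ℝ] E)) ∞
      (fun x : M => TotalSpace.mk' (E →L[ℝ] E)
        (E := fun x : M => TangentSpace I x →L[ℝ] TangentSpace I x) x (J x))
      (extChartAt I x₀).source ↔
    ContDiffOn ℝ ∞ (J.inChart x₀) (extChartAt I x₀).target := by
  let e := trivializationAt (E →L[ℝ] E)
    (fun x : M => TangentSpace I x →L[ℝ] TangentSpace I x) x₀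
  have hb : (extChartAt I x₀).source ⊆ e.baseSet := by
    intro x hx
    rw [extChartAt_source] at hx
    simp [e, hx]
  refine (e.contMDiffOn_section_iff (isOpen_extChartAt_source x₀) hb).trans ?_
  rw [contMDiffOn_comp_extChartAt_iff]
  refine contDiffOn_congr fun y hy => ?_
  have hx : (extChartAt I x₀).symm y ∈ (extChartAt I x₀).source := (extChartAt I x₀).map_target hy
  have hx' : (extChartAt I x₀).symm y ∈ (chartAt H x₀).source := by rwa [← extChartAt_source I]
  ext v
  change (trivializationAt E (TangentSpace I) x₀).continuousLinearMapAt ℝ _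
    (J _ ((trivializationAt E (TangentSpace I) x₀).symmL ℝ _ v)) = _
  rw [continuousLinearMapAt_eq_chartD hx', symmL_eq_chartDinv hx']
  rfl

omit [IsManifold I ∞ M] in
theorem contMDiff_of_contMDiffOn_source {G : Type*} [TopologicalSpace G] {EG : Type*}
    [NormedAddCommGroup EG] [NormedSpace ℝ EG] {HG : Type*} [TopologicalSpace HG]
    {IG : ModelWithCorners ℝ EG HG} [ChartedSpace HG G] {c : M → G}
    (h : ∀ x₀, ContMDiffOn I IG ∞ c (extChartAt I x₀).source) : ContMDiff I IG ∞ c := fun x =>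
  (h x).contMDiffAt ((isOpen_extChartAt_source x).mem_nhds (mem_extChartAt_source x))

theorem IsRiemannianMetric.isSmooth [I.Boundaryless] {g : BilinField I M}
    (h : IsRiemannianMetric g) : g.IsSmooth := by
  obtain ⟨G, hG⟩ := h
  obtain rfl : G.inner = g := funext hG
  exact fun x₀ => (BilinField.contMDiffOn_iff _ x₀).1 G.contMDiff.contMDiffOn

theorem isVonNBounded_of_posDef {V : Type*} [NormedAddCommGroup V] [NormedSpace ℝ V]
    [FiniteDimensional ℝ V] (g : V →L[ℝ] V →L[ℝ] ℝ) (hpos : ∀ v, v ≠ 0 → 0 < g v v) :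
    Bornology.IsVonNBounded ℝ {v : V | g v v < 1} := by
  rw [NormedSpace.isVonNBounded_iff']
  rcases subsingleton_or_nontrivial V with hV | hV
  · exact ⟨0, fun v _ => by simp [Subsingleton.elim v 0]⟩
  have hc : IsCompact (Metric.sphere (0 : V) 1) := isCompact_sphere 0 1
  have hne : (Metric.sphere (0 : V) 1).Nonempty := by simp
  obtain ⟨u, hu, hmin⟩ := hc.exists_isMinOn hne
    (f := fun v => g v v) ((g.continuous.clm_apply continuous_id).continuousOn)
  have hu0 : u ≠ 0 := by
    rintro rfl
    simp at hu
  have hm := hpos u hu0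
  refine ⟨Real.sqrt (1 / g u u), fun v hv => ?_⟩
  rcases eq_or_ne v 0 with rfl | hv0
  · rw [norm_zero]; positivity
  have hvn : 0 < ‖v‖ := norm_pos_iff.2 hv0
  have h1 : g u u ≤ g (‖v‖⁻¹ • v) (‖v‖⁻¹ • v) := hmin (by
    simp [norm_smul, hvn.ne'])
  simp only [map_smul, smul_apply, smul_eq_mul] at h1
  have hv1 : g v v < 1 := hv
  have h2 : g u u * ‖v‖ ^ 2 ≤ g v v := by
    calc g u u * ‖v‖ ^ 2 ≤ (‖v‖⁻¹ * (‖v‖⁻¹ * g v v)) * ‖v‖ ^ 2 := by gcongr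
      _ = g v v := by field_simp
  apply Real.le_sqrt_of_sq_le
  rw [le_div_iff₀ hm]
  linarith

theorem isRiemannianMetric_of_isSmooth [FiniteDimensional ℝ E] [I.Boundaryless]
    {g : BilinField I M} (h : g.IsSmooth) (hsymm : ∀ x v w, g x v w = g x w v)
    (hpos : ∀ x v, v ≠ 0 → 0 < g x v v) : IsRiemannianMetric g :=
  ⟨{ inner := g
     symm := hsymm
     pos := hpos
     isVonNBounded := fun x => isVonNBounded_of_posDef (V := E) (g x) (hpos x)
     contMDiff := contMDiff_of_contMDiffOn_source fun x₀ =>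
       (BilinField.contMDiffOn_iff g x₀).2 (h x₀) }, fun _ => rfl⟩

theorem BilinField.IsSmooth.pullback [FiniteDimensional ℝ E] [FiniteDimensional ℝ E']
    [I.Boundaryless] [I'.Boundaryless] {f : M → M'} (hf : ContMDiff I I' ∞ f)
    {g : BilinField I' M'} (hg : g.IsSmooth) :
    (BilinField.pullback I' f g : BilinField I M).IsSmooth := by
  intro x₀ y hy
  set x₁ := f ((extChartAt I x₀).symm y) with hx₁
  have hfy : f ((extChartAt I x₀).symm y) ∈ (extChartAt I' x₁).source := mem_extChartAt_source _
  have hF := contDiffAt_inCharts hf hy hfy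
  have hD : ContDiffAt ℝ ∞ (fderiv ℝ (inCharts I I' f x₀ x₁)) y := hF.fderiv_right (by norm_num)
  have h1 : ContDiffAt ℝ ∞ (g.inChart x₁) (inCharts I I' f x₀ x₁ y) :=
    (hg x₁).contDiffAt ((isOpen_extChartAt_target x₁).mem_nhds
      ((extChartAt I' x₁).map_source hfy))
  have h2 : ContDiffAt ℝ ∞ (fun z => g.inChart x₁ (inCharts I I' f x₀ x₁ z)) y :=
    ContDiffAt.comp y h1 hF
  have hc : ContinuousAt (fun y => f ((extChartAt I x₀).symm y)) y :=
    hf.continuous.continuousAt.comp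
      ((continuousOn_extChartAt_symm x₀).continuousAt ((isOpen_extChartAt_target x₀).mem_nhds hy))
  have hev : (BilinField.pullback I' f g : BilinField I M).inChart x₀ =ᶠ[𝓝 y] fun z =>
      (ContinuousLinearMap.precomp ℝ (fderiv ℝ (inCharts I I' f x₀ x₁) z)).comp
        ((g.inChart x₁ (inCharts I I' f x₀ x₁ z)).comp (fderiv ℝ (inCharts I I' f x₀ x₁) z)) := by
    filter_upwards [(isOpen_extChartAt_target x₀).mem_nhds hy,
      hc.preimage_mem_nhds ((isOpen_extChartAt_source x₁).mem_nhds hfy)] with z hz hz'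
    ext v w
    change g _ (mfderiv I I' f _ (chartDinv I x₀ _ v)) (mfderiv I I' f _ (chartDinv I x₀ _ w))
      = g.inChart x₁ (inCharts I I' f x₀ x₁ z) (fderiv ℝ (inCharts I I' f x₀ x₁) z v)
        (fderiv ℝ (inCharts I I' f x₀ x₁) z w)
    rw [fderiv_inCharts hf hz hz', fderiv_inCharts hf hz hz', inCharts,
      BilinField.inChart_apply g hz', chartDinv_chartD hz', chartDinv_chartD hz']
  refine ContDiffAt.contDiffWithinAt (ContDiffAt.congr_of_eventuallyEq ?_ hev)
  refine contDiffAt_clm fun v => contDiffAt_clm fun w => ?_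
  change ContDiffAt ℝ ∞ (fun z => g.inChart x₁ (inCharts I I' f x₀ x₁ z)
    (fderiv ℝ (inCharts I I' f x₀ x₁) z v) (fderiv ℝ (inCharts I I' f x₀ x₁) z w)) y
  exact (h2.clm_apply (hD.clm_apply contDiffAt_const)).clm_apply (hD.clm_apply contDiffAt_const)

end Sections

section Nijenhuis

variable {E : Type*} [NormedAddCommGroup E] [NormedSpace ℝ E]
  {F : Type*} [NormedAddCommGroup F] [NormedSpace ℝ F]

/-- The Nijenhuis tensor of a field `J` of endomorphisms of a vector space, from the value
and the derivative of `J` at a point. -/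
def nijenhuis (J : E →L[ℝ] E) (J' : E →L[ℝ] E →L[ℝ] E) (v w : E) : E :=
  J' (J v) w - J' (J w) v - J (J' v w) + J (J' w v)

/-- The values of the Nijenhuis tensor are measured by the `(0,2)`-part of the derivative of
the forms of type `(1,0)`. -/
theorem apply_nijenhuis {ψ : E → E →L[ℝ] F} {ψ' : E →L[ℝ] E →L[ℝ] F} {J : E → E →L[ℝ] E}
    {J' : E →L[ℝ] E →L[ℝ] E} {y : E} (hψ : HasFDerivAt ψ ψ' y) (hJ : HasFDerivAt J J' y)
    (K : F →L[ℝ] F) (hK : ∀ f, K (K f) = -f) (h : ∀ᶠ z in 𝓝 y, ∀ w, ψ z (J z w) = K (ψ z w))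
    (v w : E) :
    (ψ' v w - ψ' w v) - (ψ' (J y v) (J y w) - ψ' (J y w) (J y v))
      + K ((ψ' (J y v) w - ψ' w (J y v)) + (ψ' v (J y w) - ψ' (J y w) v))
      = ψ y (nijenhuis (J y) J' v w) := by
  have key : ∀ u w, ψ' u (J y w) = K (ψ' u w) - ψ y (J' u w) := by
    intro u w
    have h1 : HasFDerivAt (fun z => ψ z (J z w)) _ y :=
      hψ.clm_apply (hJ.clm_apply (hasFDerivAt_const w y))
    have h2 : HasFDerivAt (fun z => K (ψ z w)) _ y :=
      K.hasFDerivAt.comp y (hψ.clm_apply (hasFDerivAt_const w y))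
    have h3 : (fun z => ψ z (J z w)) =ᶠ[𝓝 y] fun z => K (ψ z w) := h.mono fun z hz => hz w
    have h4 := congrArg (fun L : E →L[ℝ] F => L u) ((h1.congr_of_eventuallyEq h3.symm).unique h2)
    simp at h4
    rw [← h4]
    abel
  have hy := h.self_of_nhds
  have key' : ∀ x, ψ y (J y x) = K (ψ y x) := hy
  simp only [nijenhuis, map_add, map_sub, key, key', hK]
  abel

variable [FiniteDimensional ℝ E] [FiniteDimensional ℝ F]

/-- A `1`-form as a linear map. -/
def oneFormL : (E [⋀^Fin 1]→L[ℝ] F) →L[ℝ] E →L[ℝ] F :=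
  LinearMap.toContinuousLinearMap
    { toFun := fun a => (ContinuousAlternatingMap.ofSubsingleton ℝ E F (0 : Fin 1)).symm a
      map_add' := fun _ _ => rfl
      map_smul' := fun _ _ => rfl }

theorem oneFormL_apply (a : E [⋀^Fin 1]→L[ℝ] F) (v : E) : oneFormL a v = a ![v] := by
  change a _ = _
  congr 1
  funext i
  fin_cases i
  rfl

/-- The contraction of a `2`-form with a vector. -/
def contractL (u : E) : (E [⋀^Fin 2]→L[ℝ] F) →L[ℝ] E →L[ℝ] F :=
  LinearMap.toContinuousLinearMap
    { toFun := fun S => oneFormL (S.curryLeft u)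
      map_add' := fun S S' => by
        rw [← map_add]; rfl
      map_smul' := fun c S => by
        rw [RingHom.id_apply, ← map_smul]; rfl }

theorem contractL_apply (u : E) (S : E [⋀^Fin 2]→L[ℝ] F) (v : E) :
    contractL u S v = S ![u, v] := by
  change oneFormL (S.curryLeft u) v = _
  rw [oneFormL_apply]
  rfl

omit [FiniteDimensional ℝ E] [FiniteDimensional ℝ F] in
theorem extDeriv_one_apply (a : E → E [⋀^Fin 1]→L[ℝ] F) (y v w : E) :
    extDeriv a y ![v, w] = fderiv ℝ a y v ![w] - fderiv ℝ a y w ![v] := by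
  rw [extDeriv, ContinuousAlternatingMap.alternatizeUncurryFin_apply, Fin.sum_univ_two]
  have h0 : Fin.removeNth 0 ![v, w] = ![w] := by funext i; fin_cases i; rfl
  have h1 : Fin.removeNth 1 ![v, w] = ![v] := by funext i; fin_cases i; rfl
  simp [h0, h1, sub_eq_add_neg]

omit [FiniteDimensional ℝ E] [FiniteDimensional ℝ F] in
theorem extDeriv_two_apply (S : E → E [⋀^Fin 2]→L[ℝ] F) (y u v w : E) :
    extDeriv S y ![u, v, w]
      = fderiv ℝ S y u ![v, w] - fderiv ℝ S y v ![u, w] + fderiv ℝ S y w ![u, v] := by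
  rw [extDeriv, ContinuousAlternatingMap.alternatizeUncurryFin_apply, Fin.sum_univ_three]
  have h0 : Fin.removeNth 0 ![u, v, w] = ![v, w] := by funext i; fin_cases i <;> rfl
  have h1 : Fin.removeNth 1 ![u, v, w] = ![u, w] := by funext i; fin_cases i <;> rfl
  have h2 : Fin.removeNth 2 ![u, v, w] = ![u, v] := by funext i; fin_cases i <;> rfl
  simp [h0, h1, h2, sub_eq_add_neg]

omit [FiniteDimensional ℝ E] [FiniteDimensional ℝ F] in
theorem two_form_swap (S : E [⋀^Fin 2]→L[ℝ] F) (v w : E) : S ![v, w] = -S ![w, v] := by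
  have h := S.map_swap ![w, v] (show (0 : Fin 2) ≠ 1 by decide)
  have e : (![w, v] : Fin 2 → E) ∘ (Equiv.swap 0 1 : Equiv.Perm (Fin 2)) = ![v, w] := by
    funext i; fin_cases i <;> rfl
  rw [e] at h
  exact h

/-- Multiplication by `i` on `ℝ × ℝ`. -/
def rotL : ℝ × ℝ →L[ℝ] ℝ × ℝ :=
  (-ContinuousLinearMap.snd ℝ ℝ ℝ).prod (ContinuousLinearMap.fst ℝ ℝ ℝ)

theorem rotL_rotL (f : ℝ × ℝ) : rotL (rotL f) = -f := rfl

/-- The real part of `apply_nijenhuis` for the `1`-form `a + i c`. -/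
theorem apply_nijenhuis_fst {a c : E → E →L[ℝ] ℝ} {a' c' : E →L[ℝ] E →L[ℝ] ℝ}
    {J : E → E →L[ℝ] E} {J' : E →L[ℝ] E →L[ℝ] E} {y : E} (ha : HasFDerivAt a a' y)
    (hc : HasFDerivAt c c' y) (hJ : HasFDerivAt J J' y)
    (h : ∀ᶠ z in 𝓝 y, ∀ w, a z (J z w) = -c z w ∧ c z (J z w) = a z w) (v w : E) :
    (a' v w - a' w v) - (a' (J y v) (J y w) - a' (J y w) (J y v))
      - ((c' (J y v) w - c' w (J y v)) + (c' v (J y w) - c' (J y w) v))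
      = a y (nijenhuis (J y) J' v w) := by
  let ψ : E → E →L[ℝ] ℝ × ℝ := fun z => (a z).prod (c z)
  let P : (E →L[ℝ] ℝ) × (E →L[ℝ] ℝ) →L[ℝ] E →L[ℝ] ℝ × ℝ :=
    LinearMap.toContinuousLinearMap
      { toFun := fun p => p.1.prod p.2
        map_add' := fun _ _ => rfl
        map_smul' := fun _ _ => rfl }
  have hψ : HasFDerivAt ψ (P.comp (a'.prod c')) y := P.hasFDerivAt.comp y (ha.prodMk hc)
  have := apply_nijenhuis hψ hJ rotL rotL_rotL
    (h.mono fun z hz w => Prod.ext (hz w).1 (hz w).2) v w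
  have hP : ∀ u w, P.comp (a'.prod c') u w = (a' u w, c' u w) := fun _ _ => rfl
  have hψy : (ψ y (nijenhuis (J y) J' v w)).1 = a y (nijenhuis (J y) J' v w) := rfl
  have h1 := congrArg Prod.fst this
  rw [hψy] at h1
  simp only [hP] at h1
  simp only [rotL, ContinuousLinearMap.prod_apply, neg_apply, ContinuousLinearMap.coe_snd',
    ContinuousLinearMap.coe_fst', Prod.fst_add, Prod.fst_sub, Prod.snd_add, Prod.snd_sub] at h1
  rw [← h1, sub_eq_add_neg]

end Nijenhuis

section NijenhuisVanishing

variable {E : Type*} [NormedAddCommGroup E] [NormedSpace ℝ E] [FiniteDimensional ℝ E]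

theorem extDeriv_nijenhuis {a c : E → E [⋀^Fin 1]→L[ℝ] ℝ}
    {J : E → E →L[ℝ] E} {J' : E →L[ℝ] E →L[ℝ] E} {y : E} (ha : DifferentiableAt ℝ a y)
    (hc : DifferentiableAt ℝ c y) (hJ : HasFDerivAt J J' y)
    (h : ∀ᶠ z in 𝓝 y, ∀ w, a z ![J z w] = -c z ![w] ∧ c z ![J z w] = a z ![w]) (v w : E) :
    extDeriv a y ![v, w] - extDeriv a y ![J y v, J y w]
      - (extDeriv c y ![J y v, w] + extDeriv c y ![v, J y w])
      = a y ![nijenhuis (J y) J' v w] := by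
  have h1 := apply_nijenhuis_fst (oneFormL.hasFDerivAt.comp y ha.hasFDerivAt)
    (oneFormL.hasFDerivAt.comp y hc.hasFDerivAt) hJ
    (h.mono fun z hz w => by simpa only [Function.comp_apply, oneFormL_apply] using hz w) v w
  simp only [Function.comp_apply, ContinuousLinearMap.comp_apply, oneFormL_apply] at h1
  rw [← h1]
  simp only [extDeriv_one_apply]

omit [FiniteDimensional ℝ E] in
theorem extDeriv_smul_one_apply {l : E → ℝ} {a : E → E [⋀^Fin 1]→L[ℝ] ℝ} {y : E}
    (hl : DifferentiableAt ℝ l y) (ha : DifferentiableAt ℝ a y) (v w : E) :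
    extDeriv (fun z => l z • a z) y ![v, w]
      = fderiv ℝ l y v * a y ![w] - fderiv ℝ l y w * a y ![v] + l y * extDeriv a y ![v, w] := by
  rw [extDeriv_one_apply, extDeriv_one_apply, fderiv_fun_smul hl ha]
  simp only [add_apply, smul_apply, ContinuousLinearMap.smulRight_apply,
    ContinuousAlternatingMap.add_apply, ContinuousAlternatingMap.smul_apply, smul_eq_mul]
  ring

omit [FiniteDimensional ℝ E] in
theorem two_form_relations_right {S₂ S₃ : E [⋀^Fin 2]→L[ℝ] ℝ} {J : E →L[ℝ] E}
    (h : ∀ v w, S₂ ![J v, w] = -S₃ ![v, w] ∧ S₃ ![J v, w] = S₂ ![v, w]) (v w : E) :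
    S₂ ![v, J w] = -S₃ ![v, w] ∧ S₃ ![v, J w] = S₂ ![v, w] := by
  constructor
  · rw [two_form_swap S₂, (h w v).1, two_form_swap S₃ w, neg_neg]
  · rw [two_form_swap S₃, (h w v).2, two_form_swap S₂ w, neg_neg]

/-- If the closed form `S₂ + i S₃` has type `(2,0)`, then it annihilates the Nijenhuis tensor. -/
theorem contract_nijenhuis {S₂ S₃ : E → E [⋀^Fin 2]→L[ℝ] ℝ}
    {J : E → E →L[ℝ] E} {J' : E →L[ℝ] E →L[ℝ] E} {y : E} (h₂ : DifferentiableAt ℝ S₂ y)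
    (h₃ : DifferentiableAt ℝ S₃ y) (d₂ : extDeriv S₂ y = 0) (d₃ : extDeriv S₃ y = 0)
    (hJ : HasFDerivAt J J' y)
    (h : ∀ᶠ z in 𝓝 y, ∀ v w, S₂ z ![J z v, w] = -S₃ z ![v, w] ∧ S₃ z ![J z v, w] = S₂ z ![v, w])
    (u v w : E) : S₂ y ![u, nijenhuis (J y) J' v w] = 0 := by
  have hr : ∀ᶠ z in 𝓝 y, ∀ v w,
      S₂ z ![v, J z w] = -S₃ z ![v, w] ∧ S₃ z ![v, J z w] = S₂ z ![v, w] := by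
    filter_upwards [h] with z hz v w
    exact two_form_relations_right hz v w
  have h1 := apply_nijenhuis_fst ((contractL u).hasFDerivAt.comp y h₂.hasFDerivAt)
    ((contractL u).hasFDerivAt.comp y h₃.hasFDerivAt) hJ
    (hr.mono fun z hz w => by simpa only [Function.comp_apply, contractL_apply] using hz u w) v w
  simp only [Function.comp_apply, ContinuousLinearMap.comp_apply, contractL_apply] at h1
  rw [← h1]
  have curl : ∀ S : E → E [⋀^Fin 2]→L[ℝ] ℝ, extDeriv S y = 0 → ∀ v w,
      fderiv ℝ S y v ![u, w] - fderiv ℝ S y w ![u, v] = fderiv ℝ S y u ![v, w] := by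
    intro S hS v w
    have h0 : extDeriv S y ![u, v, w] = 0 := by rw [hS]; rfl
    rw [extDeriv_two_apply] at h0
    linarith
  rw [curl S₂ d₂, curl S₂ d₂, curl S₃ d₃, curl S₃ d₃]
  have D : ∀ S : E → E [⋀^Fin 2]→L[ℝ] ℝ, DifferentiableAt ℝ S y → ∀ v w,
      HasFDerivAt (fun z => S z ![v, J z w])
        ((contractL v (S y)).comp ((ContinuousLinearMap.apply ℝ E w).comp J')
          + ((ContinuousLinearMap.apply ℝ ℝ (J y w)).comp
            ((contractL v).comp (fderiv ℝ S y)))) y := by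
    intro S hS v w
    have h2 := ((contractL v).hasFDerivAt.comp y hS.hasFDerivAt).clm_apply
      (hJ.clm_apply (hasFDerivAt_const w y))
    simp only [Function.comp_apply, contractL_apply] at h2
    refine h2.congr_fderiv ?_
    ext x
    simp
  have D0 : ∀ S : E → E [⋀^Fin 2]→L[ℝ] ℝ, DifferentiableAt ℝ S y → ∀ v w,
      HasFDerivAt (fun z => S z ![v, w])
        ((ContinuousLinearMap.apply ℝ ℝ w).comp ((contractL v).comp (fderiv ℝ S y))) y := by
    intro S hS v w
    have h2 := ((contractL v).hasFDerivAt.comp y hS.hasFDerivAt).clm_apply (hasFDerivAt_const w y)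
    simp only [Function.comp_apply, contractL_apply] at h2
    refine h2.congr_fderiv ?_
    ext x
    simp
  have e1 : ∀ v w, S₂ y ![v, J' u w] + fderiv ℝ S₂ y u ![v, J y w]
      = -(fderiv ℝ S₃ y u ![v, w]) := by
    intro v w
    have h3 : (fun z => S₂ z ![v, J z w]) =ᶠ[𝓝 y] fun z => -S₃ z ![v, w] :=
      hr.mono fun z hz => (hz v w).1
    have h4 := ((D S₂ h₂ v w).congr_of_eventuallyEq h3.symm).unique (D0 S₃ h₃ v w).neg
    have h5 := congrArg (fun L : E →L[ℝ] ℝ => L u) h4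
    simpa [contractL_apply] using h5
  have e2 : ∀ v w, S₃ y ![v, J' u w] + fderiv ℝ S₃ y u ![v, J y w]
      = fderiv ℝ S₂ y u ![v, w] := by
    intro v w
    have h3 : (fun z => S₃ z ![v, J z w]) =ᶠ[𝓝 y] fun z => S₂ z ![v, w] :=
      hr.mono fun z hz => (hz v w).2
    have h4 := ((D S₃ h₃ v w).congr_of_eventuallyEq h3.symm).unique (D0 S₂ h₂ v w)
    have h5 := congrArg (fun L : E →L[ℝ] ℝ => L u) h4
    simpa [contractL_apply] using h5
  have e3 := e1 (J y v) w
  have e4 := e2 v w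
  have e5 := (h.self_of_nhds v (J' u w)).1
  linarith

theorem nijenhuis_eq_zero {T A₁ A₂ A₃ : E → E [⋀^Fin 1]→L[ℝ] ℝ}
    {S₁ S₂ S₃ : E → E [⋀^Fin 2]→L[ℝ] ℝ} {l : E → ℝ}
    {J : E → E →L[ℝ] E} {J' : E →L[ℝ] E →L[ℝ] E} {y : E}
    (hT : DifferentiableAt ℝ T y) (dT : extDeriv T y = 0)
    (hl : DifferentiableAt ℝ l y) (hl' : ∀ v, fderiv ℝ l y v = 2 * l y * T y ![v]) (hl0 : l y ≠ 0)
    (h₁ : DifferentiableAt ℝ A₁ y) (h₂ : DifferentiableAt ℝ A₂ y) (h₃ : DifferentiableAt ℝ A₃ y)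
    (d₁ : extDeriv A₁ y = S₁ y) (d₂ : extDeriv A₂ y = S₂ y) (d₃ : extDeriv A₃ y = S₃ y)
    (hS₂ : DifferentiableAt ℝ S₂ y) (hS₃ : DifferentiableAt ℝ S₃ y)
    (dS₂ : extDeriv S₂ y = 0) (dS₃ : extDeriv S₃ y = 0)
    (hJ : HasFDerivAt J J' y)
    (hr₁ : ∀ᶠ z in 𝓝 y, ∀ v, T z ![J z v] = -(l z * A₁ z ![v]) ∧ l z * A₁ z ![J z v] = T z ![v])
    (hr₂ : ∀ᶠ z in 𝓝 y, ∀ v, A₂ z ![J z v] = -A₃ z ![v] ∧ A₃ z ![J z v] = A₂ z ![v])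
    (hr₃ : ∀ᶠ z in 𝓝 y, ∀ v w,
      S₂ z ![J z v, w] = -S₃ z ![v, w] ∧ S₃ z ![J z v, w] = S₂ z ![v, w])
    (hr₄ : ∀ v w, S₁ y ![J y v, J y w] = S₁ y ![v, w])
    (hJ2 : ∀ v, J y (J y v) = -v)
    (nondeg : ∀ v, T y ![v] = 0 → A₁ y ![v] = 0 → A₂ y ![v] = 0 → A₃ y ![v] = 0 →
      (∀ u, S₂ y ![u, v] = 0) → v = 0) (v w : E) : nijenhuis (J y) J' v w = 0 := by
  have neg1 : ∀ (a : E [⋀^Fin 1]→L[ℝ] ℝ) v, (-a) ![v] = -(a ![v]) := fun _ _ => rfl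
  have dneg : ∀ a : E → E [⋀^Fin 1]→L[ℝ] ℝ, extDeriv (fun z => -a z) y = -extDeriv a y := by
    intro a
    have := extDeriv_smul (x := y) (-1 : ℝ) a
    rw [neg_smul, one_smul, neg_smul, one_smul] at this
    exact this
  have neg2 : ∀ (S : E [⋀^Fin 2]→L[ℝ] ℝ) v w, (-S) ![v, w] = -(S ![v, w]) := fun _ _ _ => rfl
  have hlA : DifferentiableAt ℝ (fun z => l z • A₁ z) y := hl.smul h₁
  have c : ∀ v w, extDeriv (fun z => l z • A₁ z) y ![v, w]
      = 2 * (T y ![v] * (l y * A₁ y ![w]) - T y ![w] * (l y * A₁ y ![v])) + l y * S₁ y ![v, w] := by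
    intro v w
    rw [extDeriv_smul_one_apply hl h₁, hl', hl', d₁]
    ring
  have r1 := hr₁.self_of_nhds
  have cJ : ∀ v w, extDeriv (fun z => l z • A₁ z) y ![J y v, J y w]
      = extDeriv (fun z => l z • A₁ z) y ![v, w] := by
    intro v w
    rw [c, c, hr₄, (r1 v).1, (r1 w).1, (r1 v).2, (r1 w).2]
    ring
  have cJ' : extDeriv (fun z => l z • A₁ z) y ![J y v, w]
      = -extDeriv (fun z => l z • A₁ z) y ![v, J y w] := by
    rw [← cJ v (J y w), hJ2 w, ← contractL_apply, ← contractL_apply, map_neg, neg_neg]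
  have r2 := hr₃.self_of_nhds
  have r2' : ∀ v w, S₂ y ![v, J y w] = -S₃ y ![v, w] ∧ S₃ y ![v, J y w] = S₂ y ![v, w] :=
    two_form_relations_right r2
  apply nondeg
  · rw [← extDeriv_nijenhuis hT hlA hJ hr₁, dT, cJ']
    simp
  · have := extDeriv_nijenhuis (c := fun z => -T z) hlA hT.neg hJ
      (hr₁.mono fun z hz w => ⟨by rw [neg1, neg_neg]; exact (hz w).2, by
        rw [neg1, (hz w).1, neg_neg]; rfl⟩) v w
    rw [cJ, dneg, dT] at this
    have h0 : l y * A₁ y ![nijenhuis (J y) J' v w] = 0 := by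
      refine Eq.trans this.symm ?_
      simp
    exact (mul_eq_zero.1 h0).resolve_left hl0
  · rw [← extDeriv_nijenhuis h₂ h₃ hJ hr₂, d₂, d₃, (r2 v w).2, (r2 v _).1]
    ring
  · rw [← extDeriv_nijenhuis (c := fun z => -A₂ z) h₃ h₂.neg hJ
      (hr₂.mono fun z hz w => ⟨by rw [neg1, neg_neg]; exact (hz w).2, by
        rw [neg1, (hz w).1, neg_neg]⟩), d₃, dneg, d₂, neg2, neg2, (r2 v _).2, (r2 v w).1]
    ring
  · exact fun u => contract_nijenhuis hS₂ hS₃ dS₂ dS₃ hJ hr₃ u v w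

end NijenhuisVanishing

section BalancedAlgebra

variable {R : Type*} [Ring R]

theorem add_pow_succ_of_sq_zero {σ G : R} (hG : ∀ z, Commute G z) (h : G * G = 0) (N : ℕ) :
    (σ + G) ^ (N + 1) = σ ^ (N + 1) + (N + 1) • (σ ^ N * G) := by
  induction N with
  | zero => simp
  | succ N ih =>
    rw [pow_succ, ih, mul_add, add_mul, add_mul, smul_mul_assoc, smul_mul_assoc, mul_assoc _ G G, h,
      mul_zero, smul_zero, add_zero, mul_assoc, (hG σ).eq, ← mul_assoc, ← pow_succ, ← pow_succ,
      succ_nsmul (σ ^ (N + 1) * G) (N + 1)]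
    abel

theorem mul_pow_congr {x u w : R} (hw : ∀ z, Commute w z) (h : x * u = x * w) (N : ℕ) :
    x * u ^ N = x * w ^ N := by
  induction N with
  | zero => simp
  | succ N ih =>
    rw [pow_succ, ← mul_assoc, ih, mul_assoc, ((hw u).pow_left N).eq, ← mul_assoc, h, mul_assoc,
      ← pow_succ']

theorem mul_add_pow_eq_zero {s σ H : R} (hH : ∀ z, Commute H z) (h : H * H = 0) (n : ℕ)
    (hs : ∀ N, 2 * n ≤ N + 1 → s * σ ^ N = 0) : s * (σ + H) ^ (2 * n) = 0 := by
  rcases n with _ | m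
  · simpa using hs 0 (by omega)
  · rw [show 2 * (m + 1) = (2 * m + 1) + 1 by ring, add_pow_succ_of_sq_zero hH h, mul_add,
      mul_smul_comm, ← mul_assoc, hs _ (by omega), hs _ (by omega)]
    simp

variable [Algebra ℝ R]

/-- The algebraic identity behind `d (ω ^ (2 n + 1)) = 0`. -/
theorem balanced_identity (n : ℕ) {τ a₁ a₂ a₃ s₁ s₂ s₃ : R} (μ k : ℝ)
    (hk : k * (2 * n + 1) = -4)
    (hττ : τ * τ = 0) (h₂₂ : a₂ * a₂ = 0) (h₃₃ : a₃ * a₃ = 0)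
    (c₂₃ : ∀ z, Commute (a₂ * a₃) z) (c₁ : ∀ z, Commute (τ * a₁) z)
    (cs₁ : ∀ z, Commute s₁ z) (cs₂ : ∀ z, Commute s₂ z) (cs₃ : ∀ z, Commute s₃ z)
    (hs₁ : ∀ N, 2 * n ≤ N → s₁ * s₁ ^ N = 0)
    (hs₂ : ∀ N, 2 * n ≤ N + 1 → s₂ * s₁ ^ N = 0)
    (hs₃ : ∀ N, 2 * n ≤ N + 1 → s₃ * s₁ ^ N = 0) :
    ((k * μ) • (τ * s₁) + ((k + 4) * (4 * μ ^ 2)) • (τ * (a₂ * a₃))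
      + (4 * μ ^ 2) • (s₂ * a₃ - a₂ * s₃))
      * (μ • s₁ + (4 * μ ^ 2) • (a₂ * a₃) + (2 * μ) • (τ * a₁)) ^ (2 * n) = 0 := by
  set σ := μ • s₁ with hσ
  set G := (4 * μ ^ 2) • (a₂ * a₃) with hG
  set H := (2 * μ) • (τ * a₁) with hH
  have cσ : ∀ z, Commute σ z := fun z => (cs₁ z).smul_left _
  have cG : ∀ z, Commute G z := fun z => (c₂₃ z).smul_left _
  have cH : ∀ z, Commute H z := fun z => (c₁ z).smul_left _
  have hGG : G * G = 0 := by
    have q : a₂ * a₃ * (a₂ * a₃) = 0 := by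
      rw [(c₂₃ (a₂ * a₃)).eq, mul_assoc, ← (c₂₃ a₃).eq, mul_assoc, h₃₃, mul_zero, mul_zero]
    rw [hG, smul_mul_smul_comm, q, smul_zero]
  have hHH : H * H = 0 := by
    have q : τ * a₁ * (τ * a₁) = 0 := by
      rw [mul_assoc, ← (c₁ a₁).eq, mul_assoc τ a₁ a₁, ← mul_assoc τ τ, hττ, zero_mul]
    rw [hH, smul_mul_smul_comm, q, smul_zero]
  have hτH : τ * H = 0 := by rw [hH, mul_smul_comm, ← mul_assoc, hττ]; simp
  have h3G : a₃ * G = 0 := by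
    rw [hG, mul_smul_comm, ← (c₂₃ a₃).eq, mul_assoc, h₃₃]; simp
  have h2G : a₂ * G = 0 := by rw [hG, mul_smul_comm, ← mul_assoc, h₂₂]; simp
  have hsig : ∀ (s : R) N, s * s₁ ^ N = 0 → s * σ ^ N = 0 := fun s N h => by
    rw [hσ, smul_pow, mul_smul_comm, h, smul_zero]
  have e1 : τ * (σ + G + H) ^ (2 * n) = τ * (σ + G) ^ (2 * n) :=
    mul_pow_congr (fun z => (cσ z).add_left (cG z)) (by rw [mul_add _ _ H, hτH, add_zero]) _
  have e2 : ∀ x, x * G = 0 → x * (σ + G + H) ^ (2 * n) = x * (σ + H) ^ (2 * n) := fun x hx =>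
    mul_pow_congr (fun z => (cσ z).add_left (cH z)) (by simp only [mul_add, hx, add_zero]) _
  have e3 : s₂ * a₃ * (σ + G + H) ^ (2 * n) = 0 := by
    rw [mul_assoc, e2 a₃ h3G, ← mul_assoc, (cs₂ a₃).eq, mul_assoc,
      mul_add_pow_eq_zero cH hHH n fun N hN => hsig _ _ (hs₂ N hN), mul_zero]
  have e4 : a₂ * s₃ * (σ + G + H) ^ (2 * n) = 0 := by
    rw [← (cs₃ a₂).eq, mul_assoc, e2 a₂ h2G, ← mul_assoc, (cs₃ a₂).eq, mul_assoc,
      mul_add_pow_eq_zero cH hHH n fun N hN => hsig _ _ (hs₃ N hN), mul_zero]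
  have hσn : σ ^ (2 * n + 1) = 0 := by
    have h := hs₁ (2 * n) le_rfl
    rw [← pow_succ'] at h
    rw [hσ, smul_pow, h, smul_zero]
  have e5 : (σ + G) ^ (2 * n + 1) = (2 * (n : ℝ) + 1) • (σ ^ (2 * n) * G) := by
    rw [add_pow_succ_of_sq_zero cG hGG, hσn, zero_add, ← Nat.cast_smul_eq_nsmul ℝ]
    push_cast
    rfl
  have e6 : G * (σ + G) ^ (2 * n) = σ ^ (2 * n) * G := by
    rw [mul_pow_congr cσ (by rw [mul_add, hGG, add_zero]), (cG _).eq]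
  have e7 : (k * μ) • (τ * s₁) + ((k + 4) * (4 * μ ^ 2)) • (τ * (a₂ * a₃))
      = τ * (k • (σ + G) + (4 : ℝ) • G) := by
    rw [hσ, hG]
    simp only [smul_add, mul_add, mul_smul_comm, smul_smul]
    module
  have e8 : τ * (k • (σ + G) + (4 : ℝ) • G) * (σ + G + H) ^ (2 * n) = 0 := by
    have c : ∀ z, Commute (k • (σ + G) + (4 : ℝ) • G) z := fun z =>
      (((cσ z).add_left (cG z)).smul_left k).add_left ((cG z).smul_left 4)
    rw [← (c τ).eq, mul_assoc, e1, ← mul_assoc, (c τ).eq, mul_assoc, add_mul, smul_mul_assoc,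
      smul_mul_assoc, ← pow_succ', e5, e6, smul_smul, hk, ← add_smul]
    simp
  rw [e7, add_mul, e8, smul_mul_assoc, sub_mul, e3, e4]
  simp

end BalancedAlgebra

section BalancedCalculus

variable {E : Type*} [NormedAddCommGroup E] [NormedSpace ℝ E] [FiniteDimensional ℝ E]

open ExteriorAlgebra

omit [FiniteDimensional ℝ E] in
theorem extMap_one_mul_one_commute {ι : Type*} [Fintype ι] (b : Module.Basis ι ℝ E)
    (a c : E [⋀^Fin 1]→L[ℝ] ℝ) (z : ExteriorAlgebra ℝ (Module.Dual ℝ E)) :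
    Commute (extMap b 1 a * extMap b 1 c) z := by
  rw [extMap_one, extMap_one]
  exact commute_mul_ι _ _ z

theorem extDeriv_wedgePow_eq_zero (n : ℕ) {T A₁ A₂ A₃ : E → E [⋀^Fin 1]→L[ℝ] ℝ}
    {S₁ S₂ S₃ : E → E [⋀^Fin 2]→L[ℝ] ℝ} {μ f : E → ℝ} {k : ℝ} {y : E}
    (hk : k * (2 * n + 1) = -4)
    (hT : DifferentiableAt ℝ T y) (dT : extDeriv T y = 0)
    (hμ : DifferentiableAt ℝ μ y) (hμ' : ∀ v, fderiv ℝ μ y v = 2 * μ y * T y ![v])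
    (hf : DifferentiableAt ℝ f y) (hf' : ∀ v, fderiv ℝ f y v = k * f y * T y ![v])
    (h₁ : DifferentiableAt ℝ A₁ y) (h₂ : DifferentiableAt ℝ A₂ y) (h₃ : DifferentiableAt ℝ A₃ y)
    (d₁ : extDeriv A₁ y = S₁ y) (d₂ : extDeriv A₂ y = S₂ y) (d₃ : extDeriv A₃ y = S₃ y)
    (hS₁ : DifferentiableAt ℝ S₁ y) (dS₁ : extDeriv S₁ y = 0)
    (hs₁ : ∀ N, 2 * n ≤ N → wedge (S₁ y) (wedgePow (S₁ y) N) = 0)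
    (hs₂ : ∀ N, 2 * n ≤ N + 1 → wedge (S₂ y) (wedgePow (S₁ y) N) = 0)
    (hs₃ : ∀ N, 2 * n ≤ N + 1 → wedge (S₃ y) (wedgePow (S₁ y) N) = 0) :
    extDeriv (fun z => wedgePow (f z • (μ z • S₁ z
      + wedge ((2 * μ z) • A₂ z) ((2 * μ z) • A₃ z) + wedge (T z) ((2 * μ z) • A₁ z))) (2 * n + 1)) y
      = 0 := by
  let b := Module.finBasis ℝ E
  let X : ∀ k, (E [⋀^Fin k]→L[ℝ] ℝ) →ₗ[ℝ] ExteriorAlgebra ℝ (Module.Dual ℝ E) := extMap b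
  have hform : ∀ z, f z • (μ z • S₁ z
      + wedge ((2 * μ z) • A₂ z) ((2 * μ z) • A₃ z) + wedge (T z) ((2 * μ z) • A₁ z))
      = (f z * μ z) • S₁ z + (f z * (4 * μ z ^ 2)) • wedge (A₂ z) (A₃ z)
        + (f z * (2 * μ z)) • wedge (T z) (A₁ z) := by
    intro z
    have e1 : wedge ((2 * μ z) • A₂ z) ((2 * μ z) • A₃ z)
        = (4 * μ z ^ 2) • wedge (A₂ z) (A₃ z) := by
      change wedgeₗ 1 1 _ _ = _ • wedgeₗ 1 1 _ _
      rw [map_smul, map_smul, LinearMap.smul_apply, smul_smul]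
      ring_nf
    have e2 : wedge (T z) ((2 * μ z) • A₁ z) = (2 * μ z) • wedge (T z) (A₁ z) := by
      change wedgeₗ 1 1 _ _ = _ • wedgeₗ 1 1 _ _
      rw [map_smul]
    rw [e1, e2, smul_add, smul_add, smul_smul, smul_smul, smul_smul]
  simp only [hform]
  have w₂₃ := differentiableAt_wedge h₂ h₃
  have w₁ := differentiableAt_wedge hT h₁
  have g₁ : DifferentiableAt ℝ (fun z => f z * μ z) y := hf.mul hμ
  have hm : DifferentiableAt ℝ (fun z => μ z ^ 2) y := hμ.pow 2
  have hm4 : DifferentiableAt ℝ (fun z => 4 * μ z ^ 2) y := hm.const_mul 4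
  have g₂ : DifferentiableAt ℝ (fun z => f z * (4 * μ z ^ 2)) y := hf.mul hm4
  have g₃ : DifferentiableAt ℝ (fun z => f z * (2 * μ z)) y := hf.mul (hμ.const_mul 2)
  have sm : ∀ (r : ℝ) (a : E [⋀^Fin 1]→L[ℝ] ℝ) v, (r • a) ![v] = r * a ![v] := fun _ _ _ => rfl
  have t₁ : ∀ v, fderiv ℝ (fun z => f z * μ z) y v = (((k + 2) * (f y * μ y)) • T y) ![v] := by
    intro v
    rw [fderiv_fun_mul hf hμ]
    simp only [add_apply, smul_apply, smul_eq_mul, hf', hμ', sm]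
    ring
  have t₂ : ∀ v, fderiv ℝ (fun z => f z * (4 * μ z ^ 2)) y v
      = (((k + 4) * (f y * (4 * μ y ^ 2))) • T y) ![v] := by
    intro v
    rw [fderiv_fun_mul hf hm4, fderiv_const_mul hm, fderiv_fun_pow 2 hμ]
    simp only [add_apply, smul_apply, smul_eq_mul, hf', hμ', sm]
    ring
  have t₃ : ∀ v, fderiv ℝ (fun z => f z * (2 * μ z)) y v
      = (((k + 2) * (f y * (2 * μ y))) • T y) ![v] := by
    intro v
    rw [fderiv_fun_mul hf (hμ.const_mul 2), fderiv_const_mul hμ]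
    simp only [add_apply, smul_apply, smul_eq_mul, hf', hμ', sm]
    ring
  have k₁ : DifferentiableAt ℝ (fun z => (f z * μ z) • S₁ z) y := g₁.smul hS₁
  have k₂ : DifferentiableAt ℝ (fun z => (f z * (4 * μ z ^ 2)) • wedge (A₂ z) (A₃ z)) y :=
    g₂.smul w₂₃
  have k₃ : DifferentiableAt ℝ (fun z => (f z * (2 * μ z)) • wedge (T z) (A₁ z)) y := g₃.smul w₁
  have k₁₂ : DifferentiableAt ℝ
      (fun z => (f z * μ z) • S₁ z + (f z * (4 * μ z ^ 2)) • wedge (A₂ z) (A₃ z)) y := k₁.add k₂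
  have D : DifferentiableAt ℝ
      (fun z => (f z * μ z) • S₁ z + (f z * (4 * μ z ^ 2)) • wedge (A₂ z) (A₃ z)
        + (f z * (2 * μ z)) • wedge (T z) (A₁ z)) y := k₁₂.add k₃
  apply extMap_injective b
  have hTT := extMap_one_mul_self b (T y)
  rw [map_zero]
  refine (extMap_extDeriv_wedgePow b D (2 * n)).trans ?_
  have hd : X 3 (extDeriv (fun z => (f z * μ z) • S₁ z + (f z * (4 * μ z ^ 2)) • wedge (A₂ z) (A₃ z)
        + (f z * (2 * μ z)) • wedge (T z) (A₁ z)) y)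
      = f y • ((k * μ y) • (X 1 (T y) * X 2 (S₁ y))
        + ((k + 4) * (4 * μ y ^ 2)) • (X 1 (T y) * (X 1 (A₂ y) * X 1 (A₃ y)))
        + (4 * μ y ^ 2) • (X 2 (S₂ y) * X 1 (A₃ y) - X 1 (A₂ y) * X 2 (S₃ y))) := by
    rw [extDeriv_fun_add k₁₂ k₃, extDeriv_fun_add k₁ k₂, map_add, map_add]
    have q₁ := extMap_extDeriv_smul b g₁ t₁ hS₁
    have q₂ := extMap_extDeriv_smul b g₂ t₂ w₂₃
    have q₃ := extMap_extDeriv_smul b g₃ t₃ w₁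
    rw [dS₁, map_zero, smul_zero, add_zero, map_smul] at q₁
    rw [extMap_extDeriv_wedge_one b h₂ h₃, extMap_wedge, d₂, d₃, map_smul] at q₂
    rw [extMap_extDeriv_wedge_one b hT h₁, extMap_wedge, dT, d₁, map_smul, map_zero, zero_mul,
      smul_mul_assoc, ← mul_assoc (extMap b 1 (T y)) (extMap b 1 (T y)), hTT, zero_mul, smul_zero,
      zero_add, zero_sub] at q₃
    have e : X 3 (extDeriv (fun z => (f z * μ z) • S₁ z) y) + X 3 (extDeriv (fun z => (f z * (4 * μ z ^ 2)) • wedge (A₂ z) (A₃ z)) y)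
      + X 3 (extDeriv (fun z => (f z * (2 * μ z)) • wedge (T z) (A₁ z)) y) = _ :=
        congrArg₂ (· + ·) (congrArg₂ (· + ·) q₁ q₂) q₃
    refine e.trans ?_
    simp only [smul_mul_assoc, X]
    module
  have hw : X 2 ((f y * μ y) • S₁ y + (f y * (4 * μ y ^ 2)) • wedge (A₂ y) (A₃ y)
        + (f y * (2 * μ y)) • wedge (T y) (A₁ y))
      = f y • (μ y • X 2 (S₁ y) + (4 * μ y ^ 2) • (X 1 (A₂ y) * X 1 (A₃ y))
        + (2 * μ y) • (X 1 (T y) * X 1 (A₁ y))) := by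
    have e1 := extMap_wedge b (A₂ y) (A₃ y)
    have e2 := extMap_wedge b (T y) (A₁ y)
    rw [map_add, map_add, map_smul, map_smul, map_smul]
    rw [show X 2 (wedge (A₂ y) (A₃ y)) = _ from e1, show X 2 (wedge (T y) (A₁ y)) = _ from e2]
    simp only [smul_add, smul_smul]
    rfl
  have pw : ∀ (S : E [⋀^Fin 2]→L[ℝ] ℝ) N, wedge S (wedgePow (S₁ y) N) = 0 →
      X 2 S * X 2 (S₁ y) ^ N = 0 := by
    intro S N h
    have := extMap_wedge b S (wedgePow (S₁ y) N)
    rw [h, map_zero, extMap_wedgePow] at this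
    exact this.symm
  have hb := balanced_identity n (μ y) k hk hTT (extMap_one_mul_self b (A₂ y))
    (extMap_one_mul_self b (A₃ y))
    (extMap_one_mul_one_commute b (A₂ y) (A₃ y)) (extMap_one_mul_one_commute b (T y) (A₁ y))
    (extMap_two_commute b (S₁ y)) (extMap_two_commute b (S₂ y)) (extMap_two_commute b (S₃ y))
    (fun N hN => pw _ _ (hs₁ N hN)) (fun N hN => pw _ _ (hs₂ N hN)) (fun N hN => pw _ _ (hs₃ N hN))
  have hd' := congrArg₂ (fun x w : ExteriorAlgebra ℝ (Module.Dual ℝ E) => x * w ^ (2 * n)) hd hw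
  simp only [smul_pow, smul_mul_assoc, mul_smul_comm] at hd'
  rw [show _ = (0 : ExteriorAlgebra ℝ (Module.Dual ℝ E)) from hb, smul_zero, smul_zero] at hd'
  exact (congrArg _ hd').trans (smul_zero _)

end BalancedCalculus

section FormVanishing

variable {W : Type*} [AddCommGroup W] [Module ℝ W] [TopologicalSpace W] [FiniteDimensional ℝ W]

theorem wedge_wedgePow_eq_zero_of_lt {n : ℕ} (hW : Module.finrank ℝ W = 4 * n)
    (s s₁ : W [⋀^Fin 2]→L[ℝ] ℝ) {N : ℕ} (hN : 2 * n ≤ N) : wedge s (wedgePow s₁ N) = 0 :=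
  eq_zero_of_finrank_lt _ (by omega)

/-- A product of top degree of a `2`-form anti-invariant under a complex structure with invariant
`2`-forms is zero. -/
theorem wedge_wedgePow_eq_zero_of_anti {n : ℕ} (hW : Module.finrank ℝ W = 4 * n)
    {s s₁ : W [⋀^Fin 2]→L[ℝ] ℝ} {J : W →L[ℝ] W} (hJ : ∀ v, J (J v) = -v)
    (h : s.compContinuousLinearMap J = -s) (h₁ : s₁.compContinuousLinearMap J = s₁) {N : ℕ}
    (hN : 2 * n ≤ N + 1) : wedge s (wedgePow s₁ N) = 0 := by
  rcases Nat.lt_or_ge (4 * n) (2 + 2 * N) with hlt | hge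
  · exact eq_zero_of_finrank_lt _ (by omega)
  · have e := compContinuousLinearMap_eq_det_smul (wedge s (wedgePow s₁ N)) (by omega) J
    have hdet : LinearMap.det (J : W →ₗ[ℝ] W) = 1 :=
      det_eq_one_of_sq_eq_neg_one _ (LinearMap.ext hJ)
    rw [hdet, one_smul, wedge_compContinuousLinearMap, wedgePow_compContinuousLinearMap, h, h₁] at e
    have hneg : wedge (-s) (wedgePow s₁ N) = -wedge s (wedgePow s₁ N) := by
      ext v
      simp [wedge, ContinuousMultilinearMap.alternatization_apply_apply, formProd_apply]
    rw [hneg, neg_eq_iff_add_eq_zero, ← two_smul ℝ] at e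
    exact (smul_eq_zero.1 e).resolve_left two_ne_zero

end FormVanishing

section Frame

variable {V W : Type*} [AddCommGroup V] [Module ℝ V] [TopologicalSpace V] [IsTopologicalAddGroup V]
  [ContinuousSMul ℝ V] [T2Space V] [FiniteDimensional ℝ V] [AddCommGroup W] [Module ℝ W]
  [FiniteDimensional ℝ W]

omit [TopologicalSpace V] [IsTopologicalAddGroup V] [ContinuousSMul ℝ V] [T2Space V] in
theorem frame_surjective {T A₁ A₂ A₃ : V →ₗ[ℝ] ℝ} {p : V →ₗ[ℝ] W}
    (hinj : ∀ v, T v = 0 → A₁ v = 0 → A₂ v = 0 → A₃ v = 0 → p v = 0 → v = 0)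
    (hdim : Module.finrank ℝ V = 4 + Module.finrank ℝ W) (x₀ x₁ x₂ x₃ : ℝ) (w : W) :
    ∃ v, T v = x₀ ∧ A₁ v = x₁ ∧ A₂ v = x₂ ∧ A₃ v = x₃ ∧ p v = w := by
  let Z : V →ₗ[ℝ] ℝ × ℝ × ℝ × ℝ × W := T.prod (A₁.prod (A₂.prod (A₃.prod p)))
  have hZ : Function.Injective Z := by
    rw [injective_iff_map_eq_zero]
    intro v hv
    obtain ⟨h0, hv⟩ := Prod.ext_iff.1 hv
    obtain ⟨h1, hv⟩ := Prod.ext_iff.1 hv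
    obtain ⟨h2, hv⟩ := Prod.ext_iff.1 hv
    obtain ⟨h3, h4⟩ := Prod.ext_iff.1 hv
    exact hinj v h0 h1 h2 h3 h4
  have hs : Function.Surjective Z :=
    (LinearMap.injective_iff_surjective_of_finrank_eq_finrank (by
      simp only [Module.finrank_prod, Module.finrank_self]
      omega)).1 hZ
  obtain ⟨v, hv⟩ := hs (x₀, x₁, x₂, x₃, w)
  obtain ⟨h0, hv⟩ := Prod.ext_iff.1 hv
  obtain ⟨h1, hv⟩ := Prod.ext_iff.1 hv
  obtain ⟨h2, hv⟩ := Prod.ext_iff.1 hv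
  obtain ⟨h3, h4⟩ := Prod.ext_iff.1 hv
  exact ⟨v, h0, h1, h2, h3, h4⟩

theorem exists_frame_endomorphism {T A₁ A₂ A₃ : V →ₗ[ℝ] ℝ} {p : V →ₗ[ℝ] W} (K : W →ₗ[ℝ] W)
    (hinj : ∀ v, T v = 0 → A₁ v = 0 → A₂ v = 0 → A₃ v = 0 → p v = 0 → v = 0)
    (hdim : Module.finrank ℝ V = 4 + Module.finrank ℝ W) {l : ℝ} (hl : l ≠ 0) :
    ∃ J : V →L[ℝ] V, ∀ v, T (J v) = -(l * A₁ v) ∧ l * A₁ (J v) = T v ∧ A₂ (J v) = -A₃ v ∧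
      A₃ (J v) = A₂ v ∧ p (J v) = K (p v) := by
  choose f hf using fun v : V =>
    frame_surjective hinj hdim (-(l * A₁ v)) (l⁻¹ * T v) (-A₃ v) (A₂ v) (K (p v))
  have hext : ∀ v w, T v = T w → A₁ v = A₁ w → A₂ v = A₂ w → A₃ v = A₃ w → p v = p w → v = w := by
    intro v w h0 h1 h2 h3 h4
    rw [← sub_eq_zero]
    apply hinj <;> rw [map_sub, sub_eq_zero] <;> assumption
  refine ⟨LinearMap.toContinuousLinearMap
    { toFun := f
      map_add' := fun v w => ?_
      map_smul' := fun c v => ?_ }, fun v => ?_⟩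
  · obtain ⟨a0, a1, a2, a3, a4⟩ := hf (v + w)
    obtain ⟨b0, b1, b2, b3, b4⟩ := hf v
    obtain ⟨c0, c1, c2, c3, c4⟩ := hf w
    apply hext <;> simp only [map_add, *] <;> ring
  · obtain ⟨a0, a1, a2, a3, a4⟩ := hf (c • v)
    obtain ⟨b0, b1, b2, b3, b4⟩ := hf v
    apply hext <;> simp only [map_smul, smul_eq_mul, RingHom.id_apply, *] <;> ring
  · obtain ⟨a0, a1, a2, a3, a4⟩ := hf v
    exact ⟨a0, by rw [← mul_inv_cancel_left₀ hl (T v), ← a1]; rfl, a2, a3, a4⟩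

end Frame

theorem exists_oriented_frame (a b c : ℝ) :
    ∃ q₁ q₂ q₃ : ℝ, q₁ ^ 2 + q₂ ^ 2 + q₃ ^ 2 = 1 ∧ a * q₁ + b * q₂ + c * q₃ = 0 := by
  by_cases hab : a ^ 2 + b ^ 2 = 0
  · have ha : a = 0 := by nlinarith [sq_nonneg a, sq_nonneg b]
    have hb : b = 0 := by nlinarith [sq_nonneg a, sq_nonneg b]
    exact ⟨1, 0, 0, by norm_num, by simp [ha]⟩
  · have hs : Real.sqrt (a ^ 2 + b ^ 2) ^ 2 = a ^ 2 + b ^ 2 := Real.sq_sqrt (by positivity)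
    have hs0 : Real.sqrt (a ^ 2 + b ^ 2) ≠ 0 := fun h0 => hab (by rw [← hs, h0]; ring)
    refine ⟨-b / Real.sqrt (a ^ 2 + b ^ 2), a / Real.sqrt (a ^ 2 + b ^ 2), 0, ?_, ?_⟩
    · rw [div_pow, div_pow, hs]
      field_simp
      ring
    · field_simp
      ring

section TorusBundle

variable {E : Type*} [NormedAddCommGroup E] [NormedSpace ℝ E]
  {H : Type*} [TopologicalSpace H] {I : ModelWithCorners ℝ E H}
  {M : Type*} [TopologicalSpace M] [ChartedSpace H M]
  {E' : Type*} [NormedAddCommGroup E'] [NormedSpace ℝ E']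
  {H' : Type*} [TopologicalSpace H'] {I' : ModelWithCorners ℝ E' H'}
  {P : Type*} [TopologicalSpace P] [ChartedSpace H' P] [MulAction Torus3 P]

theorem torusCurve_zero (j : Fin 3) : torusCurve j 0 = 1 := by
  fin_cases j <;> simp [torusCurve]

theorem contMDiff_torusCurve (j : Fin 3) :
    ContMDiff 𝓘(ℝ, ℝ) modelTorus3 ∞ (torusCurve j) := by
  have h : ContMDiff 𝓘(ℝ, ℝ) (𝓡 1) ∞ (Circle.exp : ℝ → Circle) := contMDiff_circleExp
  have h1 : ContMDiff 𝓘(ℝ, ℝ) (𝓡 1) ∞ (fun _ : ℝ => (1 : Circle)) := contMDiff_const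
  fin_cases j
  · exact h.prodMk (h1.prodMk h1)
  · exact h1.prodMk (h.prodMk h1)
  · exact h1.prodMk (h1.prodMk h)

/-- The tangent vectors that are vertical form a space of dimension at most three. -/
theorem IsPrincipalTorusBundle.exists_vertical_map {pr : P → M}
    (h : IsPrincipalTorusBundle I I' pr) (p : P) :
    ∃ L : E' →ₗ[ℝ] EuclideanSpace ℝ (Fin 1) × EuclideanSpace ℝ (Fin 1) × EuclideanSpace ℝ (Fin 1),
      ∀ v : TangentSpace I' p, mfderiv I' I pr p v = 0 → L v = 0 → v = 0 := by
  obtain ⟨U, e, hU, hxU, hs, ht, he, he', hp⟩ := h.locally_trivial (pr p)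
  have hps : p ∈ e.source := by rw [hs]; exact hxU
  have h1 : MDifferentiableAt I' (I.prod modelTorus3) e p :=
    (he.contMDiffAt (e.open_source.mem_nhds hps)).mdifferentiableAt (by norm_num)
  have h2 : MDifferentiableAt (I.prod modelTorus3) I' e.symm (e p) :=
    (he'.contMDiffAt (e.open_target.mem_nhds (e.map_source hps))).mdifferentiableAt (by norm_num)
  have h3 : MDifferentiableAt I' modelTorus3 (fun p => (e p).2) p := h1.snd
  have h4 : MDifferentiableAt I' I (fun p => (e p).1) p := h1.fst
  refine ⟨(mfderiv I' modelTorus3 (fun p => (e p).2) p : E' →L[ℝ] _).toLinearMap, fun v hv hL => ?_⟩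
  have e1 : mfderiv I' I (fun p => (e p).1) p = mfderiv I' I pr p := by
    apply Filter.EventuallyEq.mfderiv_eq
    filter_upwards [e.open_source.mem_nhds hps] with z hz using (hp z hz).1
  have e2 := mfderiv_prodMk h4 h3
  have e3 : mfderiv I' (I.prod modelTorus3) e p v = 0 := by
    change mfderiv I' (I.prod modelTorus3) (fun q => ((e q).1, (e q).2)) p v = 0
    rw [e2]
    exact Prod.ext ((congrArg (fun L : E' →L[ℝ] E => L v) e1).trans hv) hL
  have e4 := mfderiv_comp p h2 h1
  have e5 : mfderiv I' I' (e.symm ∘ e) p = ContinuousLinearMap.id ℝ (TangentSpace I' p) := by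
    rw [← mfderiv_id]
    apply Filter.EventuallyEq.mfderiv_eq
    filter_upwards [e.open_source.mem_nhds hps] with z hz using e.left_inv hz
  have e6 := congrArg (fun L : E' →L[ℝ] E' => L v) (e5.symm.trans e4)
  refine Eq.trans e6 ?_
  change mfderiv (I.prod modelTorus3) I' e.symm (e p) (mfderiv I' (I.prod modelTorus3) e p v) = 0
  rw [e3, map_zero]

theorem IsPrincipalTorusBundle.mfderiv_orbit {pr : P → M} (h : IsPrincipalTorusBundle I I' pr)
    [IsManifold I' ∞ P]
    (j : Fin 3) (p : P) :
    mfderiv I' I pr p (mfderiv 𝓘(ℝ, ℝ) I' (fun s : ℝ => torusCurve j s • p) 0 (1 : ℝ) : E') = 0 := by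
  have hc : ContMDiff 𝓘(ℝ, ℝ) I' ∞ (fun s : ℝ => torusCurve j s • p) :=
    h.smooth_action.comp ((contMDiff_torusCurve j).prodMk contMDiff_const)
  have e0 : torusCurve j 0 • p = p := by rw [torusCurve_zero, one_smul]
  have e1 := mfderiv_comp (0 : ℝ) ((h.smooth_proj (torusCurve j 0 • p)).mdifferentiableAt (by norm_num))
    ((hc 0).mdifferentiableAt (by norm_num))
  have e2 : pr ∘ (fun s : ℝ => torusCurve j s • p) = fun _ => pr p :=
    funext fun s => h.proj_smul _ _
  rw [e2, mfderiv_const] at e1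
  have e3 := congrArg (fun L : ℝ →L[ℝ] E => L 1) e1
  have e4 : ∀ q, q = p → ∀ v : E', (mfderiv I' I pr q v : E) = (0 : E) →
      (mfderiv I' I pr p v : E) = (0 : E) := by
    rintro q rfl v hv
    exact hv
  exact e4 _ e0 _ e3.symm

/-- A tangent vector that is both vertical and horizontal is zero. -/
theorem IsTorusConnection.eq_zero [IsManifold I' ∞ P] [FiniteDimensional ℝ E'] {pr : P → M}
    (h : IsPrincipalTorusBundle I I' pr)
    {θ : Fin 3 → DForm I' P 1 ℝ} (hθ : IsTorusConnection I' θ) (p : P) (v : TangentSpace I' p)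
    (hv : mfderiv I' I pr p v = 0) (hv' : ∀ i, θ i p ![v] = 0) : v = 0 := by
  obtain ⟨L, hL⟩ := h.exists_vertical_map p
  let D : E' →ₗ[ℝ] E := (mfderiv I' I pr p : E' →L[ℝ] E).toLinearMap
  let B : E' →ₗ[ℝ] Fin 3 → ℝ := LinearMap.pi fun i => (asLinear (θ i p) : E' →L[ℝ] ℝ).toLinearMap
  let X : Fin 3 → E' := fun j => mfderiv 𝓘(ℝ, ℝ) I' (fun s : ℝ => torusCurve j s • p) 0 (1 : ℝ)
  have hX : ∀ j, X j ∈ LinearMap.ker D := fun j => h.mfderiv_orbit j p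
  have hasL : ∀ i (v : E'), asLinear (θ i p) v = θ i p ![v] := fun i v => by
    change (θ i p) _ = _
    congr 1
    funext k
    fin_cases k
    rfl
  have hBX : ∀ j, B (X j) = Pi.single j 1 := by
    intro j
    funext i
    change asLinear (θ i p) (X j) = _
    rw [hasL]
    have e4 : ∀ q, q = p → ∀ (v : E') (r : ℝ), θ i q ![v] = r → θ i p ![v] = r := by
      rintro q rfl v r hv
      exact hv
    refine (e4 _ (by rw [torusCurve_zero, one_smul]) _ _ (hθ.vertical i j p)).trans ?_
    rw [Pi.single_apply]
  have hinjL : Function.Injective (L.domRestrict (LinearMap.ker D)) := by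
    rw [injective_iff_map_eq_zero]
    intro u hu
    exact Subtype.ext (hL u.1 u.2 hu)
  have hdim : Module.finrank ℝ (LinearMap.ker D) ≤ 3 := by
    refine (LinearMap.finrank_le_finrank_of_injective hinjL).trans ?_
    simp [Module.finrank_prod]
  have hsurj : Function.Surjective (B.domRestrict (LinearMap.ker D)) := by
    intro x
    refine ⟨∑ j, x j • ⟨X j, hX j⟩, ?_⟩
    rw [map_sum]
    simp only [map_smul, LinearMap.domRestrict_apply, hBX]
    exact (pi_eq_sum_univ' x).symm
  have hdim' : Module.finrank ℝ (LinearMap.ker D) = 3 := by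
    refine le_antisymm hdim ?_
    have := LinearMap.finrank_le_finrank_of_surjective hsurj
    simpa using this
  have hinj := (LinearMap.injective_iff_surjective_of_finrank_eq_finrank
    (f := B.domRestrict (LinearMap.ker D)) (by rw [hdim']; simp)).2 hsurj
  have : (⟨v, hv⟩ : LinearMap.ker D) = 0 := by
    apply hinj
    rw [map_zero]
    funext i
    exact (hasL i v).trans (hv' i)
  exact congrArg Subtype.val this

end TorusBundle

section ChartDerivative

variable {E : Type*} [NormedAddCommGroup E] [NormedSpace ℝ E]
  {H : Type*} [TopologicalSpace H] {I : ModelWithCorners ℝ E H}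
  {M : Type*} [TopologicalSpace M] [ChartedSpace H M]
  {E' : Type*} [NormedAddCommGroup E'] [NormedSpace ℝ E']
  {H' : Type*} [TopologicalSpace H'] {I' : ModelWithCorners ℝ E' H'}
  {M' : Type*} [TopologicalSpace M'] [ChartedSpace H' M']
  {F : Type*} [NormedAddCommGroup F] [NormedSpace ℝ F] {k : ℕ}

/-- `Θ` is the exterior derivative of `Ω` in every chart. -/
def DForm.HasD (Ω : DForm I M k F) (Θ : DForm I M (k + 1) F) : Prop :=
  ∀ x₀ : M, ∀ y ∈ (extChartAt I x₀).target, extDeriv (Ω.inChart x₀) y = Θ.inChart x₀ y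

/-- The combination `r Ω₁ + s Ω₂ + u Ω₃`. -/
def DForm.comb (r s u : ℝ) (Ω₁ Ω₂ Ω₃ : DForm I M k F) : DForm I M k F :=
  fun x => r • Ω₁ x + s • Ω₂ x + u • Ω₃ x

theorem DForm.comb_inChart (r s u : ℝ) (Ω₁ Ω₂ Ω₃ : DForm I M k F) (x₀ : M) :
    (DForm.comb r s u Ω₁ Ω₂ Ω₃).inChart x₀
      = fun y => r • Ω₁.inChart x₀ y + s • Ω₂.inChart x₀ y + u • Ω₃.inChart x₀ y := rfl

theorem DForm.IsSmooth.comb {Ω₁ Ω₂ Ω₃ : DForm I M k F} (r s u : ℝ) (h₁ : Ω₁.IsSmooth)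
    (h₂ : Ω₂.IsSmooth) (h₃ : Ω₃.IsSmooth) : (DForm.comb r s u Ω₁ Ω₂ Ω₃).IsSmooth := fun x₀ =>
  (((h₁ x₀).const_smul r).add ((h₂ x₀).const_smul s)).add ((h₃ x₀).const_smul u)

variable [I.Boundaryless]

theorem DForm.IsSmooth.differentiableAt {Ω : DForm I M k F} (h : Ω.IsSmooth) {x₀ : M} {y : E}
    (hy : y ∈ (extChartAt I x₀).target) : DifferentiableAt ℝ (Ω.inChart x₀) y :=
  (h.contDiffAt hy).differentiableAt (by norm_num)

theorem DForm.HasD.comb {Ω₁ Ω₂ Ω₃ : DForm I M k F} {Θ₁ Θ₂ Θ₃ : DForm I M (k + 1) F} (r s u : ℝ)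
    (h₁ : Ω₁.IsSmooth) (h₂ : Ω₂.IsSmooth) (h₃ : Ω₃.IsSmooth)
    (d₁ : Ω₁.HasD Θ₁) (d₂ : Ω₂.HasD Θ₂) (d₃ : Ω₃.HasD Θ₃) :
    (DForm.comb r s u Ω₁ Ω₂ Ω₃).HasD (DForm.comb r s u Θ₁ Θ₂ Θ₃) := by
  intro x₀ y hy
  have k₁ : DifferentiableAt ℝ (fun y => r • Ω₁.inChart x₀ y) y :=
    (h₁.differentiableAt hy).const_smul r
  have k₂ : DifferentiableAt ℝ (fun y => s • Ω₂.inChart x₀ y) y :=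
    (h₂.differentiableAt hy).const_smul s
  have k₃ : DifferentiableAt ℝ (fun y => u • Ω₃.inChart x₀ y) y :=
    (h₃.differentiableAt hy).const_smul u
  have k₁₂ : DifferentiableAt ℝ (fun y => r • Ω₁.inChart x₀ y + s • Ω₂.inChart x₀ y) y := k₁.add k₂
  rw [DForm.comb_inChart, DForm.comb_inChart, extDeriv_fun_add k₁₂ k₃, extDeriv_fun_add k₁ k₂]
  beta_reduce
  rw [← d₁ x₀ y hy, ← d₂ x₀ y hy, ← d₃ x₀ y hy]
  exact congrArg₂ (· + ·) (congrArg₂ (· + ·) (extDeriv_smul r _) (extDeriv_smul s _))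
    (extDeriv_smul u _)

theorem DForm.HasD.closed {Ω : DForm I M k F} {Θ : DForm I M (k + 1) F} (h : Ω.IsSmooth)
    (d : Ω.HasD Θ) {x₀ : M} {y : E} (hy : y ∈ (extChartAt I x₀).target) :
    extDeriv (Θ.inChart x₀) y = 0 := by
  have e : Θ.inChart x₀ =ᶠ[𝓝 y] extDeriv (Ω.inChart x₀) := by
    filter_upwards [(isOpen_extChartAt_target x₀).mem_nhds hy] with z hz using (d x₀ z hz).symm
  rw [e.extDeriv_eq]
  exact extDeriv_extDeriv_apply (h.contDiffAt hy) minSmoothness_two_le_infty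

variable [IsManifold I ∞ M] [IsManifold I' ∞ M']

theorem ofFun_inChart_apply {t : M → ℝ} (ht : ContMDiff I 𝓘(ℝ, ℝ) ∞ t) {x₀ : M} {y : E}
    (hy : y ∈ (extChartAt I x₀).target) (v : E) :
    (DForm.ofFun t : DForm I M 1 ℝ).inChart x₀ y ![v]
      = fderiv ℝ (fun z => t ((extChartAt I x₀).symm z)) y v := by
  have h := fderiv_inCharts (x₁ := (0 : ℝ)) ht hy (by rw [extChartAt_model_space_eq_id]; trivial) v
  have e : inCharts I 𝓘(ℝ, ℝ) t x₀ (0 : ℝ) = fun z => t ((extChartAt I x₀).symm z) := by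
    funext z
    rw [inCharts, extChartAt_model_space_eq_id]
    rfl
  rw [e] at h
  rw [h, inChart_eq _ hy]
  have e2 : chartD 𝓘(ℝ, ℝ) (0 : ℝ) (t ((extChartAt I x₀).symm y))
      = ContinuousLinearMap.id ℝ ℝ := by
    rw [chartD, extChartAt_model_space_eq_id]
    exact mfderiv_id
  rw [e2]
  rfl

theorem contDiffAt_comp_symm {t : M → ℝ} (ht : ContMDiff I 𝓘(ℝ, ℝ) ∞ t) {x₀ : M} {y : E}
    (hy : y ∈ (extChartAt I x₀).target) :
    ContDiffAt ℝ ∞ (fun z => t ((extChartAt I x₀).symm z)) y := by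
  have h := contDiffAt_inCharts (x₁ := (0 : ℝ)) ht hy (by rw [extChartAt_model_space_eq_id]; trivial)
  have e : inCharts I 𝓘(ℝ, ℝ) t x₀ (0 : ℝ) = fun z => t ((extChartAt I x₀).symm z) := by
    funext z
    rw [inCharts, extChartAt_model_space_eq_id]
    rfl
  rwa [e] at h

theorem ofFun_inChart_eventuallyEq {t : M → ℝ} (ht : ContMDiff I 𝓘(ℝ, ℝ) ∞ t) {x₀ : M} {y : E}
    (hy : y ∈ (extChartAt I x₀).target) :
    (DForm.ofFun t : DForm I M 1 ℝ).inChart x₀ =ᶠ[𝓝 y] fun z =>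
      ContinuousAlternatingMap.ofSubsingletonLIE (ι := Fin 1) (𝕜 := ℝ) (E := E) (F := ℝ) 0
        (fderiv ℝ (fun z => t ((extChartAt I x₀).symm z)) z) := by
  filter_upwards [(isOpen_extChartAt_target x₀).mem_nhds hy] with z hz
  ext v
  have e : v = ![v 0] := by funext i; fin_cases i; rfl
  rw [e]
  exact ofFun_inChart_apply ht hz (v 0)

theorem isSmooth_ofFun {t : M → ℝ} (ht : ContMDiff I 𝓘(ℝ, ℝ) ∞ t) :
    (DForm.ofFun t : DForm I M 1 ℝ).IsSmooth := by
  intro x₀ y hy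
  refine ContDiffAt.contDiffWithinAt (ContDiffAt.congr_of_eventuallyEq ?_
    (ofFun_inChart_eventuallyEq ht hy))
  exact (LinearIsometryEquiv.contDiff _).contDiffAt.comp y
    ((contDiffAt_comp_symm ht hy).fderiv_right (by norm_num))

theorem extDeriv_ofFun {t : M → ℝ} (ht : ContMDiff I 𝓘(ℝ, ℝ) ∞ t) {x₀ : M} {y : E}
    (hy : y ∈ (extChartAt I x₀).target) :
    extDeriv ((DForm.ofFun t : DForm I M 1 ℝ).inChart x₀) y = 0 := by
  rw [(ofFun_inChart_eventuallyEq ht hy).extDeriv_eq]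
  ext v
  have e : v = ![v 0, v 1] := by funext i; fin_cases i <;> rfl
  have hs := ((contDiffAt_comp_symm ht hy).isSymmSndFDerivAt minSmoothness_two_le_infty).eq (v 0) (v 1)
  have hd : DifferentiableAt ℝ (fderiv ℝ (fun z => t ((extChartAt I x₀).symm z))) y :=
    ((contDiffAt_comp_symm ht hy).fderiv_right (m := ∞) (by norm_num)).differentiableAt (by norm_num)
  rw [e, extDeriv_one_apply]
  have h2 := ((ContinuousAlternatingMap.ofSubsingletonLIE (ι := Fin 1) (𝕜 := ℝ) (E := E) (F := ℝ) 0).toContinuousLinearEquiv.hasFDerivAt.comp y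
    hd.hasFDerivAt).fderiv
  have h3 : ∀ v w, fderiv ℝ (fun z => ContinuousAlternatingMap.ofSubsingletonLIE (ι := Fin 1) (𝕜 := ℝ) (E := E) (F := ℝ) 0
        (fderiv ℝ (fun z => t ((extChartAt I x₀).symm z)) z)) y v ![w]
      = fderiv ℝ (fderiv ℝ (fun z => t ((extChartAt I x₀).symm z))) y v w := by
    intro v w
    exact congrArg (fun L : E →L[ℝ] E [⋀^Fin 1]→L[ℝ] ℝ => L v ![w]) h2
  rw [h3, h3, hs, sub_self]
  rfl

theorem DForm.hasD_pullback [I'.Boundaryless] {f : M → M'} (hf : ContMDiff I I' ∞ f)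
    {Ω : DForm I' M' k F} (hΩ : Ω.IsSmooth) :
    (DForm.pullback I' f Ω : DForm I M k F).HasD (DForm.pullback I' f Ω.d) :=
  fun _ _ hy => extDeriv_inChart_pullback hf hΩ hy

end ChartDerivative

theorem asLinear_apply {V : Type*} [AddCommGroup V] [Module ℝ V] [TopologicalSpace V]
    (a : V [⋀^Fin 1]→L[ℝ] ℝ) (v : V) : asLinear a v = a ![v] := by
  change a _ = _
  congr 1
  funext i
  fin_cases i
  rfl

theorem sqForm_apply {V : Type*} [AddCommGroup V] [Module ℝ V] [TopologicalSpace V]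
    (a : V [⋀^Fin 1]→L[ℝ] ℝ) (v w : V) : sqForm a v w = a ![v] * a ![w] := by
  rw [← asLinear_apply, ← asLinear_apply]
  rfl

theorem contDiffAt_of_apply_eq {X V W : Type*} [NormedAddCommGroup X] [NormedSpace ℝ X]
    [NormedAddCommGroup V] [NormedSpace ℝ V] [FiniteDimensional ℝ V]
    [NormedAddCommGroup W] [NormedSpace ℝ W] [FiniteDimensional ℝ W]
    (hdim : Module.finrank ℝ V = Module.finrank ℝ W) {n : WithTop ℕ∞} {G : X → V →L[ℝ] W}
    {b : X → W} {u : X → V} {y : X} (hG : ContDiffAt ℝ n G y) (hb : ContDiffAt ℝ n b y)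
    (hinj : ∀ᶠ z in 𝓝 y, Function.Injective (G z)) (h : ∀ᶠ z in 𝓝 y, G z (u z) = b z) :
    ContDiffAt ℝ n u y := by
  have hE : ∀ z, Function.Injective (G z) → ∃ e : V ≃L[ℝ] W, (e : V →L[ℝ] W) = G z := by
    intro z hz
    refine ⟨(LinearEquiv.ofInjectiveOfFinrankEq (G z : V →ₗ[ℝ] W) hz hdim).toContinuousLinearEquiv, ?_⟩
    ext v
    rfl
  have h1 : ContDiffAt ℝ n (fun z => (G z).inverse (b z)) y := by
    obtain ⟨e, he⟩ := hE y hinj.self_of_nhds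
    refine ContDiffAt.clm_apply ?_ hb
    have h2 := contDiffAt_map_inverse (𝕜 := ℝ) (n := n) e
    rw [he] at h2
    exact h2.comp y hG
  refine h1.congr_of_eventuallyEq ?_
  filter_upwards [hinj, h] with z hz hz'
  obtain ⟨e, he⟩ := hE z hz
  rw [← hz', ← he, ContinuousLinearMap.inverse_equiv]
  simp

section ChartEvaluation

variable {E : Type*} [NormedAddCommGroup E] [NormedSpace ℝ E]
  {H : Type*} [TopologicalSpace H] {I : ModelWithCorners ℝ E H}
  {N : Type*} [TopologicalSpace N] [ChartedSpace H N]
  {E' : Type*} [NormedAddCommGroup E'] [NormedSpace ℝ E']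
  {H' : Type*} [TopologicalSpace H'] {I' : ModelWithCorners ℝ E' H'}
  {M : Type*} [TopologicalSpace M] [ChartedSpace H' M]
  {F : Type*} [NormedAddCommGroup F] [NormedSpace ℝ F]

theorem pullback_apply_two (φ : N → M) (τ : DForm I' M 2 F) (q : N) (v w : TangentSpace I q) :
    (DForm.pullback I' φ τ : DForm I N 2 F) q ![v, w]
      = τ (φ q) ![mfderiv I I' φ q v, mfderiv I I' φ q w] := by
  change τ (φ q) _ = _
  congr 1
  funext i
  fin_cases i <;> rfl

variable [IsManifold I ∞ N]

theorem inChart_apply_one (Ω : DForm I N 1 F) {x₀ : N} {y : E}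
    (hy : y ∈ (extChartAt I x₀).target) (v : E) :
    Ω.inChart x₀ y ![v] = Ω ((extChartAt I x₀).symm y)
      ![chartDinv I x₀ ((extChartAt I x₀).symm y) v] := by
  rw [inChart_eq Ω hy]
  change Ω _ _ = _
  congr 1
  funext i
  fin_cases i
  rfl

theorem inChart_apply_two (Ω : DForm I N 2 F) {x₀ : N} {y : E}
    (hy : y ∈ (extChartAt I x₀).target) (v w : E) :
    Ω.inChart x₀ y ![v, w] = Ω ((extChartAt I x₀).symm y)
      ![chartDinv I x₀ ((extChartAt I x₀).symm y) v,
        chartDinv I x₀ ((extChartAt I x₀).symm y) w] := by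
  rw [inChart_eq Ω hy]
  change Ω _ _ = _
  congr 1
  funext i
  fin_cases i <;> rfl

theorem chartDinv_endField_inChart (J : EndField I N) {x₀ : N} {y : E}
    (hy : y ∈ (extChartAt I x₀).target) (v : E) :
    chartDinv I x₀ ((extChartAt I x₀).symm y) (J.inChart x₀ y v)
      = J ((extChartAt I x₀).symm y) (chartDinv I x₀ ((extChartAt I x₀).symm y) v) :=
  chartDinv_chartD ((extChartAt I x₀).map_target hy) _

omit [IsManifold I ∞ N] in
theorem d_apply_two [I.Boundaryless] (ψ : DForm I N 1 F) (x : N) (v w : TangentSpace I x) :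
    ψ.d x ![v, w] = extDeriv (ψ.inChart x) (extChartAt I x x) ![chartD I x x v, chartD I x x w] := by
  rw [d_eq]
  change extDeriv (ψ.inChart x) (extChartAt I x x) _ = _
  congr 1
  funext i
  fin_cases i <;> rfl

/-- Integrability follows from the vanishing of the Nijenhuis tensor in charts. -/
theorem isIntegrable_of_nijenhuis_eq_zero [FiniteDimensional ℝ E] [I.Boundaryless] {J : EndField I N}
    (hJ : ∀ x₀ : N, ContDiffOn ℝ ∞ (J.inChart x₀) (extChartAt I x₀).target)
    (h : ∀ x v w, nijenhuis (J.inChart x (extChartAt I x x))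
      (fderiv ℝ (J.inChart x) (extChartAt I x x)) v w = 0) : IsIntegrable J := by
  intro ψ hψ hψJ x v w
  have hy := mem_extChartAt_target (I := I) x
  have hs := mem_extChartAt_source (I := I) x
  have hJx : ∀ v : TangentSpace I x,
      chartD I x x (J x v) = J.inChart x (extChartAt I x x) (chartD I x x v) := by
    intro v
    rw [EndField.inChart_apply J hs, chartDinv_chartD hs]
  rw [d_apply_two, d_apply_two, d_apply_two, d_apply_two, hJx, hJx]
  have hdJ : DifferentiableAt ℝ (J.inChart x) (extChartAt I x x) :=
    ((hJ x).contDiffAt ((isOpen_extChartAt_target x).mem_nhds hy)).differentiableAt (by norm_num)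
  have hdψ := hψ.differentiableAt hy
  let K : ℂ →L[ℝ] ℂ := Complex.I • ContinuousLinearMap.id ℝ ℂ
  have hK : ∀ f, K f = Complex.I * f := fun f => rfl
  have := apply_nijenhuis (oneFormL.hasFDerivAt.comp _ hdψ.hasFDerivAt) hdJ.hasFDerivAt K
    (fun f => by rw [hK, hK, ← mul_assoc, Complex.I_mul_I, neg_one_mul]) (by
      filter_upwards [(isOpen_extChartAt_target x).mem_nhds hy] with z hz w
      simp only [Function.comp_apply, oneFormL_apply, hK]
      rw [inChart_apply_one ψ hz, inChart_apply_one ψ hz, chartDinv_endField_inChart J hz, hψJ])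
    (chartD I x x v) (chartD I x x w)
  rw [h, map_zero, hK] at this
  simp only [ContinuousLinearMap.comp_apply, oneFormL_apply] at this
  simp only [extDeriv_one_apply]
  exact this

end ChartEvaluation

section Adapted

variable {E : Type*} [NormedAddCommGroup E] [NormedSpace ℝ E]
  {H : Type*} [TopologicalSpace H] {I : ModelWithCorners ℝ E H}
  {N : Type*} [TopologicalSpace N] [ChartedSpace H N]
  {E' : Type*} [NormedAddCommGroup E'] [NormedSpace ℝ E']
  {H' : Type*} [TopologicalSpace H'] {I' : ModelWithCorners ℝ E' H'}
  {M : Type*} [TopologicalSpace M] [ChartedSpace H' M]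

/-- The metric `e^{-4t/(2n+1)} (dt² + 4 e^{4t} (A₁² + A₂² + A₃²) + e^{2t} φ^*g)`. -/
def adaptedMetric (n : ℕ) (φ : N → M) (t : N → ℝ) (A₁ A₂ A₃ : DForm I N 1 ℝ)
    (g : BilinField I' M) : BilinField I N := fun q =>
  Real.exp (-(4 / (2 * (n : ℝ) + 1)) * t q) • (sqForm (DForm.ofFun (I := I) t q)
    + (4 * Real.exp (4 * t q)) • (sqForm (A₁ q) + sqForm (A₂ q) + sqForm (A₃ q))
    + Real.exp (2 * t q) • BilinField.pullback I' φ g q)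

/-- The form `e^{-4t/(2n+1)} (e^{2t} φ^*τ + (2 e^{2t} A₂) ∧ (2 e^{2t} A₃) + dt ∧ (2 e^{2t} A₁))`. -/
def adaptedForm (n : ℕ) (φ : N → M) (t : N → ℝ) (A₁ A₂ A₃ : DForm I N 1 ℝ)
    (τ : DForm I' M 2 ℝ) : DForm I N 2 ℝ := fun q =>
  Real.exp (-(4 / (2 * (n : ℝ) + 1)) * t q) • (Real.exp (2 * t q) • DForm.pullback I' φ τ q
    + wedge ((2 * Real.exp (2 * t q)) • A₂ q) ((2 * Real.exp (2 * t q)) • A₃ q)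
    + wedge (DForm.ofFun (I := I) t q) ((2 * Real.exp (2 * t q)) • A₁ q))

/-- A coframe `dt, A₁, A₂, A₃` together with a map `φ` to a manifold with a complex structure `K`
and a form `τ₂ + i τ₃` of type `(2,0)`. -/
structure IsAdapted (n : ℕ) (φ : N → M) (t : N → ℝ) (A₁ A₂ A₃ : DForm I N 1 ℝ)
    (g : BilinField I' M) (K : EndField I' M) (τ₁ τ₂ τ₃ : DForm I' M 2 ℝ) : Prop where
  smooth_map : ContMDiff I I' ∞ φ
  smooth_fun : ContMDiff I 𝓘(ℝ, ℝ) ∞ t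
  smooth₁ : A₁.IsSmooth
  smooth₂ : A₂.IsSmooth
  smooth₃ : A₃.IsSmooth
  smooth_τ₁ : τ₁.IsSmooth
  smooth_τ₂ : τ₂.IsSmooth
  smooth_τ₃ : τ₃.IsSmooth
  d₁ : A₁.HasD (DForm.pullback I' φ τ₁)
  d₂ : A₂.HasD (DForm.pullback I' φ τ₂)
  d₃ : A₃.HasD (DForm.pullback I' φ τ₃)
  smooth_metric : g.IsSmooth
  symm : ∀ x v w, g x v w = g x w v
  pos : ∀ x v, v ≠ 0 → 0 < g x v v
  sq : ∀ x v, K x (K x v) = -v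
  isometry : ∀ x v w, g x (K x v) (K x w) = g x v w
  form₁ : ∀ x v w, τ₁ x ![v, w] = g x (K x v) w
  form₂₃ : ∀ x v w, τ₂ x ![K x v, w] = -τ₃ x ![v, w] ∧ τ₃ x ![K x v, w] = τ₂ x ![v, w]
  nondegenerate : ∀ x v, (∀ u, τ₂ x ![u, v] = 0) → v = 0
  coframe : ∀ q v, DForm.ofFun t q ![v] = 0 → A₁ q ![v] = 0 → A₂ q ![v] = 0 → A₃ q ![v] = 0 →
    mfderiv I I' φ q v = 0 → v = 0
  finrank_base : Module.finrank ℝ E' = 4 * n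
  finrank_total : Module.finrank ℝ E = 4 * n + 4

/-- The relations that determine the complex structure of an adapted coframe. -/
def IsAdaptedStructure (φ : N → M) (t : N → ℝ) (A₁ A₂ A₃ : DForm I N 1 ℝ) (K : EndField I' M)
    (J : EndField I N) : Prop :=
  ∀ q v, DForm.ofFun t q ![J q v] = -(2 * Real.exp (2 * t q) * A₁ q ![v]) ∧
    2 * Real.exp (2 * t q) * A₁ q ![J q v] = DForm.ofFun t q ![v] ∧
    A₂ q ![J q v] = -A₃ q ![v] ∧ A₃ q ![J q v] = A₂ q ![v] ∧
    mfderiv I I' φ q (J q v) = K (φ q) (mfderiv I I' φ q v)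

variable {n : ℕ} {φ : N → M} {t : N → ℝ} {A₁ A₂ A₃ : DForm I N 1 ℝ} {g : BilinField I' M}
  {K : EndField I' M} {τ τ₁ τ₂ τ₃ : DForm I' M 2 ℝ} {J : EndField I N}

theorem adaptedMetric_apply (q : N) (v w : TangentSpace I q) :
    adaptedMetric n φ t A₁ A₂ A₃ g q v w = Real.exp (-(4 / (2 * (n : ℝ) + 1)) * t q) *
      (DForm.ofFun (I := I) t q ![v] * DForm.ofFun (I := I) t q ![w]
        + (2 * Real.exp (2 * t q)) ^ 2 * (A₁ q ![v] * A₁ q ![w] + A₂ q ![v] * A₂ q ![w]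
          + A₃ q ![v] * A₃ q ![w])
        + Real.exp (2 * t q) * g (φ q) (mfderiv I I' φ q v) (mfderiv I I' φ q w)) := by
  have e : 4 * Real.exp (4 * t q) = (2 * Real.exp (2 * t q)) ^ 2 := by
    rw [mul_pow, ← Real.exp_nat_mul]
    norm_num
    ring_nf
  rw [← e]
  simp only [← sqForm_apply]
  rfl

theorem adaptedForm_apply (q : N) (v w : TangentSpace I q) :
    adaptedForm n φ t A₁ A₂ A₃ τ q ![v, w] = Real.exp (-(4 / (2 * (n : ℝ) + 1)) * t q) *
      (Real.exp (2 * t q) * τ (φ q) ![mfderiv I I' φ q v, mfderiv I I' φ q w]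
        + (2 * Real.exp (2 * t q)) ^ 2 * (A₂ q ![v] * A₃ q ![w] - A₂ q ![w] * A₃ q ![v])
        + 2 * Real.exp (2 * t q) * (DForm.ofFun (I := I) t q ![v] * A₁ q ![w]
          - DForm.ofFun (I := I) t q ![w] * A₁ q ![v])) := by
  have sm : ∀ (r : ℝ) (a : TangentSpace I q [⋀^Fin 1]→L[ℝ] ℝ) v, (r • a) ![v] = r * a ![v] :=
    fun _ _ _ => rfl
  have e : adaptedForm n φ t A₁ A₂ A₃ τ q ![v, w] = Real.exp (-(4 / (2 * (n : ℝ) + 1)) * t q) *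
      (Real.exp (2 * t q) * (DForm.pullback I' φ τ : DForm I N 2 ℝ) q ![v, w]
    + wedge ((2 * Real.exp (2 * t q)) • A₂ q) ((2 * Real.exp (2 * t q)) • A₃ q) ![v, w]
    + wedge (DForm.ofFun (I := I) t q) ((2 * Real.exp (2 * t q)) • A₁ q) ![v, w]) := rfl
  rw [e, pullback_apply_two, wedge_one_one_apply, wedge_one_one_apply]
  simp only [sm]
  ring

theorem adaptedForm_inChart (x₀ : N) :
    (adaptedForm n φ t A₁ A₂ A₃ τ).inChart x₀ = fun y =>
      Real.exp (-(4 / (2 * (n : ℝ) + 1)) * t ((extChartAt I x₀).symm y)) •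
        (Real.exp (2 * t ((extChartAt I x₀).symm y)) •
            (DForm.pullback I' φ τ : DForm I N 2 ℝ).inChart x₀ y
          + wedge ((2 * Real.exp (2 * t ((extChartAt I x₀).symm y))) • A₂.inChart x₀ y)
            ((2 * Real.exp (2 * t ((extChartAt I x₀).symm y))) • A₃.inChart x₀ y)
          + wedge ((DForm.ofFun t : DForm I N 1 ℝ).inChart x₀ y)
            ((2 * Real.exp (2 * t ((extChartAt I x₀).symm y))) • A₁.inChart x₀ y)) := by
  funext y
  let x := (extChartAt I x₀).symm y
  let L : E →L[ℝ] TangentSpace I x := mfderivWithin 𝓘(ℝ, E) I (extChartAt I x₀).symm (range I) y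
  have h₁ := wedge_compContinuousLinearMap ((2 * Real.exp (2 * t x)) • A₂ x)
    ((2 * Real.exp (2 * t x)) • A₃ x) L
  have h₂ := wedge_compContinuousLinearMap (DForm.ofFun t x) ((2 * Real.exp (2 * t x)) • A₁ x) L
  have e : (adaptedForm n φ t A₁ A₂ A₃ τ).inChart x₀ y
    = Real.exp (-(4 / (2 * (n : ℝ) + 1)) * t x) • (Real.exp (2 * t x) •
            (DForm.pullback I' φ τ : DForm I N 2 ℝ).inChart x₀ y
      + (wedge ((2 * Real.exp (2 * t x)) • A₂ x)
        ((2 * Real.exp (2 * t x)) • A₃ x)).compContinuousLinearMap L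
      + (wedge (DForm.ofFun t x) ((2 * Real.exp (2 * t x)) • A₁ x)).compContinuousLinearMap L) := rfl
  rw [e, h₁, h₂]
  rfl

end Adapted

section Adapted

variable {E : Type*} [NormedAddCommGroup E] [NormedSpace ℝ E] [FiniteDimensional ℝ E]
  {H : Type*} [TopologicalSpace H] {I : ModelWithCorners ℝ E H}
  {N : Type*} [TopologicalSpace N] [ChartedSpace H N]
  {E' : Type*} [NormedAddCommGroup E'] [NormedSpace ℝ E'] [FiniteDimensional ℝ E']
  {H' : Type*} [TopologicalSpace H'] {I' : ModelWithCorners ℝ E' H'}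
  {M : Type*} [TopologicalSpace M] [ChartedSpace H' M]
  {n : ℕ} {φ : N → M} {t : N → ℝ} {A₁ A₂ A₃ : DForm I N 1 ℝ} {g : BilinField I' M}
  {K : EndField I' M} {τ₁ τ₂ τ₃ : DForm I' M 2 ℝ} {J : EndField I N}

theorem IsAdapted.exists_structure (h : IsAdapted n φ t A₁ A₂ A₃ g K τ₁ τ₂ τ₃) :
    ∃ J : EndField I N, IsAdaptedStructure φ t A₁ A₂ A₃ K J := by
  have hq : ∀ q : N, ∃ J : TangentSpace I q →L[ℝ] TangentSpace I q, ∀ v,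
      asLinear ((DForm.ofFun t : DForm I N 1 ℝ) q) (J v)
        = -(2 * Real.exp (2 * t q) * asLinear (A₁ q) v) ∧
      2 * Real.exp (2 * t q) * asLinear (A₁ q) (J v)
        = asLinear ((DForm.ofFun t : DForm I N 1 ℝ) q) v ∧
      asLinear (A₂ q) (J v) = -asLinear (A₃ q) v ∧ asLinear (A₃ q) (J v) = asLinear (A₂ q) v ∧
      mfderiv I I' φ q (J v) = K (φ q) (mfderiv I I' φ q v) := by
    intro q
    have hdim : Module.finrank ℝ E = 4 + Module.finrank ℝ E' := by
      rw [h.finrank_base, h.finrank_total, add_comm]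
    let T : E →ₗ[ℝ] ℝ := (asLinear ((DForm.ofFun t : DForm I N 1 ℝ) q)).toLinearMap
    let B₁ : E →ₗ[ℝ] ℝ := (asLinear (A₁ q)).toLinearMap
    let B₂ : E →ₗ[ℝ] ℝ := (asLinear (A₂ q)).toLinearMap
    let B₃ : E →ₗ[ℝ] ℝ := (asLinear (A₃ q)).toLinearMap
    let p : E →ₗ[ℝ] E' := (mfderiv I I' φ q).toLinearMap
    let L : E' →ₗ[ℝ] E' := (K (φ q)).toLinearMap
    obtain ⟨J, hJ⟩ := exists_frame_endomorphism (V := E) (W := E') (T := T) (A₁ := B₁) (A₂ := B₂)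
      (A₃ := B₃) (p := p) L
      (fun v h0 h1 h2 h3 h4 => h.coframe q v ((asLinear_apply _ _).symm.trans h0)
        ((asLinear_apply _ _).symm.trans h1) ((asLinear_apply _ _).symm.trans h2)
        ((asLinear_apply _ _).symm.trans h3) h4)
      hdim
      (l := 2 * Real.exp (2 * t q)) (by positivity)
    exact ⟨J, hJ⟩
  choose J hJ using hq
  refine ⟨J, fun q v => ?_⟩
  simp only [← asLinear_apply]
  exact hJ q v

theorem IsAdapted.surjective_mfderiv (h : IsAdapted n φ t A₁ A₂ A₃ g K τ₁ τ₂ τ₃) (q : N)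
    (w : TangentSpace I' (φ q)) : ∃ v, mfderiv I I' φ q v = w := by
  have hdim : Module.finrank ℝ E = 4 + Module.finrank ℝ E' := by
    rw [h.finrank_base, h.finrank_total, add_comm]
  let T : E →ₗ[ℝ] ℝ := (asLinear ((DForm.ofFun t : DForm I N 1 ℝ) q)).toLinearMap
  let B₁ : E →ₗ[ℝ] ℝ := (asLinear (A₁ q)).toLinearMap
  let B₂ : E →ₗ[ℝ] ℝ := (asLinear (A₂ q)).toLinearMap
  let B₃ : E →ₗ[ℝ] ℝ := (asLinear (A₃ q)).toLinearMap
  let p : E →ₗ[ℝ] E' := (mfderiv I I' φ q).toLinearMap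
  obtain ⟨v, -, -, -, -, hv⟩ := frame_surjective (V := E) (W := E') (T := T) (A₁ := B₁) (A₂ := B₂)
      (A₃ := B₃) (p := p)
      (fun v h0 h1 h2 h3 h4 => h.coframe q v ((asLinear_apply _ _).symm.trans h0)
        ((asLinear_apply _ _).symm.trans h1) ((asLinear_apply _ _).symm.trans h2)
        ((asLinear_apply _ _).symm.trans h3) h4)
      hdim 0 0 0 0 w
  exact ⟨v, hv⟩

omit [FiniteDimensional ℝ E] [FiniteDimensional ℝ E'] in
theorem IsAdapted.sq_eq_neg (h : IsAdapted n φ t A₁ A₂ A₃ g K τ₁ τ₂ τ₃)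
    (hJ : IsAdaptedStructure φ t A₁ A₂ A₃ K J) (q : N) (v : TangentSpace I q) :
    J q (J q v) = -v := by
  have add1 : ∀ (a : TangentSpace I q [⋀^Fin 1]→L[ℝ] ℝ) v w, a ![v + w] = a ![v] + a ![w] := by
    intro a v w
    simp only [← asLinear_apply, map_add]
  rw [eq_neg_iff_add_eq_zero]
  obtain ⟨a0, a1, a2, a3, a4⟩ := hJ q v
  obtain ⟨b0, b1, b2, b3, b4⟩ := hJ q (J q v)
  have l0 : 2 * Real.exp (2 * t q) ≠ 0 := by positivity
  refine h.coframe q _ ?_ ?_ ?_ ?_ ?_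
  · rw [add1, b0, a1]; ring
  · rw [add1]
    apply mul_left_cancel₀ l0
    linear_combination b1 + a0
  · rw [add1, b2, a3]; ring
  · rw [add1, b3, a2]; ring
  · rw [map_add, b4, a4, h.sq]
    simp

omit [FiniteDimensional ℝ E] [FiniteDimensional ℝ E'] in
theorem IsAdapted.compatible (h : IsAdapted n φ t A₁ A₂ A₃ g K τ₁ τ₂ τ₃)
    (hJ : IsAdaptedStructure φ t A₁ A₂ A₃ K J) (q : N) (v w : TangentSpace I q) :
    adaptedMetric n φ t A₁ A₂ A₃ g q (J q v) (J q w) = adaptedMetric n φ t A₁ A₂ A₃ g q v w := by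
  obtain ⟨a0, a1, a2, a3, a4⟩ := hJ q v
  obtain ⟨b0, b1, b2, b3, b4⟩ := hJ q w
  rw [adaptedMetric_apply, adaptedMetric_apply, a4, b4, h.isometry, a0, b0, a2, b2, a3, b3]
  have e : (2 * Real.exp (2 * t q)) ^ 2 * (A₁ q ![J q v] * A₁ q ![J q w])
      = DForm.ofFun (I := I) t q ![v] * DForm.ofFun (I := I) t q ![w] := by
    rw [← a1, ← b1]; ring
  linear_combination Real.exp (-(4 / (2 * (n : ℝ) + 1)) * t q) * e

omit [FiniteDimensional ℝ E] [FiniteDimensional ℝ E'] in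
theorem IsAdapted.form (h : IsAdapted n φ t A₁ A₂ A₃ g K τ₁ τ₂ τ₃)
    (hJ : IsAdaptedStructure φ t A₁ A₂ A₃ K J) (q : N) (v w : TangentSpace I q) :
    adaptedForm n φ t A₁ A₂ A₃ τ₁ q ![v, w] = adaptedMetric n φ t A₁ A₂ A₃ g q (J q v) w := by
  obtain ⟨a0, a1, a2, a3, a4⟩ := hJ q v
  rw [adaptedMetric_apply, adaptedForm_apply, a4, h.form₁, a0, a2, a3, ← a1]
  ring

omit [FiniteDimensional ℝ E] [FiniteDimensional ℝ E'] in
theorem IsAdapted.metric_pos (h : IsAdapted n φ t A₁ A₂ A₃ g K τ₁ τ₂ τ₃) (q : N)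
    (v : TangentSpace I q) (hv : v ≠ 0) : 0 < adaptedMetric n φ t A₁ A₂ A₃ g q v v := by
  rw [adaptedMetric_apply]
  refine mul_pos (Real.exp_pos _) ?_
  have hl : 0 < (2 * Real.exp (2 * t q)) ^ 2 := by positivity
  have hm := Real.exp_pos (2 * t q)
  have hg : 0 ≤ g (φ q) (mfderiv I I' φ q v) (mfderiv I I' φ q v) := by
    by_cases h0 : mfderiv I I' φ q v = 0
    · rw [h0]; simp
    · exact (h.pos _ _ h0).le
  set x₀ := DForm.ofFun (I := I) t q ![v] with hx₀
  set x₁ := A₁ q ![v] with hx₁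
  set x₂ := A₂ q ![v] with hx₂
  set x₃ := A₃ q ![v] with hx₃
  have n0 := mul_self_nonneg x₀
  have n1 := mul_self_nonneg x₁
  have n2 := mul_self_nonneg x₂
  have n3 := mul_self_nonneg x₃
  have hA : 0 ≤ (2 * Real.exp (2 * t q)) ^ 2 * (x₁ * x₁ + x₂ * x₂ + x₃ * x₃) :=
    mul_nonneg hl.le (by linarith)
  have hG := mul_nonneg hm.le hg
  by_contra hcon
  push Not at hcon
  have z0 : x₀ * x₀ = 0 := by linarith
  have zA : (2 * Real.exp (2 * t q)) ^ 2 * (x₁ * x₁ + x₂ * x₂ + x₃ * x₃) = 0 := by linarith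
  have zG : Real.exp (2 * t q) * g (φ q) (mfderiv I I' φ q v) (mfderiv I I' φ q v) = 0 := by
    linarith
  have zA' := (mul_eq_zero.1 zA).resolve_left hl.ne'
  have zG' := (mul_eq_zero.1 zG).resolve_left hm.ne'
  refine hv (h.coframe q v (mul_self_eq_zero.1 z0) (mul_self_eq_zero.1 (by linarith))
    (mul_self_eq_zero.1 (by linarith)) (mul_self_eq_zero.1 (by linarith)) ?_)
  by_contra h0
  exact (h.pos _ _ h0).ne' zG'

variable [I.Boundaryless] [I'.Boundaryless] [IsManifold I ∞ N] [IsManifold I' ∞ M]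

theorem IsAdapted.metric_isSmooth (h : IsAdapted n φ t A₁ A₂ A₃ g K τ₁ τ₂ τ₃) :
    (adaptedMetric n φ t A₁ A₂ A₃ g).IsSmooth := by
  intro x₀ y hy
  refine ContDiffAt.contDiffWithinAt (contDiffAt_clm fun v => contDiffAt_clm fun w => ?_)
  have ht := contDiffAt_comp_symm h.smooth_fun hy
  have hA : ∀ {Ω : DForm I N 1 ℝ}, Ω.IsSmooth → ∀ v, ContDiffAt ℝ ∞ (fun z => Ω.inChart x₀ z ![v]) y :=
    fun hΩ v => ContDiffWithinAt.alternating_apply (s := univ) (hΩ.contDiffAt hy)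
      fun _ => contDiffWithinAt_const
  have hg : ContDiffAt ℝ ∞ (fun z => (BilinField.pullback I' φ g : BilinField I N).inChart x₀ z v w) y :=
    (((BilinField.IsSmooth.pullback h.smooth_map h.smooth_metric x₀).contDiffAt
      ((isOpen_extChartAt_target x₀).mem_nhds hy)).clm_apply contDiffAt_const).clm_apply
        contDiffAt_const
  have e1 : ContDiffAt ℝ ∞
      (fun z => Real.exp (-(4 / (2 * (n : ℝ) + 1)) * t ((extChartAt I x₀).symm z))) y :=
    (contDiffAt_const.mul ht).exp
  have e2 : ContDiffAt ℝ ∞ (fun z => Real.exp (2 * t ((extChartAt I x₀).symm z))) y :=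
    (contDiffAt_const.mul ht).exp
  have e3 : ContDiffAt ℝ ∞ (fun z => (2 * Real.exp (2 * t ((extChartAt I x₀).symm z))) ^ 2) y :=
    (contDiffAt_const.mul e2).pow 2
  have hAA : ∀ {Ω : DForm I N 1 ℝ}, Ω.IsSmooth →
      ContDiffAt ℝ ∞ (fun z => Ω.inChart x₀ z ![v] * Ω.inChart x₀ z ![w]) y :=
    fun hΩ => (hA hΩ v).mul (hA hΩ w)
  have s1 : ContDiffAt ℝ ∞ (fun z => A₁.inChart x₀ z ![v] * A₁.inChart x₀ z ![w]
      + A₂.inChart x₀ z ![v] * A₂.inChart x₀ z ![w]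
      + A₃.inChart x₀ z ![v] * A₃.inChart x₀ z ![w]) y :=
    ((hAA h.smooth₁).add (hAA h.smooth₂)).add (hAA h.smooth₃)
  have s2 := e1.mul (((hAA (isSmooth_ofFun h.smooth_fun)).add (e3.mul s1)).add (e2.mul hg))
  refine s2.congr_of_eventuallyEq ?_
  filter_upwards [(isOpen_extChartAt_target x₀).mem_nhds hy] with z hz
  have e := adaptedMetric_apply (n := n) (φ := φ) (t := t) (A₁ := A₁) (A₂ := A₂) (A₃ := A₃) (g := g)
    ((extChartAt I x₀).symm z) (chartDinv I x₀ ((extChartAt I x₀).symm z) v)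
    (chartDinv I x₀ ((extChartAt I x₀).symm z) w)
  simp only [inChart_apply_one _ hz]
  have hgz : (BilinField.pullback I' φ g : BilinField I N).inChart x₀ z v w
      = g (φ ((extChartAt I x₀).symm z))
        (mfderiv I I' φ _ (chartDinv I x₀ ((extChartAt I x₀).symm z) v))
        (mfderiv I I' φ _ (chartDinv I x₀ ((extChartAt I x₀).symm z) w)) := rfl
  rw [hgz]
  refine Eq.trans ?_ e
  rfl

theorem IsAdapted.metric (h : IsAdapted n φ t A₁ A₂ A₃ g K τ₁ τ₂ τ₃) :
    IsRiemannianMetric (adaptedMetric n φ t A₁ A₂ A₃ g) := by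
  refine isRiemannianMetric_of_isSmooth h.metric_isSmooth (fun q v w => ?_) h.metric_pos
  rw [adaptedMetric_apply, adaptedMetric_apply, h.symm]
  ring

theorem IsAdapted.form_isSmooth (h : IsAdapted n φ t A₁ A₂ A₃ g K τ₁ τ₂ τ₃) :
    (adaptedForm n φ t A₁ A₂ A₃ τ₁).IsSmooth := by
  intro x₀ y hy
  have ht := contDiffAt_comp_symm h.smooth_fun hy
  have e1 : ContDiffAt ℝ ∞
      (fun z => Real.exp (-(4 / (2 * (n : ℝ) + 1)) * t ((extChartAt I x₀).symm z))) y :=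
    (contDiffAt_const.mul ht).exp
  have e2 : ContDiffAt ℝ ∞ (fun z => Real.exp (2 * t ((extChartAt I x₀).symm z))) y :=
    (contDiffAt_const.mul ht).exp
  have e3 : ContDiffAt ℝ ∞ (fun z => 2 * Real.exp (2 * t ((extChartAt I x₀).symm z))) y :=
    contDiffAt_const.mul e2
  have hS := (h.smooth_τ₁.pullback h.smooth_map).contDiffAt hy
  have w₁ := ContDiffWithinAt.wedge (e3.smul (h.smooth₂.contDiffAt hy)).contDiffWithinAt
    (s := univ) (e3.smul (h.smooth₃.contDiffAt hy)).contDiffWithinAt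
  have w₂ := ContDiffWithinAt.wedge
    ((isSmooth_ofFun h.smooth_fun).contDiffAt hy).contDiffWithinAt
    (s := univ) (e3.smul (h.smooth₁.contDiffAt hy)).contDiffWithinAt
  rw [adaptedForm_inChart]
  exact ContDiffAt.contDiffWithinAt (e1.smul (((e2.smul hS).add w₁).add w₂))

theorem IsAdapted.structure_isSmooth (h : IsAdapted n φ t A₁ A₂ A₃ g K τ₁ τ₂ τ₃)
    (hJ : IsAdaptedStructure φ t A₁ A₂ A₃ K J) (x₀ : N) :
    ContDiffOn ℝ ∞ (J.inChart x₀) (extChartAt I x₀).target := by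
  intro y hy
  have hn := (isOpen_extChartAt_target x₀).mem_nhds hy
  refine ContDiffAt.contDiffWithinAt (contDiffAt_clm fun v => ?_)
  have hdim : Module.finrank ℝ E = Module.finrank ℝ (E →L[ℝ] ℝ) :=
    Subspace.dual_finrank_eq.symm.trans
      (LinearMap.toContinuousLinearMap : (E →ₗ[ℝ] ℝ) ≃ₗ[ℝ] (E →L[ℝ] ℝ)).finrank_eq
  refine contDiffAt_of_apply_eq hdim
    (G := (adaptedMetric n φ t A₁ A₂ A₃ g).inChart x₀)
    (b := fun z => contractL v ((adaptedForm n φ t A₁ A₂ A₃ τ₁).inChart x₀ z))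
    ((h.metric_isSmooth x₀).contDiffAt hn)
    ((contractL (F := ℝ) v).contDiff.contDiffAt.comp y (h.form_isSmooth.contDiffAt hy)) ?_ ?_
  · filter_upwards [hn] with z hz
    rw [injective_iff_map_eq_zero]
    intro u hu
    by_contra h0
    have h1 : chartDinv I x₀ ((extChartAt I x₀).symm z) u ≠ 0 := by
      intro h2
      apply h0
      rw [← chartD_chartDinv ((extChartAt I x₀).map_target hz) u, h2, map_zero]
    exact (h.metric_pos _ _ h1).ne' (congrArg (fun L : E →L[ℝ] ℝ => L u) hu)
  · filter_upwards [hn] with z hz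
    ext w
    rw [contractL_apply, inChart_apply_two _ hz, h.form hJ]
    change adaptedMetric n φ t A₁ A₂ A₃ g _ (chartDinv I x₀ _ (J.inChart x₀ z v)) _ = _
    rw [chartDinv_endField_inChart J hz]
    rfl

theorem IsAdapted.isAlmostComplex (h : IsAdapted n φ t A₁ A₂ A₃ g K τ₁ τ₂ τ₃)
    (hJ : IsAdaptedStructure φ t A₁ A₂ A₃ K J) : IsAlmostComplex J where
  smooth := contMDiff_of_contMDiffOn_source fun x₀ =>
    (EndField.contMDiffOn_iff J x₀).2 (h.structure_isSmooth hJ x₀)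
  sq := h.sq_eq_neg hJ

omit [FiniteDimensional ℝ E] [I'.Boundaryless] [IsManifold I' ∞ M] [FiniteDimensional ℝ E'] in
theorem IsAdapted.fderiv_exp_mul (h : IsAdapted n φ t A₁ A₂ A₃ g K τ₁ τ₂ τ₃) (k : ℝ) {x₀ : N} {y : E}
    (hy : y ∈ (extChartAt I x₀).target) :
    DifferentiableAt ℝ (fun z => Real.exp (k * t ((extChartAt I x₀).symm z))) y ∧
      ∀ v, fderiv ℝ (fun z => Real.exp (k * t ((extChartAt I x₀).symm z))) y v
        = k * Real.exp (k * t ((extChartAt I x₀).symm y))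
          * (DForm.ofFun t : DForm I N 1 ℝ).inChart x₀ y ![v] := by
  have hd : DifferentiableAt ℝ (fun z => t ((extChartAt I x₀).symm z)) y :=
    (contDiffAt_comp_symm h.smooth_fun hy).differentiableAt (by norm_num)
  refine ⟨(hd.const_mul k).exp, fun v => ?_⟩
  rw [fderiv_exp (hd.const_mul k), fderiv_const_mul hd, ofFun_inChart_apply h.smooth_fun hy]
  simp only [smul_apply, smul_eq_mul]
  ring

theorem IsAdapted.isIntegrable (h : IsAdapted n φ t A₁ A₂ A₃ g K τ₁ τ₂ τ₃)
    (hJ : IsAdaptedStructure φ t A₁ A₂ A₃ K J) : IsIntegrable J := by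
  refine isIntegrable_of_nijenhuis_eq_zero (h.structure_isSmooth hJ) fun x v w => ?_
  set y := extChartAt I x x with hy'
  have hy : y ∈ (extChartAt I x).target := mem_extChartAt_target x
  have hn := (isOpen_extChartAt_target x).mem_nhds hy
  obtain ⟨hl, hl'⟩ := h.fderiv_exp_mul 2 hy
  have hl2 : DifferentiableAt ℝ (fun z => 2 * Real.exp (2 * t ((extChartAt I x).symm z))) y :=
    hl.const_mul 2
  have hdJ : DifferentiableAt ℝ (J.inChart x) y :=
    ((h.structure_isSmooth hJ x).contDiffAt hn).differentiableAt (by norm_num)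
  have r1 : ∀ z ∈ (extChartAt I x).target, ∀ (Ω : DForm I N 1 ℝ) v,
      Ω.inChart x z ![J.inChart x z v] = Ω ((extChartAt I x).symm z)
        ![J ((extChartAt I x).symm z) (chartDinv I x ((extChartAt I x).symm z) v)] := by
    intro z hz Ω v
    rw [inChart_apply_one Ω hz, chartDinv_endField_inChart J hz]
  have r2 : ∀ z ∈ (extChartAt I x).target, ∀ (τ : DForm I' M 2 ℝ) v w,
      (DForm.pullback I' φ τ : DForm I N 2 ℝ).inChart x z ![J.inChart x z v, w]
        = τ (φ ((extChartAt I x).symm z))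
          ![K _ (mfderiv I I' φ _ (chartDinv I x ((extChartAt I x).symm z) v)),
            mfderiv I I' φ _ (chartDinv I x ((extChartAt I x).symm z) w)] := by
    intro z hz τ v w
    rw [inChart_apply_two _ hz, pullback_apply_two, chartDinv_endField_inChart J hz,
      (hJ _ _).2.2.2.2]
  have r3 : ∀ z ∈ (extChartAt I x).target, ∀ v w,
      (DForm.pullback I' φ τ₁ : DForm I N 2 ℝ).inChart x z ![J.inChart x z v, J.inChart x z w]
        = (DForm.pullback I' φ τ₁ : DForm I N 2 ℝ).inChart x z ![v, w] := by
    intro z hz v w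
    rw [r2 z hz, chartDinv_endField_inChart J hz, (hJ _ _).2.2.2.2, inChart_apply_two _ hz,
      pullback_apply_two, h.form₁, h.form₁, h.isometry]
  refine nijenhuis_eq_zero (T := (DForm.ofFun t : DForm I N 1 ℝ).inChart x)
    (A₁ := A₁.inChart x) (A₂ := A₂.inChart x) (A₃ := A₃.inChart x)
    (S₁ := (DForm.pullback I' φ τ₁ : DForm I N 2 ℝ).inChart x)
    (S₂ := (DForm.pullback I' φ τ₂ : DForm I N 2 ℝ).inChart x)
    (S₃ := (DForm.pullback I' φ τ₃ : DForm I N 2 ℝ).inChart x)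
    (l := fun z => 2 * Real.exp (2 * t ((extChartAt I x).symm z)))
    ((isSmooth_ofFun h.smooth_fun).differentiableAt hy) (extDeriv_ofFun h.smooth_fun hy)
    hl2 (fun v => ?_) (by positivity) (h.smooth₁.differentiableAt hy)
    (h.smooth₂.differentiableAt hy) (h.smooth₃.differentiableAt hy) (h.d₁ x y hy) (h.d₂ x y hy)
    (h.d₃ x y hy) ((h.smooth_τ₂.pullback h.smooth_map).differentiableAt hy)
    ((h.smooth_τ₃.pullback h.smooth_map).differentiableAt hy) (h.d₂.closed h.smooth₂ hy)
    (h.d₃.closed h.smooth₃ hy) hdJ.hasFDerivAt ?_ ?_ ?_ (r3 y hy) (fun v => ?_) ?_ v w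
  · rw [fderiv_const_mul hl, smul_apply, hl', smul_eq_mul]
    ring
  · filter_upwards [hn] with z hz v
    rw [r1 z hz, r1 z hz, inChart_apply_one _ hz, inChart_apply_one _ hz]
    exact ⟨(hJ _ _).1, (hJ _ _).2.1⟩
  · filter_upwards [hn] with z hz v
    rw [r1 z hz, r1 z hz, inChart_apply_one _ hz, inChart_apply_one _ hz]
    exact ⟨(hJ _ _).2.2.1, (hJ _ _).2.2.2.1⟩
  · filter_upwards [hn] with z hz v w
    rw [r2 z hz, r2 z hz, inChart_apply_two _ hz, inChart_apply_two _ hz, pullback_apply_two,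
      pullback_apply_two]
    exact h.form₂₃ _ _ _
  · have hs := (extChartAt I x).map_target hy
    rw [← chartD_chartDinv hs (J.inChart x y (J.inChart x y v)), chartDinv_endField_inChart J hy,
      chartDinv_endField_inChart J hy, h.sq_eq_neg hJ, map_neg, chartD_chartDinv hs]
  · intro v h0 h1 h2 h3 h4
    have hs := (extChartAt I x).map_target hy
    rw [inChart_apply_one _ hy] at h0 h1 h2 h3
    have h5 : mfderiv I I' φ _ (chartDinv I x ((extChartAt I x).symm y) v) = 0 := by
      refine h.nondegenerate _ _ fun u => ?_
      obtain ⟨u', hu'⟩ := h.surjective_mfderiv _ u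
      have h6 := h4 (chartD I x ((extChartAt I x).symm y) u')
      rw [inChart_apply_two _ hy, pullback_apply_two, chartDinv_chartD hs, hu'] at h6
      exact h6
    rw [← chartD_chartDinv hs v, h.coframe _ _ h0 h1 h2 h3 h5, map_zero]

theorem IsAdapted.isHermitian (h : IsAdapted n φ t A₁ A₂ A₃ g K τ₁ τ₂ τ₃)
    (hJ : IsAdaptedStructure φ t A₁ A₂ A₃ K J) :
    IsHermitian (adaptedMetric n φ t A₁ A₂ A₃ g) J (adaptedForm n φ t A₁ A₂ A₃ τ₁) where
  metric := h.metric
  almostComplex := h.isAlmostComplex hJ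
  integrable := h.isIntegrable hJ
  compatible := h.compatible hJ
  smooth_form := h.form_isSmooth
  form := h.form hJ

omit [FiniteDimensional ℝ E] [FiniteDimensional ℝ E'] [I.Boundaryless] [I'.Boundaryless]
  [IsManifold I ∞ N] [IsManifold I' ∞ M] in
theorem IsAdapted.form₂₃_comp (h : IsAdapted n φ t A₁ A₂ A₃ g K τ₁ τ₂ τ₃) (x : M) :
    (τ₁ x).compContinuousLinearMap (K x) = τ₁ x ∧ (τ₂ x).compContinuousLinearMap (K x) = -τ₂ x ∧
      (τ₃ x).compContinuousLinearMap (K x) = -τ₃ x := by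
  have e : ∀ (τ : TangentSpace I' x [⋀^Fin 2]→L[ℝ] ℝ) v,
      τ.compContinuousLinearMap (K x) v = τ ![K x (v 0), K x (v 1)] := by
    intro τ v
    change τ _ = _
    congr 1
    funext i
    fin_cases i <;> rfl
  have e' : ∀ v : Fin 2 → TangentSpace I' x, v = ![v 0, v 1] := by
    intro v; funext i; fin_cases i <;> rfl
  have hr := two_form_relations_right (E := E') (S₂ := τ₂ x) (S₃ := τ₃ x) (J := K x) (h.form₂₃ x)
  refine ⟨?_, ?_, ?_⟩ <;> ext v <;> rw [e, e' v]
  · change τ₁ x ![K x (v 0), K x (v 1)] = _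
    rw [h.form₁, h.form₁, h.isometry]
  · change τ₂ x ![K x (v 0), K x (v 1)] = -τ₂ x ![v 0, v 1]
    rw [(h.form₂₃ x _ _).1]
    exact congrArg Neg.neg (hr _ _).2
  · change τ₃ x ![K x (v 0), K x (v 1)] = -τ₃ x ![v 0, v 1]
    rw [(h.form₂₃ x _ _).2]
    exact (hr _ _).1

theorem IsAdapted.isBalancedHermitian (h : IsAdapted n φ t A₁ A₂ A₃ g K τ₁ τ₂ τ₃) :
    IsBalancedHermitian (2 * n + 2) (adaptedMetric n φ t A₁ A₂ A₃ g)
      (adaptedForm n φ t A₁ A₂ A₃ τ₁) := by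
  obtain ⟨J, hJ⟩ := h.exists_structure
  refine ⟨by rw [h.finrank_total]; ring, ⟨J, h.isHermitian hJ⟩, ?_⟩
  funext x
  rw [d_eq]
  set y := extChartAt I x x with hy'
  have hy : y ∈ (extChartAt I x).target := mem_extChartAt_target x
  let Θ : DForm I N (2 * (2 * n + 1)) ℝ :=
    fun q => wedgePow (adaptedForm n φ t A₁ A₂ A₃ τ₁ q) (2 * n + 1)
  have e : Θ.inChart x
      = fun z => wedgePow ((adaptedForm n φ t A₁ A₂ A₃ τ₁).inChart x z) (2 * n + 1) := by
    funext z
    exact wedgePow_compContinuousLinearMap _ _ _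
  have pb : ∀ τ : DForm I' M 2 ℝ, (DForm.pullback I' φ τ : DForm I N 2 ℝ).inChart x y
      = (τ (φ ((extChartAt I x).symm y))).compContinuousLinearMap
        ((mfderiv I I' φ ((extChartAt I x).symm y)).comp
          (chartDinv I x ((extChartAt I x).symm y))) := by
    intro τ
    rw [inChart_eq _ hy]
    rfl
  have pw : ∀ (τ : DForm I' M 2 ℝ) N', wedge (τ (φ ((extChartAt I x).symm y)))
        (wedgePow (τ₁ (φ ((extChartAt I x).symm y))) N') = 0 →
      wedge ((DForm.pullback I' φ τ : DForm I N 2 ℝ).inChart x y)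
        (wedgePow ((DForm.pullback I' φ τ₁ : DForm I N 2 ℝ).inChart x y) N') = 0 := by
    intro τ N' h0
    rw [pb, pb, ← wedgePow_compContinuousLinearMap, ← wedge_compContinuousLinearMap, h0]
    rfl
  obtain ⟨i₁, i₂, i₃⟩ := h.form₂₃_comp (φ ((extChartAt I x).symm y))
  have hfin : Module.finrank ℝ (TangentSpace I' (φ ((extChartAt I x).symm y))) = 4 * n :=
    h.finrank_base
  have hfd : FiniteDimensional ℝ (TangentSpace I' (φ ((extChartAt I x).symm y))) :=
    inferInstanceAs (FiniteDimensional ℝ E')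
  obtain ⟨hf, hf'⟩ := h.fderiv_exp_mul (-(4 / (2 * (n : ℝ) + 1))) hy
  obtain ⟨hμ, hμ'⟩ := h.fderiv_exp_mul 2 hy
  have hk : -(4 / (2 * (n : ℝ) + 1)) * (2 * n + 1) = -4 := by
    have : (2 * (n : ℝ) + 1) ≠ 0 := by positivity
    field_simp
  have key := extDeriv_wedgePow_eq_zero n hk
    ((isSmooth_ofFun h.smooth_fun).differentiableAt hy) (extDeriv_ofFun h.smooth_fun hy)
    hμ hμ' hf hf' (h.smooth₁.differentiableAt hy)
    (h.smooth₂.differentiableAt hy) (h.smooth₃.differentiableAt hy) (h.d₁ x y hy) (h.d₂ x y hy)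
    (h.d₃ x y hy) ((h.smooth_τ₁.pullback h.smooth_map).differentiableAt hy)
    (h.d₁.closed h.smooth₁ hy)
    (fun N' hN => pw _ _ (wedge_wedgePow_eq_zero_of_lt hfin _ _ hN))
    (fun N' hN => pw _ _ (wedge_wedgePow_eq_zero_of_anti hfin (h.sq _) i₂ i₁ hN))
    (fun N' hN => pw _ _ (wedge_wedgePow_eq_zero_of_anti hfin (h.sq _) i₃ i₁ hN))
  have key' : extDeriv (Θ.inChart x) y = 0 := by
    rw [e, adaptedForm_inChart]
    exact key
  refine (congrArg (fun η : E [⋀^Fin (2 * (2 * n + 1) + 1)]→L[ℝ] ℝ =>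
    η.compContinuousLinearMap (chartD I x x)) key').trans ?_
  rfl

end Adapted

theorem quaternion_comb_mul {V : Type*} [AddCommGroup V] [Module ℝ V] {J₁ J₂ J₃ : V →ₗ[ℝ] V}
    (s₁ : ∀ v, J₁ (J₁ v) = -v) (s₂ : ∀ v, J₂ (J₂ v) = -v) (s₃ : ∀ v, J₃ (J₃ v) = -v)
    (m₁₂ : ∀ v, J₁ (J₂ v) = J₃ v) (m₂₃ : ∀ v, J₂ (J₃ v) = J₁ v) (m₃₁ : ∀ v, J₃ (J₁ v) = J₂ v)
    (u₁ u₂ u₃ w₁ w₂ w₃ : ℝ) (v : V) :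
    u₁ • J₁ (w₁ • J₁ v + w₂ • J₂ v + w₃ • J₃ v) + u₂ • J₂ (w₁ • J₁ v + w₂ • J₂ v + w₃ • J₃ v)
      + u₃ • J₃ (w₁ • J₁ v + w₂ • J₂ v + w₃ • J₃ v)
      = (u₂ * w₃ - u₃ * w₂) • J₁ v + (u₃ * w₁ - u₁ * w₃) • J₂ v + (u₁ * w₂ - u₂ * w₁) • J₃ v
        - (u₁ * w₁ + u₂ * w₂ + u₃ * w₃) • v := by
  have m₂₁ : J₂ (J₁ v) = -J₃ v := by rw [← m₂₃ v, s₂]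
  have m₃₂ : J₃ (J₂ v) = -J₁ v := by rw [← m₃₁ v, s₃]
  have m₁₃ : J₁ (J₃ v) = -J₂ v := by rw [← m₁₂ v, s₁]
  simp only [map_add, map_smul, s₁, s₂, s₃, m₁₂, m₂₃, m₃₁, m₂₁, m₃₂, m₁₃]
  module

section HyperKahler

variable {E : Type*} [NormedAddCommGroup E] [NormedSpace ℝ E]
  {H : Type*} [TopologicalSpace H] {I : ModelWithCorners ℝ E H}
  {M : Type*} [TopologicalSpace M] [ChartedSpace H M] [IsManifold I ∞ M]

/-- The combination `u₁ J₁ + u₂ J₂ + u₃ J₃`. -/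
def EndField.comb (u₁ u₂ u₃ : ℝ) (J₁ J₂ J₃ : EndField I M) : EndField I M :=
  fun x => u₁ • J₁ x + u₂ • J₂ x + u₃ • J₃ x

variable {g : BilinField I M} {J₁ J₂ J₃ : EndField I M} {σ₁ σ₂ σ₃ : DForm I M 2 ℝ}

theorem IsHyperKahler.comb_mul (h : IsHyperKahler g J₁ J₂ J₃ σ₁ σ₂ σ₃) (u₁ u₂ u₃ w₁ w₂ w₃ : ℝ)
    (x : M) (v : TangentSpace I x) :
    EndField.comb u₁ u₂ u₃ J₁ J₂ J₃ x (EndField.comb w₁ w₂ w₃ J₁ J₂ J₃ x v)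
      = EndField.comb (u₂ * w₃ - u₃ * w₂) (u₃ * w₁ - u₁ * w₃) (u₁ * w₂ - u₂ * w₁) J₁ J₂ J₃ x v
        - (u₁ * w₁ + u₂ * w₂ + u₃ * w₃) • v :=
  quaternion_comb_mul (J₁ := (J₁ x).toLinearMap) (J₂ := (J₂ x).toLinearMap)
    (J₃ := (J₃ x).toLinearMap) (h.hermitian₁.almostComplex.sq x)
    (h.hermitian₂.almostComplex.sq x) (h.hermitian₃.almostComplex.sq x) (h.mul₁₂ x) (h.mul₂₃ x)
    (h.mul₃₁ x) u₁ u₂ u₃ w₁ w₂ w₃ v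

theorem IsHyperKahler.comb_form (h : IsHyperKahler g J₁ J₂ J₃ σ₁ σ₂ σ₃) (u₁ u₂ u₃ : ℝ)
    (x : M) (v w : TangentSpace I x) :
    DForm.comb u₁ u₂ u₃ σ₁ σ₂ σ₃ x ![v, w] = g x (EndField.comb u₁ u₂ u₃ J₁ J₂ J₃ x v) w := by
  have e1 : DForm.comb u₁ u₂ u₃ σ₁ σ₂ σ₃ x ![v, w]
      = u₁ * σ₁ x ![v, w] + u₂ * σ₂ x ![v, w] + u₃ * σ₃ x ![v, w] := rfl
  have e2 : EndField.comb u₁ u₂ u₃ J₁ J₂ J₃ x v = u₁ • J₁ x v + u₂ • J₂ x v + u₃ • J₃ x v := rfl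
  rw [e1, e2, h.hermitian₁.form, h.hermitian₂.form, h.hermitian₃.form]
  simp only [map_add, map_smul, add_apply, smul_apply, smul_eq_mul]

theorem IsHyperKahler.symm (h : IsHyperKahler g J₁ J₂ J₃ σ₁ σ₂ σ₃) (x : M)
    (v w : TangentSpace I x) : g x v w = g x w v := by
  obtain ⟨G, hG⟩ := h.hermitian₁.metric
  rw [← hG]
  exact G.symm x v w

theorem IsHyperKahler.pos (h : IsHyperKahler g J₁ J₂ J₃ σ₁ σ₂ σ₃) (x : M)
    (v : TangentSpace I x) (hv : v ≠ 0) : 0 < g x v v := by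
  obtain ⟨G, hG⟩ := h.hermitian₁.metric
  rw [← hG]
  exact G.pos x v hv

theorem IsHyperKahler.comb_sq (h : IsHyperKahler g J₁ J₂ J₃ σ₁ σ₂ σ₃) {u₁ u₂ u₃ : ℝ}
    (hu : u₁ ^ 2 + u₂ ^ 2 + u₃ ^ 2 = 1) (x : M) (v : TangentSpace I x) :
    EndField.comb u₁ u₂ u₃ J₁ J₂ J₃ x (EndField.comb u₁ u₂ u₃ J₁ J₂ J₃ x v) = -v := by
  have e : EndField.comb 0 0 0 J₁ J₂ J₃ x v = (0 : ℝ) • J₁ x v + (0 : ℝ) • J₂ x v + (0 : ℝ) • J₃ x v :=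
    rfl
  rw [h.comb_mul, show u₂ * u₃ - u₃ * u₂ = 0 by ring, show u₃ * u₁ - u₁ * u₃ = 0 by ring,
    show u₁ * u₂ - u₂ * u₁ = 0 by ring, e, show u₁ * u₁ + u₂ * u₂ + u₃ * u₃ = 1 by linarith]
  simp

theorem IsHyperKahler.comb_isometry (h : IsHyperKahler g J₁ J₂ J₃ σ₁ σ₂ σ₃) {u₁ u₂ u₃ : ℝ}
    (hu : u₁ ^ 2 + u₂ ^ 2 + u₃ ^ 2 = 1) (x : M) (v w : TangentSpace I x) :
    g x (EndField.comb u₁ u₂ u₃ J₁ J₂ J₃ x v) (EndField.comb u₁ u₂ u₃ J₁ J₂ J₃ x w) = g x v w := by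
  rw [← h.comb_form]
  have e := two_form_swap (E := E) (DForm.comb u₁ u₂ u₃ σ₁ σ₂ σ₃ x) v
    (EndField.comb u₁ u₂ u₃ J₁ J₂ J₃ x w)
  refine e.trans ?_
  refine (congrArg Neg.neg (h.comb_form u₁ u₂ u₃ x _ v)).trans ?_
  rw [h.comb_sq hu, h.symm x v w]
  simp

theorem IsHyperKahler.comb_nondegenerate (h : IsHyperKahler g J₁ J₂ J₃ σ₁ σ₂ σ₃) {u₁ u₂ u₃ : ℝ}
    (hu : u₁ ^ 2 + u₂ ^ 2 + u₃ ^ 2 = 1) (x : M) (v : TangentSpace I x)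
    (hv : ∀ w, DForm.comb u₁ u₂ u₃ σ₁ σ₂ σ₃ x ![w, v] = 0) : v = 0 := by
  by_contra h0
  have e := h.comb_form u₁ u₂ u₃ x (EndField.comb u₁ u₂ u₃ J₁ J₂ J₃ x v) v
  rw [hv, h.comb_sq hu] at e
  have := h.pos x v h0
  simp at e
  linarith

end HyperKahler

section TorusConstruction

variable {E : Type*} [NormedAddCommGroup E] [NormedSpace ℝ E]
  {H : Type*} [TopologicalSpace H] {I : ModelWithCorners ℝ E H}
  {M : Type*} [TopologicalSpace M] [ChartedSpace H M]
  {E' : Type*} [NormedAddCommGroup E'] [NormedSpace ℝ E']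
  {H' : Type*} [TopologicalSpace H'] {I' : ModelWithCorners ℝ E' H'}
  {P : Type*} [TopologicalSpace P] [ChartedSpace H' P]
  {pr : P → M} {α ξ η : DForm I' P 1 ℝ}

/-- The `1`-form `u₁ α - u₂ ξ - u₃ η` on `ℝ × P`. -/
def coframeForm (u₁ u₂ u₃ : ℝ) (α ξ η : DForm I' P 1 ℝ) : DForm (𝓘(ℝ, ℝ).prod I') (ℝ × P) 1 ℝ :=
  DForm.comb u₁ (-u₂) (-u₃) (liftTotal α) (liftTotal ξ) (liftTotal η)

theorem coframeForm_apply (u₁ u₂ u₃ : ℝ) (q : ℝ × P) (v : TangentSpace (𝓘(ℝ, ℝ).prod I') q) :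
    coframeForm u₁ u₂ u₃ α ξ η q ![v]
      = u₁ * liftTotal α q ![v] - u₂ * liftTotal ξ q ![v] - u₃ * liftTotal η q ![v] := by
  have e : coframeForm u₁ u₂ u₃ α ξ η q ![v]
      = u₁ * liftTotal α q ![v] + -u₂ * liftTotal ξ q ![v] + -u₃ * liftTotal η q ![v] := rfl
  rw [e]
  ring

theorem mfderiv_comp_snd (hpr : ContMDiff I' I ∞ pr) (q : ℝ × P)
    (v : TangentSpace (𝓘(ℝ, ℝ).prod I') q) :
    mfderiv (𝓘(ℝ, ℝ).prod I') I (fun q : ℝ × P => pr q.2) q v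
      = mfderiv I' I pr q.2 (mfderiv (𝓘(ℝ, ℝ).prod I') I' Prod.snd q v) := by
  have h := mfderiv_comp q ((hpr q.2).mdifferentiableAt (by norm_num))
    (mdifferentiableAt_snd (I := 𝓘(ℝ, ℝ)) (I' := I') (x := q))
  exact congrArg (fun L : ℝ × E' →L[ℝ] E => L v) h

theorem liftTotal_pullback (hpr : ContMDiff I' I ∞ pr) {k : ℕ} (σ : DForm I M k ℝ) :
    liftTotal (DForm.pullback I pr σ : DForm I' P k ℝ) = liftBase (I' := I') pr σ := by
  funext q
  ext v
  change σ (pr q.2) _ = σ (pr q.2) _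
  congr 1
  funext i
  exact (mfderiv_comp_snd hpr q (v i)).symm

theorem liftTotal_apply_one (q : ℝ × P) (v : TangentSpace (𝓘(ℝ, ℝ).prod I') q) :
    liftTotal α q ![v] = α q.2 ![mfderiv (𝓘(ℝ, ℝ).prod I') I' Prod.snd q v] := by
  change α q.2 _ = _
  congr 1
  funext i
  fin_cases i
  rfl

variable [FiniteDimensional ℝ E'] [I'.Boundaryless] [IsManifold I' ∞ P]

theorem isSmooth_liftTotal (h : α.IsSmooth) : (liftTotal α).IsSmooth :=
  h.pullback contMDiff_snd

theorem isSmooth_coframeForm (u₁ u₂ u₃ : ℝ) (h₁ : α.IsSmooth) (h₂ : ξ.IsSmooth)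
    (h₃ : η.IsSmooth) : (coframeForm u₁ u₂ u₃ α ξ η).IsSmooth :=
  (isSmooth_liftTotal h₁).comb _ _ _ (isSmooth_liftTotal h₂) (isSmooth_liftTotal h₃)

theorem hasD_coframeForm (hpr : ContMDiff I' I ∞ pr) (u₁ u₂ u₃ : ℝ) (h₁ : α.IsSmooth)
    (h₂ : ξ.IsSmooth) (h₃ : η.IsSmooth) {σ₁ σ₂ σ₃ : DForm I M 2 ℝ}
    (hα : α.d = DForm.pullback I pr σ₁) (hξ : ξ.d = -DForm.pullback I pr σ₂)
    (hη : η.d = -DForm.pullback I pr σ₃) :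
    (coframeForm u₁ u₂ u₃ α ξ η).HasD
      (DForm.pullback I (fun q : ℝ × P => pr q.2) (DForm.comb u₁ u₂ u₃ σ₁ σ₂ σ₃)) := by
  have d : ∀ {β : DForm I' P 1 ℝ}, β.IsSmooth → (liftTotal β).HasD (liftTotal β.d) :=
    fun hβ => DForm.hasD_pullback contMDiff_snd hβ
  have e := DForm.HasD.comb u₁ (-u₂) (-u₃) (isSmooth_liftTotal h₁) (isSmooth_liftTotal h₂)
    (isSmooth_liftTotal h₃) (d h₁) (d h₂) (d h₃)
  have e2 : DForm.comb u₁ (-u₂) (-u₃) (liftTotal α.d) (liftTotal ξ.d) (liftTotal η.d)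
      = DForm.pullback I (fun q : ℝ × P => pr q.2) (DForm.comb u₁ u₂ u₃ σ₁ σ₂ σ₃) := by
    have neg : ∀ σ : DForm I M 2 ℝ, liftTotal (-DForm.pullback I pr σ : DForm I' P 2 ℝ)
        = -liftBase pr σ := fun σ => by
      rw [← liftTotal_pullback hpr]
      rfl
    rw [hα, hξ, hη, neg, neg, liftTotal_pullback hpr]
    funext q
    change u₁ • liftBase (I' := I') pr σ₁ q + -u₂ • -liftBase (I' := I') pr σ₂ q
        + -u₃ • -liftBase (I' := I') pr σ₃ q
      = u₁ • liftBase (I' := I') pr σ₁ q + u₂ • liftBase (I' := I') pr σ₂ q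
        + u₃ • liftBase (I' := I') pr σ₃ q
    simp only [smul_neg, neg_smul, neg_neg]
  rw [← e2]
  exact e

end TorusConstruction

theorem oriented_frame_columns {a b c q₁ q₂ q₃ : ℝ}
    (hp : a ^ 2 + b ^ 2 + c ^ 2 = 1) (hq : q₁ ^ 2 + q₂ ^ 2 + q₃ ^ 2 = 1)
    (hpq : a * q₁ + b * q₂ + c * q₃ = 0) :
    a * a + q₁ * q₁ + (b * q₃ - c * q₂) * (b * q₃ - c * q₂) = 1 ∧
    b * b + q₂ * q₂ + (c * q₁ - a * q₃) * (c * q₁ - a * q₃) = 1 ∧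
    c * c + q₃ * q₃ + (a * q₂ - b * q₁) * (a * q₂ - b * q₁) = 1 ∧
    a * b + q₁ * q₂ + (b * q₃ - c * q₂) * (c * q₁ - a * q₃) = 0 ∧
    a * c + q₁ * q₃ + (b * q₃ - c * q₂) * (a * q₂ - b * q₁) = 0 ∧
    b * c + q₂ * q₃ + (c * q₁ - a * q₃) * (a * q₂ - b * q₁) = 0 := by
  refine ⟨?_, ?_, ?_, ?_, ?_, ?_⟩
  · linear_combination (q₁ ^ 2 + q₂ ^ 2 + q₃ ^ 2) * hp + hq
      + (2 * a * q₁ - (a * q₁ + b * q₂ + c * q₃)) * hpq - a ^ 2 * hq - q₁ ^ 2 * hp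
  · linear_combination (q₁ ^ 2 + q₂ ^ 2 + q₃ ^ 2) * hp + hq
      + (2 * b * q₂ - (a * q₁ + b * q₂ + c * q₃)) * hpq - b ^ 2 * hq - q₂ ^ 2 * hp
  · linear_combination (q₁ ^ 2 + q₂ ^ 2 + q₃ ^ 2) * hp + hq
      + (2 * c * q₃ - (a * q₁ + b * q₂ + c * q₃)) * hpq - c ^ 2 * hq - q₃ ^ 2 * hp
  · linear_combination -q₁ * q₂ * hp - a * b * hq + (q₂ * a + q₁ * b) * hpq
  · linear_combination -q₁ * q₃ * hp - a * c * hq + (q₃ * a + q₁ * c) * hpq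
  · linear_combination -q₂ * q₃ * hp - b * c * hq + (q₃ * b + q₂ * c) * hpq

section TorusConstruction

variable {E : Type*} [NormedAddCommGroup E] [NormedSpace ℝ E] [FiniteDimensional ℝ E]
  {H : Type*} [TopologicalSpace H] {I : ModelWithCorners ℝ E H} [I.Boundaryless]
  {M : Type*} [TopologicalSpace M] [ChartedSpace H M] [IsManifold I ∞ M]
  {E' : Type*} [NormedAddCommGroup E'] [NormedSpace ℝ E'] [FiniteDimensional ℝ E']
  {H' : Type*} [TopologicalSpace H'] {I' : ModelWithCorners ℝ E' H'} [I'.Boundaryless]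
  {P : Type*} [TopologicalSpace P] [ChartedSpace H' P] [IsManifold I' ∞ P] [MulAction Torus3 P]
  {pr : P → M} {α ξ η : DForm I' P 1 ℝ} {g : BilinField I M} {J₁ J₂ J₃ : EndField I M}
  {σ₁ σ₂ σ₃ : DForm I M 2 ℝ}

omit [FiniteDimensional ℝ E] [I.Boundaryless] [IsManifold I ∞ M] [I'.Boundaryless] in
theorem coframe_eq_zero (hpr : IsPrincipalTorusBundle I I' pr)
    (hconn : IsTorusConnection I' ![α, ξ, η]) (q : ℝ × P)
    (v : TangentSpace (𝓘(ℝ, ℝ).prod I') q) (ht : dtForm q ![v] = 0)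
    (h₁ : liftTotal α q ![v] = 0) (h₂ : liftTotal ξ q ![v] = 0) (h₃ : liftTotal η q ![v] = 0)
    (hv : mfderiv (𝓘(ℝ, ℝ).prod I') I (fun q : ℝ × P => pr q.2) q v = 0) : v = 0 := by
  rw [liftTotal_apply_one] at h₁ h₂ h₃
  rw [mfderiv_comp_snd hpr.smooth_proj] at hv
  have h2 := IsTorusConnection.eq_zero hpr hconn q.2 _ hv (by
    intro i
    fin_cases i
    · exact h₁
    · exact h₂
    · exact h₃)
  rw [mfderiv_snd] at h2
  have h1 : mfderiv (𝓘(ℝ, ℝ).prod I') 𝓘(ℝ, ℝ) (Prod.fst : ℝ × P → ℝ) q v = 0 := ht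
  rw [mfderiv_fst] at h1
  exact Prod.ext h1 h2

omit [FiniteDimensional ℝ E] in
theorem isAdapted_coframeForm {n : ℕ} (hM : IsHyperKahler g J₁ J₂ J₃ σ₁ σ₂ σ₃)
    (hpr : IsPrincipalTorusBundle I I' pr) (hconn : IsTorusConnection I' ![α, ξ, η])
    (hα : α.d = DForm.pullback I pr σ₁) (hξ : ξ.d = -DForm.pullback I pr σ₂)
    (hη : η.d = -DForm.pullback I pr σ₃) (hE : Module.finrank ℝ E = 4 * n)
    (hE' : Module.finrank ℝ E' = 4 * n + 3) {a b c q₁ q₂ q₃ : ℝ}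
    (hp : a ^ 2 + b ^ 2 + c ^ 2 = 1) (hq : q₁ ^ 2 + q₂ ^ 2 + q₃ ^ 2 = 1)
    (hpq : a * q₁ + b * q₂ + c * q₃ = 0) :
    IsAdapted n (fun q : ℝ × P => pr q.2) Prod.fst (coframeForm a b c α ξ η)
      (coframeForm q₁ q₂ q₃ α ξ η)
      (coframeForm (b * q₃ - c * q₂) (c * q₁ - a * q₃) (a * q₂ - b * q₁) α ξ η) g
      (EndField.comb a b c J₁ J₂ J₃) (DForm.comb a b c σ₁ σ₂ σ₃) (DForm.comb q₁ q₂ q₃ σ₁ σ₂ σ₃)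
      (DForm.comb (b * q₃ - c * q₂) (c * q₁ - a * q₃) (a * q₂ - b * q₁) σ₁ σ₂ σ₃) := by
  have sα : α.IsSmooth := hconn.smooth 0
  have sξ : ξ.IsSmooth := hconn.smooth 1
  have sη : η.IsSmooth := hconn.smooth 2
  have s₁ := hM.hermitian₁.smooth_form
  have s₂ := hM.hermitian₂.smooth_form
  have s₃ := hM.hermitian₃.smooth_form
  refine
    { smooth_map := hpr.smooth_proj.comp contMDiff_snd
      smooth_fun := contMDiff_fst
      smooth₁ := isSmooth_coframeForm _ _ _ sα sξ sη
      smooth₂ := isSmooth_coframeForm _ _ _ sα sξ sη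
      smooth₃ := isSmooth_coframeForm _ _ _ sα sξ sη
      smooth_τ₁ := s₁.comb _ _ _ s₂ s₃
      smooth_τ₂ := s₁.comb _ _ _ s₂ s₃
      smooth_τ₃ := s₁.comb _ _ _ s₂ s₃
      d₁ := hasD_coframeForm hpr.smooth_proj _ _ _ sα sξ sη hα hξ hη
      d₂ := hasD_coframeForm hpr.smooth_proj _ _ _ sα sξ sη hα hξ hη
      d₃ := hasD_coframeForm hpr.smooth_proj _ _ _ sα sξ sη hα hξ hη
      smooth_metric := hM.hermitian₁.metric.isSmooth
      symm := hM.symm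
      pos := hM.pos
      sq := hM.comb_sq hp
      isometry := hM.comb_isometry hp
      form₁ := hM.comb_form a b c
      form₂₃ := fun x v w => ⟨?_, ?_⟩
      nondegenerate := hM.comb_nondegenerate hq
      coframe := fun q v h0 h1 h2 h3 hv => ?_
      finrank_base := hE
      finrank_total := by
        rw [Module.finrank_prod, Module.finrank_self, hE']
        ring }
  · rw [hM.comb_form, hM.comb_form, hM.comb_mul,
      show q₁ * a + q₂ * b + q₃ * c = 0 by linarith, zero_smul, sub_zero, ← hM.comb_form,
      ← hM.comb_form]
    simp only [DForm.comb, ContinuousAlternatingMap.add_apply, ContinuousAlternatingMap.smul_apply,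
      smul_eq_mul]
    ring
  · rw [hM.comb_form, hM.comb_form, hM.comb_mul,
      show (b * q₃ - c * q₂) * a + (c * q₁ - a * q₃) * b + (a * q₂ - b * q₁) * c = 0 by ring,
      zero_smul, sub_zero,
      show (c * q₁ - a * q₃) * c - (a * q₂ - b * q₁) * b = q₁ by
        linear_combination q₁ * hp - a * hpq,
      show (a * q₂ - b * q₁) * a - (b * q₃ - c * q₂) * c = q₂ by
        linear_combination q₂ * hp - b * hpq,
      show (b * q₃ - c * q₂) * b - (c * q₁ - a * q₃) * a = q₃ by
        linear_combination q₃ * hp - c * hpq]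
  · obtain ⟨c₁₁, c₂₂, c₃₃, c₁₂, c₁₃, c₂₃⟩ := oriented_frame_columns hp hq hpq
    rw [coframeForm_apply] at h1 h2 h3
    refine coframe_eq_zero hpr hconn q v h0 ?_ ?_ ?_ hv
    all_goals
      generalize liftTotal α q ![v] = x at *
      generalize liftTotal ξ q ![v] = y at *
      generalize liftTotal η q ![v] = z at *
    · linear_combination (a * h1 + q₁ * h2 + (b * q₃ - c * q₂) * h3) - x * c₁₁ + y * c₁₂ + z * c₁₃
    · linear_combination -(b * h1 + q₂ * h2 + (c * q₁ - a * q₃) * h3) + x * c₁₂ - y * c₂₂ - z * c₂₃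
    · linear_combination -(c * h1 + q₃ * h2 + (a * q₂ - b * q₁) * h3) + x * c₁₃ - y * c₂₃ - z * c₃₃

end TorusConstruction

theorem adaptedMetric_coframeForm {E : Type*} [NormedAddCommGroup E] [NormedSpace ℝ E]
    {H : Type*} [TopologicalSpace H] {I : ModelWithCorners ℝ E H}
    {M : Type*} [TopologicalSpace M] [ChartedSpace H M]
    {E' : Type*} [NormedAddCommGroup E'] [NormedSpace ℝ E']
    {H' : Type*} [TopologicalSpace H'] {I' : ModelWithCorners ℝ E' H'}
    {P : Type*} [TopologicalSpace P] [ChartedSpace H' P]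
    (n : ℕ) (pr : P → M) (α ξ η : DForm I' P 1 ℝ) (g : BilinField I M) {a b c q₁ q₂ q₃ : ℝ}
    (hp : a ^ 2 + b ^ 2 + c ^ 2 = 1) (hq : q₁ ^ 2 + q₂ ^ 2 + q₃ ^ 2 = 1)
    (hpq : a * q₁ + b * q₂ + c * q₃ = 0) :
    adaptedMetric n (fun q : ℝ × P => pr q.2) Prod.fst (coframeForm a b c α ξ η)
      (coframeForm q₁ q₂ q₃ α ξ η)
      (coframeForm (b * q₃ - c * q₂) (c * q₁ - a * q₃) (a * q₂ - b * q₁) α ξ η) g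
      = fun q => conformalFactor n q • metricN pr g α ξ η q := by
  funext q
  have e : sqForm (coframeForm a b c α ξ η q) + sqForm (coframeForm q₁ q₂ q₃ α ξ η q)
      + sqForm (coframeForm (b * q₃ - c * q₂) (c * q₁ - a * q₃) (a * q₂ - b * q₁) α ξ η q)
      = sqForm (liftTotal α q) + sqForm (liftTotal ξ q) + sqForm (liftTotal η q) := by
    ext v w
    simp only [add_apply, sqForm_apply, coframeForm_apply]
    generalize liftTotal α q ![v] = x
    generalize liftTotal ξ q ![v] = y
    generalize liftTotal η q ![v] = z
    generalize liftTotal α q ![w] = x'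
    generalize liftTotal ξ q ![w] = y'
    generalize liftTotal η q ![w] = z'
    obtain ⟨c₁₁, c₂₂, c₃₃, c₁₂, c₁₃, c₂₃⟩ := oriented_frame_columns hp hq hpq
    linear_combination x * x' * c₁₁ + y * y' * c₂₂ + z * z' * c₃₃ - (x * y' + y * x') * c₁₂
      - (x * z' + z * x') * c₁₃ + (y * z' + z * y') * c₂₃
  rw [adaptedMetric, e]
  rfl

theorem adaptedForm_coframeForm {E : Type*} [NormedAddCommGroup E] [NormedSpace ℝ E]
    {H : Type*} [TopologicalSpace H] {I : ModelWithCorners ℝ E H}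
    {M : Type*} [TopologicalSpace M] [ChartedSpace H M]
    {E' : Type*} [NormedAddCommGroup E'] [NormedSpace ℝ E']
    {H' : Type*} [TopologicalSpace H'] {I' : ModelWithCorners ℝ E' H'}
    {P : Type*} [TopologicalSpace P] [ChartedSpace H' P]
    (n : ℕ) (pr : P → M) (α ξ η : DForm I' P 1 ℝ) (σ₁ σ₂ σ₃ : DForm I M 2 ℝ) {a b c q₁ q₂ q₃ : ℝ}
    (hq : q₁ ^ 2 + q₂ ^ 2 + q₃ ^ 2 = 1) (hpq : a * q₁ + b * q₂ + c * q₃ = 0) :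
    adaptedForm n (fun q : ℝ × P => pr q.2) Prod.fst (coframeForm a b c α ξ η)
      (coframeForm q₁ q₂ q₃ α ξ η)
      (coframeForm (b * q₃ - c * q₂) (c * q₁ - a * q₃) (a * q₂ - b * q₁) α ξ η)
      (DForm.comb a b c σ₁ σ₂ σ₃)
      = fun q => a • (conformalFactor n q • omega₁ pr σ₁ α ξ η q)
        + b • (conformalFactor n q • omega₂ pr σ₂ α ξ η q)
        + c • (conformalFactor n q • omega₃ pr σ₃ α ξ η q) := by
  funext q
  ext v
  have ev : v = ![v 0, v 1] := by funext i; fin_cases i <;> rfl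
  rw [ev, adaptedForm_apply]
  have e : ∀ σ : DForm I M 2 ℝ, σ (pr q.2)
      ![mfderiv (𝓘(ℝ, ℝ).prod I') I (fun q : ℝ × P => pr q.2) q (v 0),
        mfderiv (𝓘(ℝ, ℝ).prod I') I (fun q : ℝ × P => pr q.2) q (v 1)]
      = liftBase (I' := I') pr σ q ![v 0, v 1] := fun σ =>
    (pullback_apply_two (fun q : ℝ × P => pr q.2) σ q (v 0) (v 1)).symm
  have sm : ∀ (r : ℝ) (a : TangentSpace (𝓘(ℝ, ℝ).prod I') q [⋀^Fin 1]→L[ℝ] ℝ) v,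
    (r • a) ![v] = r * a ![v] := fun _ _ _ => rfl
  have cb : DForm.comb a b c σ₁ σ₂ σ₃ (pr q.2)
      ![mfderiv (𝓘(ℝ, ℝ).prod I') I (fun q : ℝ × P => pr q.2) q (v 0),
        mfderiv (𝓘(ℝ, ℝ).prod I') I (fun q : ℝ × P => pr q.2) q (v 1)]
      = a * liftBase (I' := I') pr σ₁ q ![v 0, v 1] + b * liftBase (I' := I') pr σ₂ q ![v 0, v 1]
        + c * liftBase (I' := I') pr σ₃ q ![v 0, v 1] := by
    rw [← e, ← e, ← e]
    rfl
  rw [cb]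
  simp only [omega₁, omega₂, omega₃, ContinuousAlternatingMap.add_apply,
    ContinuousAlternatingMap.smul_apply, smul_eq_mul, wedge_one_one_apply, sm, coframeForm_apply,
    conformalFactor]
  change Real.exp (-(4 / (2 * (n : ℝ) + 1)) * q.1) * _ = _
  have hT : (DForm.ofFun Prod.fst : DForm (𝓘(ℝ, ℝ).prod I') (ℝ × P) 1 ℝ) = dtForm := rfl
  rw [hT]
  generalize liftTotal α q ![v 0] = x
  generalize liftTotal ξ q ![v 0] = y
  generalize liftTotal η q ![v 0] = z
  generalize liftTotal α q ![v 1] = x'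
  generalize liftTotal ξ q ![v 1] = y'
  generalize liftTotal η q ![v 1] = z'
  generalize liftBase (I' := I') pr σ₁ q ![v 0, v 1] = k₁
  generalize liftBase (I' := I') pr σ₂ q ![v 0, v 1] = k₂
  generalize liftBase (I' := I') pr σ₃ q ![v 0, v 1] = k₃
  generalize dtForm q ![v 0] = t
  generalize dtForm q ![v 1] = t'
  generalize Real.exp (-(4 / (2 * (n : ℝ) + 1)) * q.1) = f
  generalize Real.exp (2 * q.1) = m
  have e₁ : q₂ * (a * q₂ - b * q₁) - q₃ * (c * q₁ - a * q₃) = a := by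
    linear_combination a * hq - q₁ * hpq
  have e₂ : q₃ * (b * q₃ - c * q₂) - q₁ * (a * q₂ - b * q₁) = b := by
    linear_combination b * hq - q₂ * hpq
  have e₃ : q₁ * (c * q₁ - a * q₃) - q₂ * (b * q₃ - c * q₂) = c := by
    linear_combination c * hq - q₃ * hpq
  linear_combination f * (2 * m) ^ 2 * ((y * z' - y' * z) * e₁ + (x * z' - x' * z) * e₂
    - (x * y' - x' * y) * e₃)

end

theorem mainTheorem7 (n : ℕ)
    {M : Type*} [TopologicalSpace M] [T2Space M]
    [ChartedSpace (EuclideanSpace ℝ (Fin (4 * n))) M] [IsManifold (𝓡 (4 * n)) ∞ M]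
    {P : Type*} [TopologicalSpace P] [T2Space P]
    [ChartedSpace (EuclideanSpace ℝ (Fin (4 * n + 3))) P] [IsManifold (𝓡 (4 * n + 3)) ∞ P]
    [MulAction Torus3 P]
    (gM : BilinField (𝓡 (4 * n)) M) (J₁ J₂ J₃ : EndField (𝓡 (4 * n)) M)
    (σ₁ σ₂ σ₃ : DForm (𝓡 (4 * n)) M 2 ℝ)
    (hM : IsHyperKahler gM J₁ J₂ J₃ σ₁ σ₂ σ₃)
    (pr : P → M) (hpr : IsPrincipalTorusBundle (𝓡 (4 * n)) (𝓡 (4 * n + 3)) pr)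
    (α ξ η : DForm (𝓡 (4 * n + 3)) P 1 ℝ)
    (hconn : IsTorusConnection (𝓡 (4 * n + 3)) ![α, ξ, η])
    (hα : α.d = DForm.pullback (𝓡 (4 * n)) pr σ₁)
    (hξ : ξ.d = -DForm.pullback (𝓡 (4 * n)) pr σ₂)
    (hη : η.d = -DForm.pullback (𝓡 (4 * n)) pr σ₃)
    (a b c : ℝ) (habc : a ^ 2 + b ^ 2 + c ^ 2 = 1) :
    IsBalancedHermitian (2 * n + 2)
      (fun q => conformalFactor n q • metricN pr gM α ξ η q)
      (fun q => a • (conformalFactor n q • omega₁ pr σ₁ α ξ η q)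
        + b • (conformalFactor n q • omega₂ pr σ₂ α ξ η q)
        + c • (conformalFactor n q • omega₃ pr σ₃ α ξ η q)) := by
  obtain ⟨q₁, q₂, q₃, hq, hpq⟩ := exists_oriented_frame a b c
  rw [← adaptedMetric_coframeForm n pr α ξ η gM habc hq hpq,
    ← adaptedForm_coframeForm n pr α ξ η σ₁ σ₂ σ₃ hq hpq]
  exact (isAdapted_coframeForm hM hpr hconn hα hξ hη (by simp) (by simp) habc hq
    hpq).isBalancedHermitian
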